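/- Fix $\varepsilon>0$. There is a randomized algorithm that, given a set $S$ of $n\ge 2$ points in $\mathbb{R}^3$ and a query point $y\in\mathbb{R}^3$, returns two distinct points $a,b\in S$ such that the Euclidean distance from $y$ to the line through $a$ and $b$ is at most $(1+\varepsilon)$ times the distance from $y$ to the line through any two distinct points of $S$, and that runs in time $O_\varepsilon(n\log^3 n)$ with high probability. Precisely: the algorithm is a single finite program, depending only on $\varepsilon$, for a real RAM. This machine operates at unit cost on $w$-bit words (unsigned $+,-,\times$ and integer division modulo $2^w$, comparisons, array indexing) and on exact real numbers (rational constants, $+,-,\times,/$, comparisons, arrays, conversion of a word to a real, but no rounding of reals to words and no roots). It can draw, at unit cost, a fresh uniformly random integer from $\{0,\dots,m-1\}$ for any nonzero word $m$. There is a constant $\kappa$, depending only on $\varepsilon$, such that the following holds for every word length $w\ge\kappa\log_2 n$, every $S$ and every $y$. Whenever the program halts, its output is correct in the above sense. Moreover, for every $c\in\mathbb{N}$ there is a constant $C$, depending only on $\varepsilon$ and $c$, such that with probability at least $1-n^{-c}$ the program halts within $C\,n\log^3 n$ steps. -/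

import Mathlib

open scoped ENNReal

/-!  # A randomized real RAM

Programs in a small imperative language over two kinds of data: machine words of `w` bits
(integers and array indices) and exact real numbers.  There are finitely many scalar variables and
arrays per program, words are used as indices, real arithmetic is exact, and there is no
operation that turns a real into a word (no rounding), nor any root extraction.  One step of the
machine executes one assignment, one test, one draw of a random integer, or one unfolding of a
sequential composition.  A program is a fixed finite text, which knows neither the input size
nor the word length, so an assignment stands for a bounded number of elementary operations. -/

namespace RealRAM

/-- Word expressions: constants, variables, array entries, and arithmetic. -/
inductive WExp : Type
  | const (m : ℕ)
  | var (x : ℕ)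
  | get (a : ℕ) (i : WExp)
  | add (e f : WExp)
  | sub (e f : WExp)
  | mul (e f : WExp)
  | div (e f : WExp)

/-- Real expressions: rational constants, variables, array entries, the real value of a word,
and arithmetic. -/
inductive RExp : Type
  | const (q : ℚ)
  | var (x : ℕ)
  | get (a : ℕ) (i : WExp)
  | ofWord (e : WExp)
  | add (e f : RExp)
  | sub (e f : RExp)
  | mul (e f : RExp)
  | div (e f : RExp)

/-- Tests: comparisons of words, comparisons of reals, and Boolean combinations. -/
inductive Test : Type
  | wordLt (e f : WExp)
  | realLt (e f : RExp)
  | neg (b : Test)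
  | both (b c : Test)

/-- Programs. -/
inductive Prog : Type
  | skip
  /-- word variable `x` receives `e` -/
  | setWord (x : ℕ) (e : WExp)
  /-- real variable `x` receives `e` -/
  | setReal (x : ℕ) (e : RExp)
  /-- entry `i` of word array `a` receives `e` -/
  | putWord (a : ℕ) (i e : WExp)
  /-- entry `i` of real array `a` receives `e` -/
  | putReal (a : ℕ) (i : WExp) (e : RExp)
  /-- word variable `x` receives a fresh uniformly random element of `{0, …, e - 1}` -/
  | sample (x : ℕ) (e : WExp)
  | seq (P Q : Prog)
  | cond (b : Test) (P Q : Prog)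
  /-- execute `P` as long as `b` holds -/
  | loop (b : Test) (P : Prog)

/-- The memory of the machine with `w`-bit words. -/
structure Memory (w : ℕ) where
  word : ℕ → BitVec w
  real : ℕ → ℝ
  wordArr : ℕ → BitVec w → BitVec w
  realArr : ℕ → BitVec w → ℝ

/-- Word arithmetic is unsigned and modulo `2 ^ w`; `div` is the integer quotient, and `0` if
the divisor is `0`. -/
def WExp.eval {w : ℕ} (μ : Memory w) : WExp → BitVec w
  | .const m => BitVec.ofNat w m
  | .var x => μ.word x
  | .get a i => μ.wordArr a (i.eval μ)
  | .add e f => e.eval μ + f.eval μ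
  | .sub e f => e.eval μ - f.eval μ
  | .mul e f => e.eval μ * f.eval μ
  | .div e f => e.eval μ / f.eval μ

/-- Real arithmetic is exact; a division by `0` gives `0`. -/
noncomputable def RExp.eval {w : ℕ} (μ : Memory w) : RExp → ℝ
  | .const q => (q : ℝ)
  | .var x => μ.real x
  | .get a i => μ.realArr a (i.eval μ)
  | .ofWord e => ((e.eval μ).toNat : ℝ)
  | .add e f => e.eval μ + f.eval μ
  | .sub e f => e.eval μ - f.eval μ
  | .mul e f => e.eval μ * f.eval μ
  | .div e f => e.eval μ / f.eval μ

def Test.Holds {w : ℕ} (μ : Memory w) : Test → Prop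
  | .wordLt e f => (e.eval μ).toNat < (f.eval μ).toNat
  | .realLt e f => e.eval μ < f.eval μ
  | .neg b => ¬ b.Holds μ
  | .both b c => b.Holds μ ∧ c.Holds μ

/-- The uniform distribution on `{0, …, m - 1}`, as words (the word `0` if `m = 0`). -/
noncomputable def uniformBelow (w : ℕ) : ℕ → PMF (BitVec w)
  | 0 => PMF.pure 0
  | m + 1 => (PMF.uniformOfFintype (Fin (m + 1))).map fun i => BitVec.ofNat w i

/-- A configuration: the stack of programs that remain to be executed, and the memory. -/
structure Config (w : ℕ) where
  todo : List Prog
  mem : Memory w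

/-- The machine has halted when nothing remains to be executed. -/
def Config.Halted {w : ℕ} (γ : Config w) : Prop := γ.todo = []

open Classical in
/-- One step of the machine, as a probability distribution on the next configuration; a halted
configuration does not change. -/
noncomputable def step {w : ℕ} : Config w → PMF (Config w)
  | ⟨[], μ⟩ => PMF.pure ⟨[], μ⟩
  | ⟨.skip :: k, μ⟩ => PMF.pure ⟨k, μ⟩
  | ⟨.setWord x e :: k, μ⟩ =>
      PMF.pure ⟨k, { μ with word := Function.update μ.word x (e.eval μ) }⟩
  | ⟨.setReal x e :: k, μ⟩ =>
      PMF.pure ⟨k, { μ with real := Function.update μ.real x (e.eval μ) }⟩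
  | ⟨.putWord a i e :: k, μ⟩ =>
      PMF.pure ⟨k, { μ with
        wordArr := Function.update μ.wordArr a
          (Function.update (μ.wordArr a) (i.eval μ) (e.eval μ)) }⟩
  | ⟨.putReal a i e :: k, μ⟩ =>
      PMF.pure ⟨k, { μ with
        realArr := Function.update μ.realArr a
          (Function.update (μ.realArr a) (i.eval μ) (e.eval μ)) }⟩
  | ⟨.sample x e :: k, μ⟩ =>
      (uniformBelow w (e.eval μ).toNat).map fun r =>
        ⟨k, { μ with word := Function.update μ.word x r }⟩
  | ⟨.seq P Q :: k, μ⟩ => PMF.pure ⟨P :: Q :: k, μ⟩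
  | ⟨.cond b P Q :: k, μ⟩ => PMF.pure ⟨(if b.Holds μ then P else Q) :: k, μ⟩
  | ⟨.loop b P :: k, μ⟩ =>
      PMF.pure ⟨if b.Holds μ then P :: .loop b P :: k else k, μ⟩

/-- The distribution of the configuration after `t` steps. -/
noncomputable def run {w : ℕ} : ℕ → Config w → PMF (Config w)
  | 0, γ => PMF.pure γ
  | t + 1, γ => (step γ).bind (run t)

end RealRAM

namespace NearestLine

/-- Three-dimensional Euclidean space. -/
abbrev E3 : Type := EuclideanSpace ℝ (Fin 3)

/-- The Euclidean distance from `y` to the line through `a` and `b`. -/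
noncomputable def lineDist (y a b : E3) : ℝ :=
  Metric.infDist y (line[ℝ, a, b] : Set E3)

/-- The input convention: word variable `0` holds the number `n` of points, entry `i < n` of
real array `j < 3` holds coordinate `j` of the `i`-th point, real variable `j < 3` holds
coordinate `j` of the query point, and all the rest of the memory is `0`. -/
noncomputable def inputMemory (w : ℕ) {n : ℕ} (p : Fin n ↪ E3) (y : E3) : RealRAM.Memory w where
  word x := if x = 0 then BitVec.ofNat w n else 0
  real x := if h : x < 3 then y ⟨x, h⟩ else 0
  wordArr _ _ := 0
  realArr a i := if h : a < 3 ∧ i.toNat < n then p ⟨i.toNat, h.2⟩ ⟨a, h.1⟩ else 0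

/-- The initial configuration of program `P` on the point set `p` and the query point `y`. -/
noncomputable def start (P : RealRAM.Prog) (w : ℕ) {n : ℕ} (p : Fin n ↪ E3) (y : E3) :
    RealRAM.Config w :=
  ⟨[P], inputMemory w p y⟩

/-- The output convention: word variables `1` and `2` hold the indices of two distinct points.
The output is `(1 + ε)`-approximate if the line through these two is at distance at most
`(1 + ε)` times the distance of any line through two distinct points of the set. -/
def IsApproxOutput (ε : ℝ) {w n : ℕ} (p : Fin n ↪ E3) (y : E3) (μ : RealRAM.Memory w) : Prop :=
  ∃ i j : Fin n, i ≠ j ∧ (μ.word 1).toNat = i ∧ (μ.word 2).toNat = j ∧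
    ∀ a b : Fin n, a ≠ b → lineDist y (p i) (p j) ≤ (1 + ε) * lineDist y (p a) (p b)

end NearestLine

/-!
The algorithm is deterministic, so it halts in time with probability one.

Move the query point to the origin. The line through `a` and `b` has distance `D / N` from the origin,
where `D` is the sine of the angle between the directions of `a` and `b` (up to sign), and `N` is the
distance between their images under the inversion at the unit sphere (`le_lineSq_iff`). Both are
metrics, so the nearest line is the pair that the inversion stretches most with respect to `D`. By
the triangle inequality for `N`, it is enough to try the edges of a spanner for `D`: if all edges are
stretched by at most `M`, then so are all pairs, up to a factor near `1` (`spanner_stretch`).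

In a small cell of the projective plane, `D` is approximately a Euclidean norm in the coordinates of
a central projection (`sine_flat`), and a theta graph is a spanner: each point is joined, for each
narrow cone, to the point of the cone with the least value of a linear coordinate. A cone in the
plane is a quadrant with respect to two linear functions. So, after sorting by the first function,
a merge sort by the second one finds these neighbours: whenever two blocks are merged, an element of
the left block is tried together with the best one of the preceding elements of the right block
(`wp_dominance`). It is harmless to try additional pairs. This handles all pairs whose directions
almost agree up to sign (`near_le`).

If the directions of `a` and `b` are far apart, and `a` is nearer to the origin than `b`, then `a` can be
replaced by the nearest point to the origin in its cell of directions (`far_le`). Such pairs are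
found by trying the nearest point of each cell with all other points (`wp_scanCell`).

The number of cells and cones depends only on `ε`, so the total time is `O(n log n)`. Running times are
derived together with correctness from the rules for `WP`, a weakest precondition with a time bound.
-/

namespace RealRAM

/-! ### Deterministic executions and their running time -/

theorem run_add {w : ℕ} (s t : ℕ) (γ : Config w) : run (s + t) γ = (run s γ).bind (run t) := by
  induction s generalizing γ with
  | zero => simp [run, PMF.pure_bind]
  | succ s ih =>
    rw [Nat.succ_add]
    simp only [run, PMF.bind_bind]
    congr 1
    funext γ'
    exact ih γ'

theorem run_halted {w : ℕ} (t : ℕ) (μ : Memory w) : run t ⟨[], μ⟩ = PMF.pure ⟨[], μ⟩ := by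
  induction t with
  | zero => rfl
  | succ t ih => simp [run, step, PMF.pure_bind, ih]

/-- `P` turns the memory `μ` into `μ'` in exactly `t` steps, with probability one and whatever
programs remain on the stack below it. -/
def Exec {w : ℕ} (P : Prog) (μ μ' : Memory w) (t : ℕ) : Prop :=
  ∀ k, run t ⟨P :: k, μ⟩ = PMF.pure ⟨k, μ'⟩

/-- Weakest precondition with a time bound: from `μ`, the program `P` terminates with certainty
within `T` steps in a memory that satisfies `Q`. -/
def WP {w : ℕ} (P : Prog) (T : ℕ) (Q : Memory w → Prop) (μ : Memory w) : Prop :=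
  ∃ t ≤ T, ∃ μ', Exec P μ μ' t ∧ Q μ'

theorem WP.mono {w : ℕ} {P : Prog} {T T' : ℕ} {Q Q' : Memory w → Prop} {μ : Memory w}
    (h : WP P T Q μ) (hT : T ≤ T') (hQ : ∀ μ', Q μ' → Q' μ') : WP P T' Q' μ := by
  obtain ⟨t, ht, μ', he, hq⟩ := h
  exact ⟨t, ht.trans hT, μ', he, hQ _ hq⟩

/-- The memory after `v` has been written to the word variable `x`. -/
def setW {w : ℕ} (μ : Memory w) (x : ℕ) (v : BitVec w) : Memory w :=
  { μ with word := Function.update μ.word x v }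

/-- The memory after `v` has been written to the real variable `x`. -/
def setR {w : ℕ} (μ : Memory w) (x : ℕ) (v : ℝ) : Memory w :=
  { μ with real := Function.update μ.real x v }

/-- The memory after `v` has been written to entry `i` of the word array `a`. -/
def putW {w : ℕ} (μ : Memory w) (a : ℕ) (i v : BitVec w) : Memory w :=
  { μ with wordArr := Function.update μ.wordArr a (Function.update (μ.wordArr a) i v) }

theorem wp_skip {w : ℕ} {Q : Memory w → Prop} {μ : Memory w} (h : Q μ) : WP .skip 1 Q μ :=
  ⟨1, le_rfl, μ, fun k => by simp [run, step], h⟩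

theorem wp_setWord {w : ℕ} {x : ℕ} {e : WExp} {Q : Memory w → Prop} {μ : Memory w}
    (h : Q (setW μ x (e.eval μ))) : WP (.setWord x e) 1 Q μ :=
  ⟨1, le_rfl, _, fun k => by simp [run, step, setW], h⟩

theorem wp_setReal {w : ℕ} {x : ℕ} {e : RExp} {Q : Memory w → Prop} {μ : Memory w}
    (h : Q (setR μ x (e.eval μ))) : WP (.setReal x e) 1 Q μ :=
  ⟨1, le_rfl, _, fun k => by simp [run, step, setR], h⟩

theorem wp_putWord {w : ℕ} {a : ℕ} {i e : WExp} {Q : Memory w → Prop} {μ : Memory w}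
    (h : Q (putW μ a (i.eval μ) (e.eval μ))) : WP (.putWord a i e) 1 Q μ :=
  ⟨1, le_rfl, _, fun k => by simp [run, step, putW], h⟩

theorem wp_seq {w : ℕ} {P R : Prog} {T₁ T₂ : ℕ} {Q : Memory w → Prop} {μ : Memory w}
    (h : WP P T₁ (WP R T₂ Q) μ) : WP (.seq P R) (1 + T₁ + T₂) Q μ := by
  obtain ⟨t₁, ht₁, μ₁, he₁, t₂, ht₂, μ₂, he₂, hq⟩ := h
  refine ⟨1 + t₁ + t₂, by omega, μ₂, fun k => ?_, hq⟩
  rw [add_assoc, run_add]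
  simp only [run, step, PMF.pure_bind]
  rw [run_add, he₁, PMF.pure_bind, he₂]

theorem wp_cond {w : ℕ} {b : Test} {P R : Prog} {T : ℕ} {Q : Memory w → Prop} {μ : Memory w}
    (h₁ : b.Holds μ → WP P T Q μ) (h₂ : ¬ b.Holds μ → WP R T Q μ) :
    WP (.cond b P R) (1 + T) Q μ := by
  by_cases hb : b.Holds μ
  · obtain ⟨t, ht, μ', he, hq⟩ := h₁ hb
    refine ⟨1 + t, by omega, μ', fun k => ?_, hq⟩
    rw [run_add]
    simp only [run, step, PMF.pure_bind, hb, if_true, he _]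
  · obtain ⟨t, ht, μ', he, hq⟩ := h₂ hb
    refine ⟨1 + t, by omega, μ', fun k => ?_, hq⟩
    rw [run_add]
    simp only [run, step, PMF.pure_bind, hb, if_false, he _]

/-- Total correctness of a loop, with an invariant `I` and a potential `Φ` that pays for the
steps: one iteration, including its test, may cost at most what it takes from the potential. -/
theorem wp_loop {w : ℕ} {b : Test} {P : Prog} (I : Memory w → Prop) (Φ : Memory w → ℕ)
    (h : ∀ μ, I μ → b.Holds μ → ∃ T, WP P T (fun μ' => I μ' ∧ T + 1 + Φ μ' ≤ Φ μ) μ)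
    {μ : Memory w} (hμ : I μ) :
    WP (.loop b P) (Φ μ + 1) (fun μ' => I μ' ∧ ¬ b.Holds μ') μ := by
  induction hm : Φ μ using Nat.strong_induction_on generalizing μ with
  | _ m ih =>
    by_cases hb : b.Holds μ
    · obtain ⟨T, t, ht, μ₁, he₁, hI, hΦ⟩ := h μ hμ hb
      obtain ⟨t₂, ht₂, μ₂, he₂, hq⟩ := ih (Φ μ₁) (by omega) hI rfl
      refine ⟨1 + t + t₂, by omega, μ₂, fun k => ?_, hq⟩
      rw [add_assoc, run_add]
      simp only [run, step, PMF.pure_bind, hb, if_true]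
      rw [run_add, he₁, PMF.pure_bind, he₂]
    · exact ⟨1, by omega, μ, fun k => by simp [run, step, hb], hμ, hb⟩

/-- The programs of a list, one after the other. -/
def Prog.all : List Prog → Prog
  | [] => .skip
  | P :: l => .seq P (Prog.all l)

/-- If every task of the list preserves `I`, does not increase the real variable `3`, and makes it
so small that the task's own property `F a` holds, then in the end all these properties hold. -/
theorem wp_all {w : ℕ} {α : Type*} (prog : α → Prog) (I : Memory w → Prop) (F : α → ℝ → Prop)
    (hF : ∀ a, Antitone (F a)) (T : ℕ) (l : List α)
    (h : ∀ a ∈ l, ∀ μ, I μ →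
      WP (prog a) T (fun μ' => I μ' ∧ μ'.real 3 ≤ μ.real 3 ∧ F a (μ'.real 3)) μ)
    (μ : Memory w) (hμ : I μ) :
    WP (Prog.all (l.map prog)) (l.length * (T + 1) + 1)
      (fun μ' => I μ' ∧ μ'.real 3 ≤ μ.real 3 ∧ ∀ a ∈ l, F a (μ'.real 3)) μ := by
  induction l generalizing μ with
  | nil => exact (wp_skip (by simpa using hμ)).mono (by simp) (fun _ h => h)
  | cons a l ih =>
    refine (wp_seq ((h a (by simp) μ hμ).mono le_rfl fun μ₁ h₁ =>
      (ih (fun b hb => h b (by simp [hb])) μ₁ h₁.1).mono le_rfl fun μ₂ h₂ => ?_)).mono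
        (by simp only [List.length_cons, add_mul]; omega) (fun _ h => h)
    refine ⟨h₂.1, h₂.2.1.trans h₁.2.1, fun b hb => ?_⟩
    rcases List.mem_cons.1 hb with rfl | hb
    · exact hF _ h₂.2.1 h₁.2.2
    · exact h₂.2.2 b hb

/-! ### Words as natural numbers -/

/-- The value of a word variable as a natural number. -/
def reg {w : ℕ} (μ : Memory w) (x : ℕ) : ℕ := (μ.word x).toNat

/-- The contents of a word array as natural numbers; only indices below `2 ^ w` are meaningful. -/
def arr {w : ℕ} (μ : Memory w) (a i : ℕ) : ℕ := (μ.wordArr a (BitVec.ofNat w i)).toNat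

theorem toNat_var {w : ℕ} (μ : Memory w) (x : ℕ) : ((WExp.var x).eval μ).toNat = reg μ x := rfl

theorem toNat_get {w : ℕ} (μ : Memory w) (a x : ℕ) :
    ((WExp.get a (.var x)).eval μ).toNat = arr μ a (reg μ x) := by
  simp [WExp.eval, arr, reg]

theorem toNat_const {w : ℕ} (μ : Memory w) {m : ℕ} (hm : m < 2 ^ w) :
    ((WExp.const m).eval μ).toNat = m := by
  simp [WExp.eval, Nat.mod_eq_of_lt hm]

theorem toNat_add {w : ℕ} (μ : Memory w) {e f : WExp}
    (h : (e.eval μ).toNat + (f.eval μ).toNat < 2 ^ w) :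
    ((WExp.add e f).eval μ).toNat = (e.eval μ).toNat + (f.eval μ).toNat := by
  simp [WExp.eval, Nat.mod_eq_of_lt h]

@[simp] theorem reg_setW {w : ℕ} (μ : Memory w) (x : ℕ) (v : BitVec w) (y : ℕ) :
    reg (setW μ x v) y = if y = x then v.toNat else reg μ y := by
  unfold reg setW Function.update
  split <;> simp_all

@[simp] theorem arr_setW {w : ℕ} (μ : Memory w) (x : ℕ) (v : BitVec w) :
    arr (setW μ x v) = arr μ := rfl

@[simp] theorem real_setW {w : ℕ} (μ : Memory w) (x : ℕ) (v : BitVec w) :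
    (setW μ x v).real = μ.real := rfl

@[simp] theorem realArr_setW {w : ℕ} (μ : Memory w) (x : ℕ) (v : BitVec w) :
    (setW μ x v).realArr = μ.realArr := rfl

@[simp] theorem reg_setR {w : ℕ} (μ : Memory w) (x : ℕ) (v : ℝ) :
    reg (setR μ x v) = reg μ := rfl

@[simp] theorem real_setR {w : ℕ} (μ : Memory w) (x : ℕ) (v : ℝ) (y : ℕ) :
    (setR μ x v).real y = if y = x then v else μ.real y := by
  unfold setR Function.update
  split <;> simp_all

@[simp] theorem realArr_setR {w : ℕ} (μ : Memory w) (x : ℕ) (v : ℝ) :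
    (setR μ x v).realArr = μ.realArr := rfl

@[simp] theorem reg_putW {w : ℕ} (μ : Memory w) (a : ℕ) (i v : BitVec w) :
    reg (putW μ a i v) = reg μ := rfl

@[simp] theorem real_putW {w : ℕ} (μ : Memory w) (a : ℕ) (i v : BitVec w) :
    (putW μ a i v).real = μ.real := rfl

@[simp] theorem realArr_putW {w : ℕ} (μ : Memory w) (a : ℕ) (i v : BitVec w) :
    (putW μ a i v).realArr = μ.realArr := rfl

theorem arr_putW {w : ℕ} (μ : Memory w) (a : ℕ) (i v : BitVec w) {j : ℕ} (hj : j < 2 ^ w) :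
    arr (putW μ a i v) a j = if j = i.toNat then v.toNat else arr μ a j := by
  have : BitVec.ofNat w j = i ↔ j = i.toNat := by
    rw [← BitVec.toNat_inj, BitVec.toNat_ofNat, Nat.mod_eq_of_lt hj]
  unfold arr putW
  simp only [Function.update_self, Function.update_apply, this]
  split <;> rfl

theorem arr_putW_ne {w : ℕ} (μ : Memory w) {a a' : ℕ} (i v : BitVec w) (h : a' ≠ a) :
    arr (putW μ a i v) a' = arr μ a' := by
  funext j
  simp [arr, putW, h]

end RealRAM

namespace NearestLine

open RealRAM

/-! ### Expressions for the geometry, and the current best pair -/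

/-- The square of the distance from the origin to the line through two vectors of `ℝ³`, given by
their coordinates; it is `0` (a division by zero) when the vectors agree. -/
noncomputable def lineSq (a b : ℕ → ℝ) : ℝ :=
  ((a 0 * b 1 - a 1 * b 0) * (a 0 * b 1 - a 1 * b 0) +
    (a 1 * b 2 - a 2 * b 1) * (a 1 * b 2 - a 2 * b 1) +
    (a 2 * b 0 - a 0 * b 2) * (a 2 * b 0 - a 0 * b 2)) /
  ((a 0 - b 0) * (a 0 - b 0) + (a 1 - b 1) * (a 1 - b 1) + (a 2 - b 2) * (a 2 - b 2))

/-- The square of the norm of a vector of `ℝ³`. -/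
def normSq (a : ℕ → ℝ) : ℝ := a 0 * a 0 + a 1 * a 1 + a 2 * a 2

/-- Coordinate `c` of the vector from the query point to the point with index `e`. -/
def vecE (c : ℕ) (e : WExp) : RExp := .sub (.get c e) (.var c)

/-- The expression for a square. -/
def sqE (e : RExp) : RExp := .mul e e

/-- A coordinate of the cross product of the vectors to two points. -/
def crossE (c d : ℕ) (e f : WExp) : RExp :=
  .sub (.mul (vecE c e) (vecE d f)) (.mul (vecE d e) (vecE c f))

/-- Coordinate `c` of the difference of two points. -/
def diffE (c : ℕ) (e f : WExp) : RExp := .sub (vecE c e) (vecE c f)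

/-- The expression for `lineSq`. -/
def lineSqE (e f : WExp) : RExp :=
  .div (.add (.add (sqE (crossE 0 1 e f)) (sqE (crossE 1 2 e f))) (sqE (crossE 2 0 e f)))
    (.add (.add (sqE (diffE 0 e f)) (sqE (diffE 1 e f))) (sqE (diffE 2 e f)))

/-- The expression for `normSq`. -/
def normSqE (e : WExp) : RExp := .add (.add (sqE (vecE 0 e)) (sqE (vecE 1 e))) (sqE (vecE 2 e))

/-- The memory holds the vectors `vec i` from the query point to the points. -/
def HasVec {w : ℕ} (vec : ℕ → ℕ → ℝ) (μ : Memory w) : Prop :=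
  ∀ c < 3, ∀ b, μ.realArr c b - μ.real c = vec b.toNat c

variable {w n : ℕ} {vec : ℕ → ℕ → ℝ}

theorem eval_vecE {μ : Memory w} (h : HasVec vec μ) {c : ℕ} (hc : c < 3) (e : WExp) :
    (vecE c e).eval μ = vec (e.eval μ).toNat c := h c hc _

theorem eval_lineSqE {μ : Memory w} (h : HasVec vec μ) (e f : WExp) :
    (lineSqE e f).eval μ = lineSq (vec (e.eval μ).toNat) (vec (f.eval μ).toNat) := by
  simp only [lineSqE, sqE, crossE, diffE, RExp.eval, eval_vecE h (show 0 < 3 by norm_num),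
    eval_vecE h (show 1 < 3 by norm_num), eval_vecE h (show 2 < 3 by norm_num), lineSq]

theorem eval_normSqE {μ : Memory w} (h : HasVec vec μ) (e : WExp) :
    (normSqE e).eval μ = normSq (vec (e.eval μ).toNat) := by
  simp only [normSqE, sqE, RExp.eval, eval_vecE h (show 0 < 3 by norm_num),
    eval_vecE h (show 1 < 3 by norm_num), eval_vecE h (show 2 < 3 by norm_num), normSq]

/-- The invariant of the whole program: the input is intact, the word variables `1` and `2` hold
the indices of two distinct points, and the real variable `3` the square of the distance of
their line. -/
structure Ok (n : ℕ) (vec : ℕ → ℕ → ℝ) (μ : Memory w) : Prop where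
  reg_zero : reg μ 0 = n
  hasVec : HasVec vec μ
  lt_one : reg μ 1 < n
  lt_two : reg μ 2 < n
  ne : reg μ 1 ≠ reg μ 2
  real_three : μ.real 3 = lineSq (vec (reg μ 1)) (vec (reg μ 2))

theorem Ok.setW {μ : Memory w} (h : Ok n vec μ) {x : ℕ} (hx : 2 < x) (v : BitVec w) :
    Ok n vec (setW μ x v) := by
  have h0 : 0 ≠ x := by omega
  have h1 : 1 ≠ x := by omega
  have h2 : 2 ≠ x := by omega
  obtain ⟨a, b, c, d, e, f⟩ := h
  constructor <;> simpa [h0, h1, h2, HasVec]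

theorem Ok.putW {μ : Memory w} (h : Ok n vec μ) (a : ℕ) (i v : BitVec w) :
    Ok n vec (putW μ a i v) := by
  obtain ⟨a, b, c, d, e, f⟩ := h
  constructor <;> simpa [HasVec]

/-- Replace the current best pair by the points with indices in the variables `x` and `y`, if
these are distinct points whose line is nearer. -/
def tryPair (x y : ℕ) : Prog :=
  .cond (.both (.both (.wordLt (.var x) (.var 0)) (.wordLt (.var y) (.var 0)))
      (.both (.neg (.both (.neg (.wordLt (.var x) (.var y))) (.neg (.wordLt (.var y) (.var x)))))
        (.realLt (lineSqE (.var x) (.var y)) (.var 3))))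
    (.seq (.setReal 3 (lineSqE (.var x) (.var y))) (.seq (.setWord 1 (.var x)) (.setWord 2 (.var y))))
    .skip

theorem wp_tryPair {μ : Memory w} (h : Ok n vec μ) {x y : ℕ} (_ : 2 < x) (hy : 2 < y) :
    WP (tryPair x y) 6 (fun μ' => Ok n vec μ' ∧ μ'.real 3 ≤ μ.real 3 ∧
      (reg μ x < n → reg μ y < n → reg μ x ≠ reg μ y →
        μ'.real 3 ≤ lineSq (vec (reg μ x)) (vec (reg μ y))) ∧
      (∀ z > 2, reg μ' z = reg μ z) ∧ arr μ' = arr μ) μ := by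
  have hy1 : y ≠ 1 := by omega
  refine wp_cond (T := 5) (fun hb => ?_) (fun hb => ?_)
  · simp only [Test.Holds, eval_lineSqE h.hasVec, toNat_var, h.reg_zero] at hb
    refine wp_seq (T₁ := 1) (T₂ := 3) (wp_setReal (wp_seq (T₁ := 1) (T₂ := 1)
      (wp_setWord (wp_setWord ?_))))
    rw [eval_lineSqE h.hasVec, toNat_var, toNat_var]
    obtain ⟨⟨hxn, hyn⟩, hne, hlt⟩ := hb
    have hne' : reg μ x ≠ reg μ y := by omega
    refine ⟨⟨?_, ?_, ?_, ?_, ?_, ?_⟩, ?_, ?_, ?_, ?_⟩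
    · simpa using h.reg_zero
    · intro c hc b
      have : c ≠ 3 := by omega
      simpa [this] using h.hasVec c hc b
    · simpa [toNat_var] using hxn
    · simpa [toNat_var, hy1] using hyn
    · simpa [toNat_var, hy1] using hne'
    · simp [toNat_var, hy1]
    · simpa [RExp.eval] using hlt.le
    · simp
    · intro z hz
      have h1 : z ≠ 1 := by omega
      have h2 : z ≠ 2 := by omega
      simp [h1, h2]
    · rfl
  · refine (wp_skip ?_).mono (show 1 ≤ 5 by norm_num) fun _ h => h
    simp only [Test.Holds, eval_lineSqE h.hasVec, toNat_var, h.reg_zero] at hb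
    refine ⟨h, le_rfl, fun h1 h2 h3 => ?_, fun _ _ => rfl, rfl⟩
    by_contra hlt
    exact hb ⟨⟨h1, h2⟩, by omega, by simpa [RExp.eval] using hlt⟩

/-! ### The best member of a cell -/

/-- The test `T` decides the predicate `p` of point indices. -/
def Decides (vec : ℕ → ℕ → ℝ) (T : WExp → Test) (p : ℕ → Prop) : Prop :=
  ∀ ⦃w : ℕ⦄ ⦃μ : Memory w⦄, HasVec vec μ → ∀ e, (T e).Holds μ ↔ p (e.eval μ).toNat

/-- The test `T` decides the relation `r` between point indices. -/
def DecidesRel (vec : ℕ → ℕ → ℝ) (T : WExp → WExp → Test) (r : ℕ → ℕ → Prop) : Prop :=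
  ∀ ⦃w : ℕ⦄ ⦃μ : Memory w⦄, HasVec vec μ →
    ∀ e f, (T e f).Holds μ ↔ r (e.eval μ).toNat (f.eval μ).toNat

/-- The expression `K` computes the function `k` of point indices. -/
def Computes (vec : ℕ → ℕ → ℝ) (K : WExp → RExp) (k : ℕ → ℝ) : Prop :=
  ∀ ⦃w : ℕ⦄ ⦃μ : Memory w⦄, HasVec vec μ → ∀ e, (K e).eval μ = k (e.eval μ).toNat

/-- `m` minimizes `k` among the elements of `S` that satisfy `p`, where `m = n` stands for the
absence of such elements. -/
def IsBest (n : ℕ) (p : ℕ → Prop) (k : ℕ → ℝ) (S : ℕ → Prop) (m : ℕ) : Prop :=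
  (m = n ∧ ∀ i, S i → ¬ p i) ∨ (m < n ∧ S m ∧ p m ∧ ∀ i, S i → p i → k m ≤ k i)

theorem IsBest.congr {p : ℕ → Prop} {k : ℕ → ℝ} {S S' : ℕ → Prop} {m : ℕ}
    (h : IsBest n p k S m) (hS : ∀ i, S' i ↔ S i) : IsBest n p k S' m := by
  simpa only [IsBest, hS] using h

/-- Replace the best point so far, in the variable `3`, by the point in the variable `x`, if the
latter passes the test `T` and has a smaller key `K`. -/
def updateBest (T : WExp → Test) (K : WExp → RExp) (x : ℕ) : Prog :=
  .cond (.both (T (.var x)) (.neg (.both (.wordLt (.var 3) (.var 0))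
      (.neg (.realLt (K (.var x)) (K (.var 3)))))))
    (.setWord 3 (.var x)) .skip

theorem wp_updateBest {T : WExp → Test} {K : WExp → RExp} {p : ℕ → Prop} {k : ℕ → ℝ}
    (hT : Decides vec T p) (hK : Computes vec K k) {S : ℕ → Prop} {μ : Memory w}
    (h : Ok n vec μ) {x : ℕ} (hx : reg μ x < n) (hS : IsBest n p k S (reg μ 3)) :
    WP (updateBest T K x) 2 (fun μ' => ∃ v, μ' = setW μ 3 v ∧
      IsBest n p k (fun i => S i ∨ i = reg μ x) (reg μ' 3)) μ := by
  refine wp_cond (T := 1) (fun hb => wp_setWord ⟨_, rfl, ?_⟩)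
    (fun hb => wp_skip ⟨μ.word 3, ?_, ?_⟩)
  · simp only [Test.Holds, hT h.hasVec, hK h.hasVec, toNat_var, h.reg_zero] at hb
    obtain ⟨hp, hb⟩ := hb
    simp only [reg_setW, if_true, toNat_var]
    right
    refine ⟨hx, Or.inr rfl, hp, fun i hi hpi => ?_⟩
    rcases hi with hi | rfl
    · rcases hS with ⟨-, hS⟩ | ⟨h1, -, -, hS⟩
      · exact absurd hpi (hS i hi)
      · exact (not_le.1 fun hle => hb ⟨h1, not_lt.2 hle⟩).le.trans (hS i hi hpi)
    · exact le_rfl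
  · simp [RealRAM.setW]
  · simp only [Test.Holds, hT h.hasVec, hK h.hasVec, toNat_var, h.reg_zero, not_and, not_not,
      Classical.not_imp] at hb
    rcases hS with ⟨h1, hS⟩ | ⟨h1, h2, h3, hS⟩
    · refine Or.inl ⟨h1, fun i hi hpi => ?_⟩
      rcases hi with hi | rfl
      · exact hS i hi hpi
      · have := (hb hpi).1
        omega
    · refine Or.inr ⟨h1, Or.inl h2, h3, fun i hi hpi => ?_⟩
      rcases hi with hi | rfl
      · exact hS i hi hpi
      · exact not_lt.1 (hb hpi).2

/-- Add one to the word variable `x`. -/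
def incr (x : ℕ) : Prog := .setWord x (.add (.var x) (.const 1))

theorem toNat_incr {μ : Memory w} {x : ℕ} (h : reg μ x + 1 < 2 ^ w) :
    ((WExp.add (.var x) (.const 1)).eval μ).toNat = reg μ x + 1 := by
  have h1 : ((WExp.const 1).eval μ).toNat = 1 := toNat_const μ (by omega)
  rw [toNat_add, h1, toNat_var]
  rwa [h1, toNat_var]

/-- Find the point with the smallest key `K` among those that pass the test `T`, and try it
together with every other point. -/
def scanCell (T : WExp → Test) (K : WExp → RExp) : Prog :=
  .seq (.setWord 3 (.var 0)) (.seq (.setWord 4 (.const 0)) (.seq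
    (.loop (.wordLt (.var 4) (.var 0)) (.seq (updateBest T K 4) (incr 4)))
    (.seq (.setWord 4 (.const 0))
      (.loop (.wordLt (.var 4) (.var 0)) (.seq (tryPair 3 4) (incr 4))))))

/-- The value `v` is at most the squared distance of each line through the point that minimizes
`k` under the condition `p`. -/
def ScanGoal (n : ℕ) (vec : ℕ → ℕ → ℝ) (p : ℕ → Prop) (k : ℕ → ℝ) (v : ℝ) : Prop :=
  ∀ i < n, p i → ∃ m < n, p m ∧ k m ≤ k i ∧ ∀ j < n, j ≠ m → v ≤ lineSq (vec m) (vec j)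

theorem wp_scanCell {T : WExp → Test} {K : WExp → RExp} {p : ℕ → Prop} {k : ℕ → ℝ}
    (hw : n + 1 < 2 ^ w)
    (hT : Decides vec T p) (hK : Computes vec K k) {μ : Memory w} (h : Ok n vec μ) :
    WP (scanCell T K) (14 * n + 9) (fun μ' => Ok n vec μ' ∧ μ'.real 3 ≤ μ.real 3 ∧
      ScanGoal n vec p k (μ'.real 3)) μ := by
  refine WP.mono (wp_seq (T₁ := 1) (wp_setWord (wp_seq (T₁ := 1) (wp_setWord (wp_seq
    (T₁ := 5 * n + 1) (T₂ := 1 + 1 + (9 * n + 1)) ?_))))) (by omega) fun _ h => h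
  set μ₁ := setW (setW μ 3 ((WExp.var 0).eval μ)) 4 ((WExp.const 0).eval _) with hμ₁
  have h4 : reg μ₁ 4 = 0 := by
    simp only [hμ₁, reg_setW, if_true]
    exact toNat_const _ (by omega)
  refine (wp_loop (μ := μ₁) (fun μ' => Ok n vec μ' ∧ μ'.real 3 = μ.real 3 ∧ reg μ' 4 ≤ n ∧
    IsBest n p k (fun i => i < reg μ' 4) (reg μ' 3)) (fun μ' => 5 * (n - reg μ' 4)) ?_ ?_).mono
    (by omega) ?_
  · rintro μ' ⟨h1, h2, h3, h5⟩ hb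
    simp only [Test.Holds, toNat_var, h1.reg_zero] at hb
    refine ⟨4, wp_seq (T₁ := 2) (T₂ := 1) ((wp_updateBest hT hK h1 hb h5).mono le_rfl ?_)⟩
    rintro μ'' ⟨v, rfl, hv⟩
    refine wp_setWord ?_
    have : reg (setW μ' 3 v) 4 = reg μ' 4 := by simp
    have e := toNat_incr (μ := setW μ' 3 v) (x := 4) (by omega)
    rw [this] at e
    refine ⟨⟨(h1.setW (by norm_num) _).setW (by norm_num) _, by simpa using h2, ?_, ?_⟩, ?_⟩
    · simp only [reg_setW, if_true, e]
      omega
    · simp only [reg_setW, if_true, e]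
      simp only [reg_setW, if_true] at hv
      exact hv.congr fun i => by omega
    · simp only [reg_setW, if_true, e]
      omega
  · refine ⟨(h.setW (by norm_num) _).setW (by norm_num) _, by simp [hμ₁], by omega,
      Or.inl ⟨?_, by simp [h4]⟩⟩
    simpa [hμ₁, toNat_var] using h.reg_zero
  · rintro μ₂ ⟨⟨h1, h2, h3, h5⟩, hb⟩
    simp only [Test.Holds, toNat_var, h1.reg_zero] at hb
    refine wp_seq (wp_setWord ?_)
    have h42 : reg (setW μ₂ 4 ((WExp.const 0).eval μ₂)) 4 = 0 := by
      simp only [reg_setW, if_true]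
      exact toNat_const _ (by omega)
    refine (wp_loop (fun μ' => Ok n vec μ' ∧ μ'.real 3 ≤ μ.real 3 ∧ reg μ' 4 ≤ n ∧
      reg μ' 3 = reg μ₂ 3 ∧ (reg μ₂ 3 < n → ∀ j < reg μ' 4, j ≠ reg μ₂ 3 →
        μ'.real 3 ≤ lineSq (vec (reg μ₂ 3)) (vec j))) (fun μ' => 9 * (n - reg μ' 4)) ?_ ?_).mono
        (by omega) ?_
    · rintro μ' ⟨g1, g2, g3, g4, g5⟩ hb'
      simp only [Test.Holds, toNat_var, g1.reg_zero] at hb'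
      refine ⟨8, wp_seq (T₁ := 6) (T₂ := 1) ((wp_tryPair g1 (by norm_num) (by norm_num)).mono
        le_rfl ?_)⟩
      rintro μ'' ⟨k1, k2, k3, k4, -⟩
      refine wp_setWord ?_
      have e := toNat_incr (μ := μ'') (x := 4) (by rw [k4 _ (by norm_num)]; omega)
      rw [k4 _ (by norm_num)] at e
      refine ⟨⟨k1.setW (by norm_num) _, by simpa using k2.trans g2, ?_, ?_, ?_⟩, ?_⟩
      · simp only [reg_setW, if_true, e]
        omega
      · simp [k4, g4]
      · simp only [reg_setW, if_true, e, real_setW]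
        intro hm j hj hjm
        rcases Nat.lt_succ_iff_lt_or_eq.1 hj with hj | rfl
        · exact k2.trans (g5 hm j hj hjm)
        · rw [g4] at k3
          exact k3 hm hb' hjm.symm
      · simp only [reg_setW, if_true, e]
        omega
    · exact ⟨h1.setW (by norm_num) _, by simp [h2], by omega, by simp, by simp [h42]⟩
    · rintro μ₃ ⟨⟨g1, g2, g3, g4, g5⟩, hb'⟩
      simp only [Test.Holds, toNat_var, g1.reg_zero] at hb'
      refine ⟨g1, g2, fun i hi hpi => ?_⟩
      rcases h5 with ⟨-, h5⟩ | ⟨h5, -, h6, h7⟩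
      · exact absurd hpi (h5 i (by omega))
      · exact ⟨_, h5, h6, h7 i (by omega) hpi, fun j hj hjm => g5 h5 j (by omega) hjm⟩

/-! ### Segments of arrays -/

/-- The entries of the array `A` with indices from `lo` to `hi - 1`. -/
def seg (A : ℕ → ℕ) (lo hi : ℕ) : List ℕ := (List.range' lo (hi - lo)).map A

theorem mem_seg {A : ℕ → ℕ} {lo hi x : ℕ} : x ∈ seg A lo hi ↔ ∃ i, lo ≤ i ∧ i < hi ∧ A i = x := by
  simp only [seg, List.mem_map, List.mem_range'_1]
  constructor
  · rintro ⟨i, h, rfl⟩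
    exact ⟨i, by omega, by omega, rfl⟩
  · rintro ⟨i, h1, h2, rfl⟩
    exact ⟨i, by omega, rfl⟩

theorem seg_of_le {A : ℕ → ℕ} {lo hi : ℕ} (h : hi ≤ lo) : seg A lo hi = [] := by
  simp [seg, Nat.sub_eq_zero_of_le h]

theorem seg_cons {A : ℕ → ℕ} {lo hi : ℕ} (h : lo < hi) :
    seg A lo hi = A lo :: seg A (lo + 1) hi := by
  obtain ⟨d, rfl⟩ := Nat.exists_eq_add_of_lt h
  have e1 : lo + d + 1 - lo = d + 1 := by omega
  have e2 : lo + d + 1 - (lo + 1) = d := by omega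
  simp [seg, e1, e2, List.range'_succ]

theorem seg_append {A : ℕ → ℕ} {lo mid hi : ℕ} (h₁ : lo ≤ mid) (h₂ : mid ≤ hi) :
    seg A lo hi = seg A lo mid ++ seg A mid hi := by
  obtain ⟨d, rfl⟩ := Nat.exists_eq_add_of_le h₁
  obtain ⟨e, rfl⟩ := Nat.exists_eq_add_of_le h₂
  have e1 : lo + d + e - lo = d + e := by omega
  simp only [seg, e1, Nat.add_sub_cancel_left, ← List.map_append]
  rw [List.range'_append_1]

theorem seg_succ {A : ℕ → ℕ} {lo hi : ℕ} (h : lo ≤ hi) :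
    seg A lo (hi + 1) = seg A lo hi ++ [A hi] := by
  rw [seg_append h (Nat.le_succ hi), seg_cons (Nat.lt_succ_self hi), seg_of_le le_rfl]

theorem seg_congr {A B : ℕ → ℕ} {lo hi : ℕ} (h : ∀ i, lo ≤ i → i < hi → A i = B i) :
    seg A lo hi = seg B lo hi := by
  refine List.map_congr_left fun i hi => ?_
  rw [List.mem_range'_1] at hi
  exact h i (by omega) (by omega)

theorem length_seg (A : ℕ → ℕ) (lo hi : ℕ) : (seg A lo hi).length = hi - lo := by
  simp [seg]

/-! ### Merging two blocks -/

/-- The pairs that a merge of the blocks `L` and `R` has to try: for each element `a` of `L`, the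
elements of `R` that precede `a` in the order `r` and satisfy `p` are represented by one of
them with the smallest key. -/
def MergeGoal (vec : ℕ → ℕ → ℝ) (p : ℕ → Prop) (k : ℕ → ℝ) (r : ℕ → ℕ → Bool)
    (L R : List ℕ) (v : ℝ) : Prop :=
  ∀ a ∈ L, ∀ b ∈ R, p b → r b a →
    ∃ c ∈ R, p c ∧ r c a ∧ k c ≤ k b ∧ (a ≠ c → v ≤ lineSq (vec a) (vec c))

theorem MergeGoal.anti {p : ℕ → Prop} {k : ℕ → ℝ} {r : ℕ → ℕ → Bool} {L R : List ℕ} {v v' : ℝ}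
    (h : MergeGoal vec p k r L R v) (hv : v' ≤ v) : MergeGoal vec p k r L R v' := by
  intro a ha b hb h1 h2
  obtain ⟨c, h3, h4, h5, h6, h7⟩ := h a ha b hb h1 h2
  exact ⟨c, h3, h4, h5, h6, fun hac => hv.trans (h7 hac)⟩

/-- The state of a merge of `A[lo], …, A[mid - 1]` with `A[mid], …, A[hi - 1]` into the array `C`:
the elements from `i` and from `j` on remain, `C` is filled up to `o`, and `m` is the best of the
elements already taken from the right block. -/
structure MergeState (n : ℕ) (vec : ℕ → ℕ → ℝ) (p : ℕ → Prop) (k : ℕ → ℝ) (r : ℕ → ℕ → Bool)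
    (A : ℕ → ℕ) (lo mid hi i j o m : ℕ) (C : ℕ → ℕ) (v : ℝ) : Prop where
  lo_le : lo ≤ i
  le_mid : i ≤ mid
  mid_le : mid ≤ j
  le_hi : j ≤ hi
  out : o + mid = i + j
  merged : seg C lo o ++ List.merge (seg A j hi) (seg A i mid) r =
    List.merge (seg A mid hi) (seg A lo mid) r
  best : IsBest n p k (fun c => c ∈ seg A mid j) m
  before : ∀ b ∈ seg A mid j, ∀ a ∈ seg A i mid, r b a
  goal : MergeGoal vec p k r (seg A lo i) (seg A mid hi) v

section

variable {p : ℕ → Prop} {k : ℕ → ℝ} {r : ℕ → ℕ → Bool} {A C C' : ℕ → ℕ}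
  {lo mid hi i j o m m' : ℕ} {v v' : ℝ}

theorem MergeState.takeRight (h : MergeState n vec p k r A lo mid hi i j o m C v)
    (hr : ∀ a b c, r a b → r b c → r a c) (sL : (seg A lo mid).Pairwise (fun a b => r a b))
    (hj : j < hi) (hle : i < mid → r (A j) (A i)) (hC : ∀ x < o, C' x = C x) (ho : C' o = A j)
    (hm : IsBest n p k (fun c => c ∈ seg A mid j ∨ c = A j) m') :
    MergeState n vec p k r A lo mid hi i (j + 1) (o + 1) m' C' v := by
  obtain ⟨h1, h2, h3, h4, h5, h6, h7, h8, h9⟩ := h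
  refine ⟨h1, h2, by omega, by omega, by omega, ?_, ?_, ?_, h9⟩
  · rw [seg_succ (by omega), seg_congr (fun x _ hx => hC x hx), ho, ← h6, List.append_assoc,
      seg_cons hj]
    congr 1
    rcases h2.lt_or_eq with hi' | rfl
    · rw [seg_cons hi', List.cons_merge_cons_pos _ _ _ (hle hi')]
      rfl
    · rw [seg_of_le (le_refl i)]
      simp
  · refine hm.congr fun c => ?_
    rw [seg_succ h3]
    simp
  · intro b hb a ha
    rw [seg_succ h3, List.mem_append, List.mem_singleton] at hb
    rcases hb with hb | rfl
    · exact h8 b hb a ha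
    · have hi' : i < mid := by
        by_contra hi'
        simp [seg_of_le (not_lt.1 hi')] at ha
      rw [seg_cons hi', List.mem_cons] at ha
      rcases ha with rfl | ha
      · exact hle hi'
      · rw [seg_append h1 h2, seg_cons hi', List.pairwise_append, List.pairwise_cons] at sL
        exact hr _ _ _ (hle hi') (sL.2.1.1 a ha)

/-- The remaining elements of the right block do not precede `A i`, so that `m` is the best of all those
that do. -/
theorem MergeState.takeLeft (h : MergeState n vec p k r A lo mid hi i j o m C v)
    (hr : ∀ a b c, r a b → r b c → r a c) (sR : (seg A mid hi).Pairwise (fun a b => r a b))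
    (hrefl : ∀ a, r a a)
    (hi' : i < mid) (hle : j < hi → ¬ r (A j) (A i)) (hC : ∀ x < o, C' x = C x) (ho : C' o = A i)
    (hv : v' ≤ v) (hm : m < n → A i ≠ m → v' ≤ lineSq (vec (A i)) (vec m)) :
    MergeState n vec p k r A lo mid hi (i + 1) j (o + 1) m C' v' := by
  obtain ⟨h1, h2, h3, h4, h5, h6, h7, h8, h9⟩ := h
  refine ⟨by omega, by omega, h3, h4, by omega, ?_, h7, ?_, ?_⟩
  · rw [seg_succ (by omega), seg_congr (fun x _ hx => hC x hx), ho, ← h6, List.append_assoc,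
      seg_cons hi']
    congr 1
    rcases h4.lt_or_eq with hj | rfl
    · rw [seg_cons hj, List.cons_merge_cons_neg _ _ _ (hle hj)]
      rfl
    · rw [seg_of_le (le_refl j)]
      simp
  · intro b hb a ha
    exact h8 b hb a (by rw [seg_cons hi']; exact List.mem_cons_of_mem _ ha)
  · intro a ha b hb hpb hba
    rw [seg_succ h1, List.mem_append, List.mem_singleton] at ha
    rcases ha with ha | rfl
    · exact h9.anti hv a ha b hb hpb hba
    · have hbj : b ∈ seg A mid j := by
        rw [seg_append h3 h4, List.mem_append] at hb
        refine hb.resolve_right fun hb => ?_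
        have hj : j < hi := by
          by_contra hj
          simp [seg_of_le (not_lt.1 hj)] at hb
        rw [seg_cons hj, List.mem_cons] at hb
        refine hle hj (hr _ _ _ ?_ hba)
        rcases hb with rfl | hb
        · exact hrefl _
        · rw [seg_append h3 h4, seg_cons hj, List.pairwise_append, List.pairwise_cons] at sR
          exact sR.2.1.1 b hb
      rcases h7 with ⟨-, h7⟩ | ⟨g1, g2, g3, g4⟩
      · exact absurd hpb (h7 b hbj)
      · refine ⟨m, ?_, g3, h8 m g2 _ ?_, g4 b hbj hpb, hm g1⟩
        · rw [seg_append h3 h4]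
          exact List.mem_append_left _ g2
        · rw [seg_cons hi']
          exact List.mem_cons_self

end

/-- One step of a merge: the smaller one of the first remaining elements of the two blocks goes to
the output. An element of the right block may become the best one so far, while an element of
the left block is tried together with the best element so far of the right block. -/
def mergeStep (le : WExp → WExp → Test) (T : WExp → Test) (K : WExp → RExp) : Prog :=
  .seq (.setWord 12 (.get 0 (.var 9))) (.seq (.setWord 13 (.get 0 (.var 10))) (
    .cond (.both (.wordLt (.var 10) (.var 8))
        (.neg (.both (.wordLt (.var 9) (.var 7)) (.neg (le (.var 13) (.var 12))))))
      (.seq (.putWord 1 (.var 11) (.var 13)) (.seq (incr 10) (.seq (incr 11) (updateBest T K 13))))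
      (.seq (.putWord 1 (.var 11) (.var 12)) (.seq (incr 9) (.seq (incr 11) (tryPair 12 3))))))

/-- The invariant of a merge; the word array `1` held `B` before the merge, and the real variable
`3` held `v`. -/
structure MergeInv (n : ℕ) (vec : ℕ → ℕ → ℝ) (p : ℕ → Prop) (k : ℕ → ℝ) (r : ℕ → ℕ → Bool)
    (A B : ℕ → ℕ) (h lo mid hi : ℕ) (v : ℝ) (μ : Memory w) : Prop where
  ok : Ok n vec μ
  le : μ.real 3 ≤ v
  hh : reg μ 5 = h
  hlo : reg μ 6 = lo
  hmid : reg μ 7 = mid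
  hhi : reg μ 8 = hi
  source : arr μ 0 = A
  below : ∀ i < lo, arr μ 1 i = B i
  state : MergeState n vec p k r A lo mid hi (reg μ 9) (reg μ 10) (reg μ 11) (reg μ 3)
    (arr μ 1) (μ.real 3)

theorem wp_mergeStep {le : WExp → WExp → Test} {T : WExp → Test} {K : WExp → RExp}
    {p : ℕ → Prop} {k : ℕ → ℝ} {r : ℕ → ℕ → Bool} (hw : n + 1 < 2 ^ w)
    (hle : DecidesRel vec le (fun b a => r b a)) (hT : Decides vec T p) (hK : Computes vec K k)
    (hr : ∀ a b c, r a b → r b c → r a c) (hrefl : ∀ a, r a a)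
    {A B : ℕ → ℕ} {h lo mid hi : ℕ} {v : ℝ} (hhi : hi ≤ n) (hA : ∀ i < n, A i < n)
    (sR : (seg A mid hi).Pairwise (fun a b => r a b))
    (sL : (seg A lo mid).Pairwise (fun a b => r a b))
    {μ : Memory w} (hI : MergeInv n vec p k r A B h lo mid hi v μ) (hlt : reg μ 11 < hi) :
    WP (mergeStep le T K) 17 (fun μ' => MergeInv n vec p k r A B h lo mid hi v μ' ∧
      reg μ' 11 = reg μ 11 + 1) μ := by
  obtain ⟨ok, hle3, hh, hlo, hmid, hhi', source, below, state⟩ := hI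
  obtain ⟨h1, h2, h3, h4, h5, -, hbest, -, -⟩ := id state
  refine wp_seq (T₁ := 1) (T₂ := 15) (wp_setWord (wp_seq (T₁ := 1) (T₂ := 13) (wp_setWord ?_)))
  set μ₁ := setW (setW μ 12 _) 13 _ with hμ₁
  have ok₁ : Ok n vec μ₁ := (ok.setW (by norm_num) _).setW (by norm_num) _
  have r12 : reg μ₁ 12 = A (reg μ 9) := by
    simp [hμ₁, toNat_get, source]
  have r13 : reg μ₁ 13 = A (reg μ 10) := by
    simp [hμ₁, toNat_get, source]
  have rx : ∀ x < 12, reg μ₁ x = reg μ x := by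
    intro x hx
    have h1 : x ≠ 12 := by omega
    have h2 : x ≠ 13 := by omega
    simp [hμ₁, h1, h2]
  have arr₁ : arr μ₁ = arr μ := rfl
  have real₁ : μ₁.real = μ.real := rfl
  clear_value μ₁
  -- the writes and increments that the two branches have in common
  have common : ∀ (x y : ℕ), (x = 9 ∨ x = 10) → (hx : reg μ x < n) → (y = 12 ∨ y = 13) →
      ∀ (Q : Prog) (T : ℕ) (R : Memory w → Prop),
      (∀ μ₂ : Memory w, Ok n vec μ₂ → μ₂.real 3 = μ.real 3 → arr μ₂ 0 = A →
        (∀ z < reg μ 11, arr μ₂ 1 z = arr μ 1 z) → arr μ₂ 1 (reg μ 11) = reg μ₁ y →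
        reg μ₂ x = reg μ x + 1 → reg μ₂ 11 = reg μ 11 + 1 →
        (∀ z, z ≠ 11 → z ≠ x → reg μ₂ z = reg μ₁ z) → WP Q T R μ₂) →
      WP (.seq (.putWord 1 (.var 11) (.var y)) (.seq (incr x) (.seq (incr 11) Q))) (6 + T) R μ₁ := by
    intro x y hx hxn hy Q T R hQ
    have hx11 : x ≠ 11 := by omega
    have hx12 : x < 12 := by omega
    refine WP.mono (wp_seq (T₁ := 1) (T₂ := 4 + T) (wp_putWord (WP.mono (wp_seq (T₁ := 1)
      (wp_setWord (wp_seq (T₁ := 1) (wp_setWord (hQ _ ?_ ?_ ?_ ?_ ?_ ?_ ?_ ?_)))))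
        (by omega) fun _ h => h))) (by omega) fun _ h => h
    · exact ((ok₁.putW _ _ _).setW (by omega) _).setW (by norm_num) _
    · simp [real₁]
    · simp only [arr_setW]
      rw [arr_putW_ne _ _ _ (by norm_num), arr₁, source]
    · intro z hz
      simp only [arr_setW]
      rw [arr_putW _ _ _ _ (by omega), toNat_var, rx 11 (by norm_num), if_neg (by omega), arr₁]
    · simp only [arr_setW]
      rw [arr_putW _ _ _ _ (by omega), toNat_var, rx 11 (by norm_num), if_pos rfl, toNat_var]
    · simp only [reg_setW, if_neg hx11, if_true]
      rw [toNat_incr, reg_putW, rx x hx12]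
      rw [reg_putW, rx x hx12]
      omega
    · simp only [reg_setW, if_true]
      rw [toNat_incr] <;> rw [reg_setW, if_neg hx11.symm, reg_putW, rx 11 (by norm_num)]
      omega
    · intro z hz hzx
      simp [hz, hzx]
  refine wp_cond (T := 12) (fun hb => ?_) (fun hb => ?_)
  · simp only [Test.Holds, toNat_var, hle ok₁.hasVec, r12, r13, rx 10 (by norm_num),
      rx 9 (by norm_num), rx 8 (by norm_num), rx 7 (by norm_num), hhi', hmid] at hb
    obtain ⟨hj, hb⟩ := hb
    refine (common 10 13 (by simp) (by omega) (by simp) _ 2 _ ?_).mono (by norm_num) fun _ h => h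
    intro μ₂ k1 k2 k3 k4 k5 k6 k7 k8
    refine (wp_updateBest hT hK (S := fun c => c ∈ seg A mid (reg μ 10)) k1 ?_ ?_).mono
      le_rfl ?_
    · rw [k8 13 (by norm_num) (by norm_num), r13]
      exact hA _ (by omega)
    · rw [k8 3 (by norm_num) (by norm_num), rx 3 (by norm_num)]
      exact hbest
    · rintro μ₃ ⟨u, rfl, hu⟩
      rw [k8 13 (by norm_num) (by norm_num), r13] at hu
      refine ⟨⟨k1.setW (by norm_num) _, by simpa [k2] using hle3, ?_, ?_, ?_, ?_, k3, ?_, ?_⟩, ?_⟩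
      · simpa [k8, rx] using hh
      · simpa [k8, rx] using hlo
      · simpa [k8, rx] using hmid
      · simpa [k8, rx] using hhi'
      · intro z hz
        rw [← below z hz]
        exact k4 z (by omega)
      · have e9 : reg (setW μ₂ 3 u) 9 = reg μ 9 := by simp [k8, rx]
        have e10 : reg (setW μ₂ 3 u) 10 = reg μ 10 + 1 := by simp [k6]
        have e11 : reg (setW μ₂ 3 u) 11 = reg μ 11 + 1 := by simp [k7]
        rw [e9, e10, e11, real_setW, k2]
        refine state.takeRight hr sL hj ?_ k4 (k5.trans r13) hu
        intro hi
        by_contra hc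
        exact hb ⟨hi, hc⟩
      · simp [k7]
  · simp only [Test.Holds, toNat_var, hle ok₁.hasVec, r12, r13, rx 10 (by norm_num),
      rx 9 (by norm_num), rx 8 (by norm_num), rx 7 (by norm_num), hhi', hmid] at hb
    have hi' : reg μ 9 < mid := by
      by_contra hi'
      exact hb ⟨by omega, fun h => hi' h.1⟩
    refine (common 9 12 (by simp) (by omega) (by simp) _ 6 _ ?_).mono (by norm_num) fun _ h => h
    intro μ₂ k1 k2 k3 k4 k5 k6 k7 k8
    refine (wp_tryPair k1 (by norm_num) (by norm_num)).mono le_rfl ?_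
    rintro μ₃ ⟨g1, g2, g3, g4, g5⟩
    rw [k8 12 (by norm_num) (by norm_num), r12, k8 3 (by norm_num) (by norm_num),
      rx 3 (by norm_num)] at g3
    refine ⟨⟨g1, (g2.trans_eq k2).trans hle3, ?_, ?_, ?_, ?_, by rw [g5, k3], ?_, ?_⟩, ?_⟩
    · simpa [g4, k8, rx] using hh
    · simpa [g4, k8, rx] using hlo
    · simpa [g4, k8, rx] using hmid
    · simpa [g4, k8, rx] using hhi'
    · intro z hz
      rw [← below z hz, g5]
      exact k4 z (by omega)
    · have e9 : reg μ₃ 9 = reg μ 9 + 1 := by simp [g4, k6]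
      have e10 : reg μ₃ 10 = reg μ 10 := by simp [g4, k8, rx]
      have e11 : reg μ₃ 11 = reg μ 11 + 1 := by simp [g4, k7]
      have e3 : reg μ₃ 3 = reg μ 3 := by simp [g4, k8, rx]
      rw [e9, e10, e11, e3, g5]
      refine state.takeLeft hr sR hrefl hi' ?_ k4 (k5.trans r12) (g2.trans_eq k2) ?_
      · intro hj hc
        exact hb ⟨hj, fun h => h.2 hc⟩
      · intro hm hne
        exact g3 (hA _ (by omega)) hm hne
    · simp [g4, k7]

/-- Set the variable `x` to the sum of the variables `y` and `5`, but to at most `n`. -/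
def minSum (x y : ℕ) : Prog :=
  .cond (.wordLt (.add (.var y) (.var 5)) (.var 0)) (.setWord x (.add (.var y) (.var 5)))
    (.setWord x (.var 0))

theorem wp_minSum {μ : Memory w} (h0 : reg μ 0 = n) (x : ℕ) {y : ℕ}
    (hw : reg μ y + reg μ 5 < 2 ^ w) {Q : Memory w → Prop}
    (hQ : ∀ v : BitVec w, v.toNat = min (reg μ y + reg μ 5) n → Q (setW μ x v)) :
    WP (minSum x y) 2 Q μ := by
  have e : ((WExp.add (.var y) (.var 5)).eval μ).toNat = reg μ y + reg μ 5 := toNat_add μ hw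
  refine wp_cond (T := 1) (fun hb => wp_setWord (hQ _ ?_)) (fun hb => wp_setWord (hQ _ ?_))
  · simp only [Test.Holds, e, toNat_var, h0] at hb
    rw [e]
    omega
  · simp only [Test.Holds, e, toNat_var, h0] at hb
    rw [toNat_var, h0]
    omega

/-- Merge the two blocks of length (at most) `h` that start at `lo`, and move `lo` behind them. -/
def mergeBlocks (le : WExp → WExp → Test) (T : WExp → Test) (K : WExp → RExp) : Prog :=
  .seq (minSum 7 6) (.seq (minSum 8 7) (.seq (.setWord 9 (.var 6)) (.seq (.setWord 10 (.var 7))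
    (.seq (.setWord 11 (.var 6)) (.seq (.setWord 3 (.var 0)) (.seq
      (.loop (.wordLt (.var 11) (.var 8)) (mergeStep le T K)) (.setWord 6 (.var 8))))))))

theorem wp_mergeBlocks {le : WExp → WExp → Test} {T : WExp → Test} {K : WExp → RExp}
    {p : ℕ → Prop} {k : ℕ → ℝ} {r : ℕ → ℕ → Bool} (hw : 2 * n + 1 < 2 ^ w)
    (hle : DecidesRel vec le (fun b a => r b a)) (hT : Decides vec T p) (hK : Computes vec K k)
    (hr : ∀ a b c, r a b → r b c → r a c) (hrefl : ∀ a, r a a)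
    {μ : Memory w} (ok : Ok n vec μ) {h lo mid hi : ℕ} (hh : reg μ 5 = h) (hhn : h ≤ n)
    (hlo : reg μ 6 = lo) (hlon : lo ≤ n) (hmid : mid = min (lo + h) n) (hhi : hi = min (mid + h) n)
    (hA : ∀ i < n, arr μ 0 i < n)
    (sR : (seg (arr μ 0) mid hi).Pairwise (fun a b => r a b))
    (sL : (seg (arr μ 0) lo mid).Pairwise (fun a b => r a b)) :
    WP (mergeBlocks le T K) (18 * (hi - lo) + 17) (fun μ' => Ok n vec μ' ∧ μ'.real 3 ≤ μ.real 3 ∧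
      reg μ' 5 = h ∧ reg μ' 6 = hi ∧ arr μ' 0 = arr μ 0 ∧ (∀ i < lo, arr μ' 1 i = arr μ 1 i) ∧
      seg (arr μ' 1) lo hi =
        List.merge (seg (arr μ 0) mid hi) (seg (arr μ 0) lo mid) r ∧
      MergeGoal vec p k r (seg (arr μ 0) lo mid) (seg (arr μ 0) mid hi) (μ'.real 3)) μ := by
  refine (wp_seq (T₁ := 2) (T₂ := 18 * (hi - lo) + 14) (wp_minSum ok.reg_zero 7 (by omega) ?_)).mono
    (by omega) fun _ h => h
  intro u hu
  refine (wp_seq (T₁ := 2) (T₂ := 18 * (hi - lo) + 11) (wp_minSum (n := n) ?_ 8 ?_ ?_)).mono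
    (by omega) fun _ h => h
  · simpa using ok.reg_zero
  · simp [hu]
    omega
  intro u' hu'
  simp only [reg_setW, if_true, hu] at hu'
  rw [hh, hlo, ← hmid] at hu
  simp only [show (5 : ℕ) ≠ 7 by norm_num, if_false, hh, hlo, ← hmid, ← hhi] at hu'
  refine (wp_seq (T₁ := 1) (T₂ := 18 * (hi - lo) + 9) (wp_setWord
    ((wp_seq (T₁ := 1) (T₂ := 18 * (hi - lo) + 7) (wp_setWord
    ((wp_seq (T₁ := 1) (T₂ := 18 * (hi - lo) + 5) (wp_setWord
    ((wp_seq (T₁ := 1) (T₂ := 18 * (hi - lo) + 3) (wp_setWord ?_)).mono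
    (by omega) fun _ h => h))).mono
    (by omega) fun _ h => h))).mono
    (by omega) fun _ h => h))).mono
    (by omega) fun _ h => h
  set μ₁ := setW (setW (setW (setW (setW (setW μ 7 u) 8 u') 9 _) 10 _) 11 _) 3 _ with hμ₁
  have ok₁ : Ok n vec μ₁ := (((((ok.setW (by norm_num) _).setW (by norm_num) _).setW
    (by norm_num) _).setW (by norm_num) _).setW (by norm_num) _).setW (by norm_num) _
  have e3 : reg μ₁ 3 = n := by simpa [hμ₁, toNat_var] using ok.reg_zero
  have e5 : reg μ₁ 5 = h := by simpa [hμ₁, toNat_var] using hh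
  have e6 : reg μ₁ 6 = lo := by simpa [hμ₁, toNat_var] using hlo
  have e7 : reg μ₁ 7 = mid := by simpa [hμ₁, toNat_var] using hu
  have e8 : reg μ₁ 8 = hi := by simpa [hμ₁, toNat_var] using hu'
  have e9 : reg μ₁ 9 = lo := by simpa [hμ₁, toNat_var] using hlo
  have e10 : reg μ₁ 10 = mid := by simpa [hμ₁, toNat_var] using hu
  have e11 : reg μ₁ 11 = lo := by simpa [hμ₁, toNat_var] using hlo
  have earr : arr μ₁ = arr μ := rfl
  have ereal : μ₁.real = μ.real := rfl
  clear_value μ₁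
  refine (wp_seq (T₁ := 18 * (hi - lo) + 1) (T₂ := 1) ((wp_loop (μ := μ₁)
    (MergeInv n vec p k r (arr μ 0) (arr μ 1) h lo mid hi (μ.real 3))
    (fun μ' => 18 * (hi - reg μ' 11)) ?_ ?_).mono (by rw [e11]) ?_)).mono
    (by omega) fun _ h => h
  · intro μ₂ h₂ hb
    simp only [Test.Holds, toNat_var, h₂.hhi] at hb
    refine ⟨17, (wp_mergeStep (by omega) hle hT hK hr hrefl (by omega) hA sR sL h₂ hb).mono
      le_rfl ?_⟩
    rintro μ₃ ⟨h₃, h₄⟩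
    exact ⟨h₃, by omega⟩
  · refine ⟨ok₁, by rw [ereal], e5, e6, e7, e8, by rw [earr], by simp [earr], ?_⟩
    rw [e9, e10, e11, e3]
    refine ⟨le_rfl, by omega, le_rfl, by omega, by omega, ?_, Or.inl ⟨rfl, ?_⟩, ?_, ?_⟩
    · simp [seg_of_le le_rfl]
    · simp [seg_of_le le_rfl]
    · simp [seg_of_le le_rfl]
    · simp [seg_of_le le_rfl, MergeGoal]
  · rintro μ₂ ⟨h₂, hb⟩
    obtain ⟨f1, f2, f3, f4, f5, f6, f7, f8, f9, f10, f11, f12, f13, f14, -, -, f15⟩ := h₂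
    simp only [Test.Holds, toNat_var, f6] at hb
    have g9 : reg μ₂ 9 = mid := by omega
    have g10 : reg μ₂ 10 = hi := by omega
    have g11 : reg μ₂ 11 = hi := by omega
    rw [g9, g10, g11, seg_of_le le_rfl, seg_of_le le_rfl] at f14
    rw [g9] at f15
    refine wp_setWord ⟨f1.setW (by norm_num) _, f2, ?_, ?_, f7, f8, by simpa using f14, f15⟩
    · simpa using f3
    · simpa [toNat_var] using f6

/-! ### Merge sort -/

/-- The block with index `b` among the consecutive blocks of length `h` of an array of length `n`
(the last one may be shorter). -/
def block (n h : ℕ) (A : ℕ → ℕ) (b : ℕ) : List ℕ := seg A (min (b * h) n) (min ((b + 1) * h) n)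

/-- Copy the word array `1` to the word array `0`. -/
def copyBack : Prog :=
  .seq (.setWord 6 (.const 0)) (.loop (.wordLt (.var 6) (.var 0))
    (.seq (.putWord 0 (.var 6) (.get 1 (.var 6))) (incr 6)))

theorem wp_copyBack (hw : n + 1 < 2 ^ w) {μ : Memory w} (ok : Ok n vec μ) :
    WP copyBack (4 * n + 3) (fun μ' => Ok n vec μ' ∧ μ'.real 3 = μ.real 3 ∧ reg μ' 5 = reg μ 5 ∧
      ∀ i < n, arr μ' 0 i = arr μ 1 i) μ := by
  refine (wp_seq (T₁ := 1) (T₂ := 4 * n + 1) (wp_setWord ?_)).mono (by omega) fun _ h => h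
  have e6 : reg (setW μ 6 ((WExp.const 0).eval μ)) 6 = 0 := by
    simp only [reg_setW, if_true]
    exact toNat_const _ (by omega)
  refine (wp_loop (fun μ' => Ok n vec μ' ∧ μ'.real 3 = μ.real 3 ∧ reg μ' 5 = reg μ 5 ∧
    reg μ' 6 ≤ n ∧ arr μ' 1 = arr μ 1 ∧ ∀ i < reg μ' 6, arr μ' 0 i = arr μ 1 i)
    (fun μ' => 4 * (n - reg μ' 6)) ?_ ?_).mono (by omega) ?_
  · rintro μ₁ ⟨h1, h2, h3, h4, h5, h6⟩ hb
    simp only [Test.Holds, toNat_var, h1.reg_zero] at hb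
    refine ⟨3, wp_seq (T₁ := 1) (T₂ := 1) (wp_putWord (wp_setWord ?_))⟩
    have e := toNat_incr (μ := putW μ₁ 0 ((WExp.var 6).eval μ₁) ((WExp.get 1 (.var 6)).eval μ₁))
      (x := 6) (by rw [reg_putW]; omega)
    rw [reg_putW] at e
    refine ⟨⟨(h1.putW _ _ _).setW (by norm_num) _, h2, by simpa using h3, ?_, ?_, ?_⟩, ?_⟩
    · simp only [reg_setW, if_true, e]
      omega
    · rw [arr_setW, arr_putW_ne _ _ _ (by norm_num), h5]
    · simp only [reg_setW, if_true, e, arr_setW]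
      intro i hi
      rw [arr_putW _ _ _ _ (by omega), toNat_var, toNat_get, h5]
      split_ifs with h
      · rw [h]
      · exact h6 i (by omega)
    · simp only [reg_setW, if_true, e]
      omega
  · exact ⟨ok.setW (by norm_num) _, rfl, by simp, by omega, rfl, by simp [e6]⟩
  · rintro μ₁ ⟨⟨h1, h2, h3, h4, h5, h6⟩, hb⟩
    simp only [Test.Holds, toNat_var, h1.reg_zero] at hb
    exact ⟨h1, h2, h3, fun i hi => h6 i (by omega)⟩

/-- Merge the blocks in pairs. -/
def mergeLevel (le : WExp → WExp → Test) (T : WExp → Test) (K : WExp → RExp) : Prog :=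
  .seq (.setWord 6 (.const 0)) (.seq (.loop (.wordLt (.var 6) (.var 0)) (mergeBlocks le T K))
    copyBack)

theorem wp_mergeLevel {le : WExp → WExp → Test} {T : WExp → Test} {K : WExp → RExp}
    {p : ℕ → Prop} {k : ℕ → ℝ} {r : ℕ → ℕ → Bool} (hw : 2 * n + 1 < 2 ^ w)
    (hle : DecidesRel vec le (fun b a => r b a)) (hT : Decides vec T p) (hK : Computes vec K k)
    (hr : ∀ a b c, r a b → r b c → r a c) (hrefl : ∀ a, r a a)
    {μ : Memory w} (ok : Ok n vec μ) {h : ℕ} (hh : reg μ 5 = h) (hpos : 0 < h) (hhn : h ≤ n)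
    (hA : ∀ i < n, arr μ 0 i < n)
    (hs : ∀ b, (block n h (arr μ 0) b).Pairwise (fun a b => r a b)) :
    WP (mergeLevel le T K) (40 * n + 7) (fun μ' => Ok n vec μ' ∧ μ'.real 3 ≤ μ.real 3 ∧
      reg μ' 5 = h ∧ ∀ q, block n (2 * h) (arr μ' 0) q =
        List.merge (block n h (arr μ 0) (2 * q + 1)) (block n h (arr μ 0) (2 * q)) r ∧
      MergeGoal vec p k r (block n h (arr μ 0) (2 * q)) (block n h (arr μ 0) (2 * q + 1))
        (μ'.real 3)) μ := by
  have hq1 (q : ℕ) : min (min (q * (2 * h)) n + h) n = min ((2 * q + 1) * h) n := by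
    have e1 : q * (2 * h) = 2 * q * h := by ring
    have e2 : (2 * q + 1) * h = 2 * q * h + h := by ring
    omega
  have hq2 (q : ℕ) : min (min ((2 * q + 1) * h) n + h) n = min ((q + 1) * (2 * h)) n := by
    have e1 : (q + 1) * (2 * h) = 2 * q * h + h + h := by ring
    have e2 : (2 * q + 1) * h = 2 * q * h + h := by ring
    omega
  have hb0 (q : ℕ) : seg (arr μ 0) (min (q * (2 * h)) n) (min ((2 * q + 1) * h) n) =
      block n h (arr μ 0) (2 * q) := by
    rw [block, show q * (2 * h) = 2 * q * h by ring]
  have hb1 (q : ℕ) : seg (arr μ 0) (min ((2 * q + 1) * h) n) (min ((q + 1) * (2 * h)) n) =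
      block n h (arr μ 0) (2 * q + 1) := by
    rw [block, show (q + 1) * (2 * h) = (2 * q + 1 + 1) * h by ring]
  refine (wp_seq (T₁ := 1) (T₂ := 40 * n + 5) (wp_setWord ?_)).mono (by omega) fun _ h => h
  have e6 : reg (setW μ 6 ((WExp.const 0).eval μ)) 6 = 0 := by
    simp only [reg_setW, if_true]
    exact toNat_const _ (by omega)
  refine (wp_seq (T₁ := 36 * n + 1) (T₂ := 4 * n + 3) ((wp_loop (fun μ' => Ok n vec μ' ∧
    μ'.real 3 ≤ μ.real 3 ∧ reg μ' 5 = h ∧ arr μ' 0 = arr μ 0 ∧ ∃ q,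
    reg μ' 6 = min (q * (2 * h)) n ∧ ∀ q' < q,
      block n (2 * h) (arr μ' 1) q' =
        List.merge (block n h (arr μ 0) (2 * q' + 1)) (block n h (arr μ 0) (2 * q')) r ∧
      MergeGoal vec p k r (block n h (arr μ 0) (2 * q')) (block n h (arr μ 0) (2 * q' + 1))
        (μ'.real 3)) (fun μ' => 36 * (n - reg μ' 6)) ?_ ?_).mono (by omega) ?_)).mono
      (by omega) fun _ h => h
  · rintro μ₁ ⟨h1, h2, h3, h4, q, h5, h6⟩ hb
    simp only [Test.Holds, toNat_var, h1.reg_zero] at hb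
    have hlt : min (q * (2 * h)) n < min ((q + 1) * (2 * h)) n := by
      have e1 : (q + 1) * (2 * h) = q * (2 * h) + 2 * h := by ring
      omega
    refine ⟨_, (wp_mergeBlocks hw hle hT hK hr hrefl h1 h3 hhn h5 (by omega) (hq1 q).symm
      (hq2 q).symm (by rwa [h4]) (by rw [h4, hb1]; exact hs _)
      (by rw [h4, hb0]; exact hs _)).mono le_rfl ?_⟩
    rintro μ₂ ⟨g1, g2, g3, g4, g5, g6, g7, g8⟩
    refine ⟨⟨g1, g2.trans h2, g3, g5.trans h4, q + 1, g4, fun q' hq' => ?_⟩, ?_⟩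
    · rcases Nat.lt_succ_iff_lt_or_eq.1 hq' with hq' | rfl
      · obtain ⟨k1, k2⟩ := h6 q' hq'
        refine ⟨?_, k2.anti g2⟩
        rw [← k1]
        refine seg_congr fun i _ hi => g6 i ?_
        have : (q' + 1) * (2 * h) ≤ q * (2 * h) := Nat.mul_le_mul_right _ hq'
        omega
      · rw [h4, hb0, hb1] at g7 g8
        exact ⟨g7, g8⟩
    · simp only [g4, h5]
      omega
  · exact ⟨ok.setW (by norm_num) _, le_rfl, by simpa using hh, rfl, 0, by simp [e6], by simp⟩
  · rintro μ₁ ⟨⟨h1, h2, h3, h4, q, h5, h6⟩, hb⟩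
    simp only [Test.Holds, toNat_var, h1.reg_zero] at hb
    refine (wp_copyBack (by omega) h1).mono le_rfl ?_
    rintro μ₂ ⟨g1, g2, g3, g4⟩
    refine ⟨g1, g2.trans_le h2, g3.trans h3, fun q' => ?_⟩
    have eb : block n (2 * h) (arr μ₂ 0) q' = block n (2 * h) (arr μ₁ 1) q' :=
      seg_congr fun i _ hi => g4 i (by omega)
    rw [eb, g2]
    by_cases hq' : q' < q
    · exact h6 q' hq'
    · have hle1 : q * (2 * h) ≤ q' * (2 * h) := Nat.mul_le_mul_right _ (by omega)
      have emp (c s : ℕ) (A : ℕ → ℕ) (hc : n ≤ c * s) : block n s A c = [] :=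
        seg_of_le (by omega)
      have e1 : q' * (2 * h) = 2 * q' * h := by ring
      have e2 : (2 * q' + 1) * h = 2 * q' * h + h := by ring
      rw [emp q' _ _ (by omega), emp (2 * q') _ _ (by omega), emp (2 * q' + 1) _ _ (by omega)]
      simp [MergeGoal]

/-- Sort the word array `0` by bottom-up merge sort. -/
def mergeSort (le : WExp → WExp → Test) (T : WExp → Test) (K : WExp → RExp) : Prog :=
  .seq (.setWord 5 (.const 1)) (.loop (.wordLt (.var 5) (.var 0))
    (.seq (mergeLevel le T K) (.setWord 5 (.add (.var 5) (.var 5)))))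

/-- The pairs that have been tried when the array `A` has been sorted in blocks of length `h`: an
element `A x` and later elements of its block that precede it in the order `r` and satisfy `p`;
these are represented by one of them with the smallest key. -/
def SortGoal (n : ℕ) (vec : ℕ → ℕ → ℝ) (p : ℕ → Prop) (k : ℕ → ℝ) (r : ℕ → ℕ → Bool)
    (A : ℕ → ℕ) (h : ℕ) (v : ℝ) : Prop :=
  ∀ x y, x < y → y < n → x / h = y / h → p (A y) → r (A y) (A x) →
    ∃ z, x < z ∧ z < n ∧ p (A z) ∧ r (A z) (A x) ∧ k (A z) ≤ k (A y) ∧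
      (A x ≠ A z → v ≤ lineSq (vec (A x)) (vec (A z)))

theorem SortGoal.anti {p : ℕ → Prop} {k : ℕ → ℝ} {r : ℕ → ℕ → Bool} {A : ℕ → ℕ} {h : ℕ} {v v' : ℝ}
    (H : SortGoal n vec p k r A h v) (hv : v' ≤ v) : SortGoal n vec p k r A h v' := by
  intro x y hxy hy hd hp hr
  obtain ⟨z, h1, h2, h3, h4, h5, h6⟩ := H x y hxy hy hd hp hr
  exact ⟨z, h1, h2, h3, h4, h5, fun hne => hv.trans (h6 hne)⟩

theorem mem_block_div {A : ℕ → ℕ} {h x : ℕ} (hpos : 0 < h) (hx : x < n) :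
    A x ∈ block n h A (x / h) := by
  rw [block, mem_seg]
  have h1 := Nat.div_mul_le_self x h
  have h2 : x < (x / h + 1) * h := by
    rw [mul_comm]
    exact Nat.lt_mul_div_succ x hpos
  exact ⟨x, by omega, by omega, rfl⟩

theorem block_double {A : ℕ → ℕ} (h q : ℕ) :
    block n (2 * h) A q = block n h A (2 * q) ++ block n h A (2 * q + 1) := by
  have e0 : q * (2 * h) = 2 * q * h := by ring
  have e1 : (q + 1) * (2 * h) = (2 * q + 1 + 1) * h := by ring
  have e2 : (2 * q + 1) * h = 2 * q * h + h := by ring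
  have e3 : (2 * q + 1 + 1) * h = 2 * q * h + h + h := by ring
  rw [block, block, block, e0, e1]
  exact seg_append (by omega) (by omega)

/-- Pairs in different blocks of length `h`, but in the same one of length `2 * h`, are covered by the
merge of the two blocks. -/
theorem SortGoal.double {p : ℕ → Prop} {k : ℕ → ℝ} {r : ℕ → ℕ → Bool} {A A' : ℕ → ℕ} {h : ℕ}
    {v v' : ℝ} (hpos : 0 < h) (H : SortGoal n vec p k r A h v) (hv : v' ≤ v)
    (hperm : ∀ b, (block n h A' b).Perm (block n h A b))
    (hm : ∀ q, MergeGoal vec p k r (block n h A' (2 * q)) (block n h A' (2 * q + 1)) v') :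
    SortGoal n vec p k r A (2 * h) v' := by
  intro x y hxy hy hd hp hr
  by_cases hd' : x / h = y / h
  · exact H.anti hv x y hxy hy hd' hp hr
  have d1 : x / (2 * h) = x / h / 2 := by rw [mul_comm, Nat.div_div_eq_div_mul]
  have d2 : y / (2 * h) = y / h / 2 := by rw [mul_comm, Nat.div_div_eq_div_mul]
  have d3 : x / h ≤ y / h := Nat.div_le_div_right hxy.le
  have hx : x / h = 2 * (x / (2 * h)) := by omega
  have hy' : y / h = 2 * (x / (2 * h)) + 1 := by omega
  obtain ⟨c, h1, h2, h3, h4, h5⟩ := hm (x / (2 * h)) (A x)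
    (by rw [(hperm _).mem_iff, ← hx]; exact mem_block_div hpos (hxy.trans hy)) (A y)
    (by rw [(hperm _).mem_iff, ← hy']; exact mem_block_div hpos hy) hp hr
  rw [(hperm _).mem_iff, block, mem_seg] at h1
  obtain ⟨z, hz1, hz2, rfl⟩ := h1
  refine ⟨z, ?_, by omega, h2, h3, h4, h5⟩
  have : x < (x / h + 1) * h := by
    rw [mul_comm]
    exact Nat.lt_mul_div_succ x hpos
  rw [hx] at this
  omega

/-- An upper bound for the running time of `mergeSort`. -/
def sortTime (n : ℕ) : ℕ := (40 * n + 10) * Nat.clog 2 n + 3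

theorem wp_mergeSort {le : WExp → WExp → Test} {T : WExp → Test} {K : WExp → RExp}
    {p : ℕ → Prop} {k : ℕ → ℝ} {r : ℕ → ℕ → Bool} (hw : 2 * n + 1 < 2 ^ w)
    (hle : DecidesRel vec le (fun b a => r b a)) (hT : Decides vec T p) (hK : Computes vec K k)
    (hr : ∀ a b c, r a b → r b c → r a c) (htot : ∀ a b, r a b || r b a)
    {μ : Memory w} (ok : Ok n vec μ) (hA : ∀ i < n, arr μ 0 i < n) :
    WP (mergeSort le T K) (sortTime n) (fun μ' => Ok n vec μ' ∧ μ'.real 3 ≤ μ.real 3 ∧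
      (seg (arr μ' 0) 0 n).Perm (seg (arr μ 0) 0 n) ∧
      (seg (arr μ' 0) 0 n).Pairwise (fun a b => r a b) ∧
      ∃ h, n ≤ h ∧ SortGoal n vec p k r (arr μ 0) h (μ'.real 3)) μ := by
  have hrefl (a) : r a a := by simpa using htot a a
  have hn := ok.lt_one
  refine (wp_seq (T₁ := 1) (T₂ := (40 * n + 10) * Nat.clog 2 n + 1) (wp_setWord ?_)).mono
    (by rw [sortTime]; omega) fun _ h => h
  have e5 : reg (setW μ 5 ((WExp.const 1).eval μ)) 5 = 1 := by
    simp only [reg_setW, if_true]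
    exact toNat_const _ (by omega)
  refine (wp_loop (fun μ' => Ok n vec μ' ∧ μ'.real 3 ≤ μ.real 3 ∧ ∃ t, reg μ' 5 = 2 ^ t ∧
    (∀ b, (block n (2 ^ t) (arr μ' 0) b).Perm (block n (2 ^ t) (arr μ 0) b)) ∧
    (∀ b, (block n (2 ^ t) (arr μ' 0) b).Pairwise (fun a b => r a b)) ∧
    SortGoal n vec p k r (arr μ 0) (2 ^ t) (μ'.real 3))
    (fun μ' => (40 * n + 10) * (Nat.clog 2 n - Nat.log 2 (reg μ' 5))) ?_ ?_).mono ?_ ?_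
  · rintro μ₁ ⟨h1, h2, t, h3, h4, h5, h6⟩ hb
    simp only [Test.Holds, toNat_var, h1.reg_zero, h3] at hb
    have hpos : 0 < 2 ^ t := by positivity
    have hA₁ : ∀ i < n, arr μ₁ 0 i < n := by
      intro i hi
      have := mem_block_div (A := arr μ₁ 0) hpos hi
      rw [(h4 _).mem_iff, block, mem_seg] at this
      obtain ⟨j, -, hj, hji⟩ := this
      rw [← hji]
      exact hA j (by omega)
    refine ⟨40 * n + 9, (wp_seq (T₁ := 40 * n + 7) (T₂ := 1)
      ((wp_mergeLevel hw hle hT hK hr hrefl h1 h3 hpos hb.le hA₁ h5).mono le_rfl ?_)).mono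
        (by omega) fun _ h => h⟩
    rintro μ₂ ⟨g1, g2, g3, g4⟩
    refine wp_setWord ?_
    have e : ((WExp.add (.var 5) (.var 5)).eval μ₂).toNat = 2 ^ (t + 1) := by
      rw [toNat_add] <;> rw [toNat_var, g3]
      · ring
      · omega
    refine ⟨⟨g1.setW (by norm_num) _, g2.trans h2, t + 1, ?_, ?_, ?_, ?_⟩, ?_⟩
    · simpa using e
    · intro b
      rw [arr_setW, pow_succ', (g4 b).1, block_double]
      exact ((List.merge_perm_append r).trans List.perm_append_comm).trans ((h4 _).append (h4 _))
    · intro b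
      rw [arr_setW, pow_succ', (g4 b).1]
      exact List.pairwise_merge hr htot _ _ (h5 _) (h5 _)
    · rw [pow_succ']
      exact h6.double hpos g2 h4 fun q => (g4 q).2
    · simp only [reg_setW, if_true, e, h3, Nat.log_pow (Nat.lt_succ_self 1)]
      have : t < Nat.clog 2 n := (Nat.lt_clog_iff_pow_lt (Nat.lt_succ_self 1)).2 hb
      obtain ⟨d, hd⟩ := Nat.exists_eq_add_of_lt this
      rw [hd, show t + d + 1 - (t + 1) = d by omega, show t + d + 1 - t = d + 1 by omega, mul_add]
      omega
  · refine ⟨ok.setW (by norm_num) _, le_rfl, 0, e5, fun b => List.Perm.refl _, fun b => ?_, ?_⟩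
    · refine List.pairwise_iff_getElem.2 fun i j hi hj hij => ?_
      rw [block, length_seg] at hj
      have : (b + 1) * 2 ^ 0 = b * 2 ^ 0 + 1 := by ring
      omega
    · intro x y hxy hy hd
      simp only [pow_zero, Nat.div_one] at hd
      omega
  · rw [e5]
    simp
  · rintro μ₁ ⟨⟨h1, h2, t, h3, h4, h5, h6⟩, hb⟩
    simp only [Test.Holds, toNat_var, h1.reg_zero, h3, not_lt] at hb
    have e (A : ℕ → ℕ) : block n (2 ^ t) A 0 = seg A 0 n := by
      simp [block, hb]
    refine ⟨h1, h2, ?_, ?_, 2 ^ t, hb, h6⟩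
    · rw [← e, ← e]
      exact h4 0
    · rw [← e]
      exact h5 0

/-! ### The nearest dominating points -/

/-- Write `0, …, n - 1` to the word array `0`. -/
def initArray : Prog :=
  .seq (.setWord 6 (.const 0)) (.loop (.wordLt (.var 6) (.var 0))
    (.seq (.putWord 0 (.var 6) (.var 6)) (incr 6)))

theorem wp_initArray (hw : n + 1 < 2 ^ w) {μ : Memory w} (ok : Ok n vec μ) :
    WP initArray (4 * n + 3) (fun μ' => Ok n vec μ' ∧ μ'.real 3 = μ.real 3 ∧
      ∀ i < n, arr μ' 0 i = i) μ := by
  refine (wp_seq (T₁ := 1) (T₂ := 4 * n + 1) (wp_setWord ?_)).mono (by omega) fun _ h => h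
  have e6 : reg (setW μ 6 ((WExp.const 0).eval μ)) 6 = 0 := by
    simp only [reg_setW, if_true]
    exact toNat_const _ (by omega)
  refine (wp_loop (fun μ' => Ok n vec μ' ∧ μ'.real 3 = μ.real 3 ∧
    reg μ' 6 ≤ n ∧ ∀ i < reg μ' 6, arr μ' 0 i = i)
    (fun μ' => 4 * (n - reg μ' 6)) ?_ ?_).mono (by omega) ?_
  · rintro μ₁ ⟨h1, h2, h4, h6⟩ hb
    simp only [Test.Holds, toNat_var, h1.reg_zero] at hb
    refine ⟨3, wp_seq (T₁ := 1) (T₂ := 1) (wp_putWord (wp_setWord ?_))⟩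
    have e := toNat_incr (μ := putW μ₁ 0 ((WExp.var 6).eval μ₁) ((WExp.var 6).eval μ₁))
      (x := 6) (by rw [reg_putW]; omega)
    rw [reg_putW] at e
    refine ⟨⟨(h1.putW _ _ _).setW (by norm_num) _, h2, ?_, ?_⟩, ?_⟩
    · simp only [reg_setW, if_true, e]
      omega
    · simp only [reg_setW, if_true, e, arr_setW]
      intro i hi
      rw [arr_putW _ _ _ _ (by omega), toNat_var]
      split_ifs with h
      · rw [h]
      · exact h6 i (by omega)
    · simp only [reg_setW, if_true, e]
      omega
  · exact ⟨ok.setW (by norm_num) _, rfl, by omega, by simp [e6]⟩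
  · rintro μ₁ ⟨⟨h1, h2, h4, h6⟩, hb⟩
    simp only [Test.Holds, toNat_var, h1.reg_zero] at hb
    exact ⟨h1, h2, fun i hi => h6 i (by omega)⟩

/-- Sort by the order `le₁`, and then by `le₂`. -/
def dominance (le₁ le₂ : WExp → WExp → Test) (T : WExp → Test) (K : WExp → RExp) : Prog :=
  .seq initArray (.seq (mergeSort le₁ T K) (mergeSort le₂ T K))

/-- The point `c` is a witness that the nearest point to `i` in its quadrant, as described by the
orders `r₁` and `r₂`, has been tried: it is at least as near, in terms of the key `k`, as `j`. -/
def Nearer (n : ℕ) (vec : ℕ → ℕ → ℝ) (p : ℕ → Prop) (k : ℕ → ℝ) (r₁ r₂ : ℕ → ℕ → Bool) (v : ℝ)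
    (i j c : ℕ) : Prop :=
  c < n ∧ c ≠ i ∧ p c ∧ r₁ i c ∧ r₂ c i ∧ k c ≤ k j ∧ v ≤ lineSq (vec i) (vec c)

/-- For each point `j` in the quadrant of `i`, a point that is at least as near to `i` has been tried
together with `i`; the roles of `i` and `j` may be exchanged if the first order ties. -/
def DominanceGoal (n : ℕ) (vec : ℕ → ℕ → ℝ) (p : ℕ → Prop) (k : ℕ → ℝ) (r₁ r₂ : ℕ → ℕ → Bool)
    (v : ℝ) : Prop :=
  ∀ i < n, ∀ j < n, i ≠ j → p i → p j → r₁ i j → r₂ j i →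
    ∃ c, Nearer n vec p k r₁ r₂ v i j c ∨ (r₁ j i ∧ Nearer n vec p k r₁ r₂ v j i c)

theorem wp_dominance {le₁ le₂ : WExp → WExp → Test} {T : WExp → Test} {K : WExp → RExp}
    {p : ℕ → Prop} {k : ℕ → ℝ} {r₁ r₂ : ℕ → ℕ → Bool} (hw : 2 * n + 1 < 2 ^ w)
    (hle₁ : DecidesRel vec le₁ (fun b a => r₁ b a)) (hle₂ : DecidesRel vec le₂ (fun b a => r₂ b a))
    (hT : Decides vec T p) (hK : Computes vec K k)
    (hr₁ : ∀ a b c, r₁ a b → r₁ b c → r₁ a c) (htot₁ : ∀ a b, r₁ a b || r₁ b a)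
    (hr₂ : ∀ a b c, r₂ a b → r₂ b c → r₂ a c) (htot₂ : ∀ a b, r₂ a b || r₂ b a)
    (htie : ∀ a b, r₁ a b → r₁ b a → r₂ a b) {μ : Memory w} (ok : Ok n vec μ) :
    WP (dominance le₁ le₂ T K) (4 * n + 5 + 2 * sortTime n) (fun μ' => Ok n vec μ' ∧
      μ'.real 3 ≤ μ.real 3 ∧ DominanceGoal n vec p k r₁ r₂ (μ'.real 3)) μ := by
  refine (wp_seq ((wp_initArray (by omega) ok).mono le_rfl ?_)).mono
    (T := 1 + (4 * n + 3) + (1 + sortTime n + sortTime n)) (by omega) fun _ h => h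
  rintro μ₁ ⟨h1, h2, h3⟩
  refine wp_seq ((wp_mergeSort hw hle₁ hT hK hr₁ htot₁ h1 (fun i hi => by rwa [h3 i hi])).mono
    le_rfl ?_)
  rintro μ₂ ⟨g1, g2, g3, g4, -⟩
  have eid : seg (arr μ₁ 0) 0 n = List.range n := by
    rw [seg_congr (B := id) fun i _ hi => h3 i hi, seg, List.map_id, Nat.sub_zero,
      List.range_eq_range']
  rw [eid] at g3
  have hlt : ∀ i < n, arr μ₂ 0 i < n := fun i hi =>
    List.mem_range.1 (g3.mem_iff.1 (mem_seg.2 ⟨i, by omega, hi, rfl⟩))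
  have hinj : ∀ i < n, ∀ j < n, i < j → arr μ₂ 0 i ≠ arr μ₂ 0 j := by
    intro i hi j hj hij
    have := List.pairwise_iff_getElem.1 (g3.nodup_iff.2 List.nodup_range) i j
      (by simpa [length_seg]) (by simpa [length_seg]) hij
    simpa [seg] using this
  have hsort : ∀ i < n, ∀ j < n, i < j → r₁ (arr μ₂ 0 i) (arr μ₂ 0 j) := by
    intro i hi j hj hij
    have := List.pairwise_iff_getElem.1 g4 i j
      (by simpa [length_seg]) (by simpa [length_seg]) hij
    simpa [seg] using this
  have hsurj : ∀ i < n, ∃ x < n, arr μ₂ 0 x = i := by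
    intro i hi
    have := g3.mem_iff.2 (List.mem_range.2 hi)
    rw [mem_seg] at this
    obtain ⟨x, -, hx, h⟩ := this
    exact ⟨x, hx, h⟩
  refine (wp_mergeSort hw hle₂ hT hK hr₂ htot₂ g1 hlt).mono le_rfl ?_
  rintro μ₃ ⟨f1, f2, -, -, h, hh, f3⟩
  refine ⟨f1, (f2.trans g2).trans_eq h2, ?_⟩
  have key : ∀ x < n, ∀ y < n, x < y → p (arr μ₂ 0 y) → r₂ (arr μ₂ 0 y) (arr μ₂ 0 x) →
      ∃ c, Nearer n vec p k r₁ r₂ (μ₃.real 3) (arr μ₂ 0 x) (arr μ₂ 0 y) c := by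
    intro x hx y hy hxy hp hr
    obtain ⟨z, k1, k2, k3, k4, k5, k6⟩ := f3 x y hxy hy
      (by rw [Nat.div_eq_of_lt (by omega), Nat.div_eq_of_lt (by omega)]) hp hr
    have hne := hinj x hx z k2 k1
    exact ⟨_, hlt z k2, hne.symm, k3, hsort x hx z k2 k1, k4, k5, k6 hne⟩
  intro i hi j hj hij hpi hpj hr1 hr2
  obtain ⟨x, hx, rfl⟩ := hsurj i hi
  obtain ⟨y, hy, rfl⟩ := hsurj j hj
  rcases lt_trichotomy x y with hxy | rfl | hxy
  · obtain ⟨c, hc⟩ := key x hx y hy hxy hpj hr2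
    exact ⟨c, Or.inl hc⟩
  · exact absurd rfl hij
  · have hr3 := hsort y hy x hx hxy
    obtain ⟨c, hc⟩ := key y hy x hx hxy hpi (htie _ _ hr1 hr3)
    exact ⟨c, Or.inr ⟨hr3, hc⟩⟩

/-! ### Lines through two points of space -/

/-- The square of the norm of the cross product. -/
def crossSq (a b : ℕ → ℝ) : ℝ :=
  (a 0 * b 1 - a 1 * b 0) * (a 0 * b 1 - a 1 * b 0) +
    (a 1 * b 2 - a 2 * b 1) * (a 1 * b 2 - a 2 * b 1) +
    (a 2 * b 0 - a 0 * b 2) * (a 2 * b 0 - a 0 * b 2)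

/-- The square of the distance. -/
def distSq (a b : ℕ → ℝ) : ℝ :=
  (a 0 - b 0) * (a 0 - b 0) + (a 1 - b 1) * (a 1 - b 1) + (a 2 - b 2) * (a 2 - b 2)

theorem lineSq_eq (a b : ℕ → ℝ) : lineSq a b = crossSq a b / distSq a b := rfl

theorem crossSq_nonneg (a b : ℕ → ℝ) : 0 ≤ crossSq a b := by
  unfold crossSq
  refine add_nonneg (add_nonneg ?_ ?_) ?_ <;> exact mul_self_nonneg _

theorem lineSq_nonneg (a b : ℕ → ℝ) : 0 ≤ lineSq a b := by
  refine div_nonneg (crossSq_nonneg a b) (add_nonneg (add_nonneg ?_ ?_) ?_) <;>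
    exact mul_self_nonneg _

theorem lineSq_comm (a b : ℕ → ℝ) : lineSq a b = lineSq b a := by
  unfold lineSq
  congr 1 <;> ring

/-- The first three terms of a sequence as a vector of `ℝ³`. -/
noncomputable def toE (a : ℕ → ℝ) : E3 := !₂[a 0, a 1, a 2]

theorem norm_sq_E3 (x : E3) : ‖x‖ ^ 2 = x 0 * x 0 + x 1 * x 1 + x 2 * x 2 := by
  rw [EuclideanSpace.norm_sq_eq, Fin.sum_univ_three]
  simp only [Real.norm_eq_abs, sq_abs]
  ring

theorem norm_sq_toE (a : ℕ → ℝ) : ‖toE a‖ ^ 2 = normSq a := by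
  simp [norm_sq_E3, toE, normSq]

theorem norm_sq_sub_toE (a b : ℕ → ℝ) : ‖toE a - toE b‖ ^ 2 = distSq a b := by
  simp [norm_sq_E3, toE, distSq]

/-- The distance from a point to a line through two points is the height of a triangle. -/
theorem lineDist_sq {y a b : E3} {a' b' : ℕ → ℝ} (ha : ∀ c : Fin 3, a' c = a c - y c)
    (hb : ∀ c : Fin 3, b' c = b c - y c) (hab : a ≠ b) :
    lineDist y a b ^ 2 = lineSq a' b' := by
  have ha0 := ha 0
  have ha1 := ha 1
  have ha2 := ha 2
  have hb0 := hb 0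
  have hb1 := hb 1
  have hb2 := hb 2
  simp only [Fin.val_zero, Fin.val_one, Fin.val_two] at ha0 ha1 ha2 hb0 hb1 hb2
  have hd : 0 < distSq a' b' := by
    have : distSq a' b' = ‖a - b‖ ^ 2 := by
      simp only [norm_sq_E3, distSq, ha0, ha1, ha2, hb0, hb1, hb2, PiLp.sub_apply]
      ring
    rw [this]
    have := norm_pos_iff.2 (sub_ne_zero.2 hab)
    positivity
  -- the squared distance to the point with parameter `t`, by Lagrange's identity
  have key : ∀ t : ℝ, ‖y - AffineMap.lineMap a b t‖ ^ 2 * distSq a' b' = crossSq a' b' +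
      (t * distSq a' b' - (a' 0 * (a' 0 - b' 0) + a' 1 * (a' 1 - b' 1) +
        a' 2 * (a' 2 - b' 2))) ^ 2 := by
    intro t
    have e (c : Fin 3) : (y - AffineMap.lineMap a b t) c = y c - (t * (b c - a c) + a c) := by
      simp [AffineMap.lineMap_apply]
    simp only [norm_sq_E3, e, crossSq, distSq, ha0, ha1, ha2, hb0, hb1, hb2]
    ring
  have hne : (line[ℝ, a, b] : Set E3).Nonempty := ⟨a, left_mem_affineSpan_pair ℝ a b⟩
  rw [lineSq_eq]
  refine le_antisymm ?_ ?_
  · set t := (a' 0 * (a' 0 - b' 0) + a' 1 * (a' 1 - b' 1) + a' 2 * (a' 2 - b' 2)) / distSq a' b'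
      with ht
    have h1 : lineDist y a b ≤ ‖y - AffineMap.lineMap a b t‖ := by
      rw [← dist_eq_norm]
      exact Metric.infDist_le_dist_of_mem (AffineMap.lineMap_mem_affineSpan_pair t a b)
    have h2 := key t
    rw [ht, div_mul_cancel₀ _ hd.ne', sub_self, ← ht] at h2
    rw [le_div_iff₀ hd]
    calc lineDist y a b ^ 2 * distSq a' b'
        ≤ ‖y - AffineMap.lineMap a b t‖ ^ 2 * distSq a' b' := by
          gcongr
          exact Metric.infDist_nonneg
      _ = crossSq a' b' := by rw [h2]; ring
  · have h0 : Real.sqrt (crossSq a' b' / distSq a' b') ≤ lineDist y a b := by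
      refine (Metric.le_infDist hne).2 fun z hz => ?_
      obtain ⟨t, rfl⟩ := mem_affineSpan_pair_iff_exists_lineMap_eq.1 hz
      rw [dist_eq_norm]
      refine Real.sqrt_le_iff.2 ⟨norm_nonneg _, ?_⟩
      rw [div_le_iff₀ hd, key t]
      nlinarith [sq_nonneg (t * distSq a' b' - (a' 0 * (a' 0 - b' 0) + a' 1 * (a' 1 - b' 1) +
        a' 2 * (a' 2 - b' 2)))]
    calc crossSq a' b' / distSq a' b' = Real.sqrt (crossSq a' b' / distSq a' b') ^ 2 :=
          (Real.sq_sqrt (div_nonneg (crossSq_nonneg _ _) hd.le)).symm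
      _ ≤ _ := by gcongr

/-! ### Pairs in far directions -/

/-- The cross product of `ℝ³` with the Euclidean norm. -/
noncomputable def cr (x y : E3) : E3 :=
  !₂[x 0 * y 1 - x 1 * y 0, x 1 * y 2 - x 2 * y 1, x 2 * y 0 - x 0 * y 2]

theorem cr_sub (x x' y : E3) : cr (x - x') y = cr x y - cr x' y := by
  ext c
  fin_cases c <;> simp [cr] <;> ring

theorem cr_smul (s : ℝ) (x y : E3) : cr (s • x) y = s • cr x y := by
  ext c
  fin_cases c <;> simp [cr] <;> ring

theorem cr_smul_right (s : ℝ) (x y : E3) : cr x (s • y) = s • cr x y := by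
  ext c
  fin_cases c <;> simp [cr] <;> ring

theorem cr_self (x : E3) : cr x x = 0 := by
  ext c
  fin_cases c <;> simp [cr] <;> ring

theorem norm_cr_le (x y : E3) : ‖cr x y‖ ≤ ‖x‖ * ‖y‖ := by
  refine (pow_le_pow_iff_left₀ (norm_nonneg _) (by positivity) two_ne_zero).1 ?_
  rw [mul_pow, norm_sq_E3, norm_sq_E3, norm_sq_E3]
  simp only [cr, PiLp.toLp_apply, Matrix.cons_val]
  nlinarith [sq_nonneg (x 0 * y 0 + x 1 * y 1 + x 2 * y 2)]

theorem norm_sq_cr_toE (a b : ℕ → ℝ) : ‖cr (toE a) (toE b)‖ ^ 2 = crossSq a b := by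
  simp [norm_sq_E3, cr, toE, crossSq]

/-- If the directions `e` and `f` form an angle that is not too small, then moving `e` slightly and
increasing `q ≥ 1` hardly increases the ratio of `e × f` to `e - q f`. -/
theorem cross_ratio_le {e e' f : E3} (he : ‖e‖ = 1) (hf : ‖f‖ = 1) {q q' ξ τ : ℝ}
    (hq : 1 ≤ q) (hqq : q ≤ q') (hξ : ‖e - e'‖ ≤ ξ) (hτ0 : 0 ≤ τ) (hτ1 : τ < 1)
    (hτ : ξ ≤ τ * ‖cr e f‖) (hpos : 0 < ‖cr e f‖) :
    0 < ‖e' - q' • f‖ ∧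
    ‖cr e' f‖ / ‖e' - q' • f‖ ≤ (1 + τ) / (1 - τ) * (‖cr e f‖ / ‖e - q • f‖) := by
  have h1 : ‖cr e f‖ ≤ ‖e - q • f‖ := by
    have : cr e f = cr (e - q • f) f := by
      rw [cr_sub, cr_smul, cr_self, smul_zero, sub_zero]
    rw [this]
    simpa [hf] using norm_cr_le (e - q • f) f
  have expand (s : ℝ) : ‖e - s • f‖ ^ 2 = 1 - 2 * s * inner ℝ e f + s ^ 2 := by
    rw [norm_sub_sq_real, norm_smul, inner_smul_right, he, hf, mul_one, Real.norm_eq_abs, sq_abs]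
    ring
  have h2 : ‖e - q • f‖ ≤ ‖e - q' • f‖ := by
    refine (pow_le_pow_iff_left₀ (norm_nonneg _) (norm_nonneg _) two_ne_zero).1 ?_
    rw [expand, expand]
    have := real_inner_le_norm e f
    rw [he, hf] at this
    nlinarith
  have h3 : ‖e - q' • f‖ ≤ ‖e' - q' • f‖ + ξ := by
    have : e - q' • f = (e' - q' • f) + (e - e') := by abel
    rw [this]
    exact (norm_add_le _ _).trans (by gcongr)
  have h4 : ‖cr e' f‖ ≤ ‖cr e f‖ + ξ := by
    have : cr e' f = cr e f - cr (e - e') f := by rw [cr_sub]; abel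
    rw [this]
    refine (norm_sub_le _ _).trans ?_
    gcongr
    refine (norm_cr_le _ _).trans ?_
    rwa [hf, mul_one]
  have h5 : (1 - τ) * ‖e - q • f‖ ≤ ‖e' - q' • f‖ := by nlinarith
  have h6 : ‖cr e' f‖ ≤ (1 + τ) * ‖cr e f‖ := by nlinarith
  have h7 : 0 < ‖e - q • f‖ := hpos.trans_le h1
  have h8 : 0 < (1 - τ) * ‖e - q • f‖ := mul_pos (by linarith) h7
  refine ⟨h8.trans_le h5, ?_⟩
  rw [div_mul_div_comm]
  exact div_le_div₀ (by positivity) h6 h8 h5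

theorem norm_normalize_sub_le {x y : E3} (hx : 1 ≤ ‖x‖) (hy : y ≠ 0) :
    ‖‖x‖⁻¹ • x - ‖y‖⁻¹ • y‖ ≤ 2 * ‖x - y‖ := by
  have hx0 : 0 < ‖x‖ := by linarith
  have hy0 : 0 < ‖y‖ := norm_pos_iff.2 hy
  have e : ‖x‖⁻¹ • x - ‖y‖⁻¹ • y = ‖x‖⁻¹ • (x - y) + (‖x‖⁻¹ * (‖y‖ - ‖x‖)) • (‖y‖⁻¹ • y) := by
    rw [smul_smul, smul_sub, sub_add, ← sub_smul]
    congr 2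
    field_simp
    ring
  rw [e]
  refine (norm_add_le _ _).trans ?_
  rw [norm_smul, norm_smul, norm_smul, norm_mul, norm_inv, norm_inv, norm_norm, norm_norm,
    inv_mul_cancel₀ hy0.ne', mul_one]
  have h1 : ‖x‖⁻¹ ≤ 1 := inv_le_one_of_one_le₀ hx
  have h2 : ‖‖y‖ - ‖x‖‖ ≤ ‖x - y‖ := by
    rw [Real.norm_eq_abs, norm_sub_rev x y]
    exact abs_norm_sub_norm_le y x
  have h3 : 0 ≤ ‖x‖⁻¹ := by positivity
  nlinarith [norm_nonneg (x - y), norm_nonneg (‖y‖ - ‖x‖)]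

/-- If `y` lies in a far direction from `x`, then `x` can be replaced by a point `x'` in almost the
same direction that is at most as far from the origin. -/
theorem cross_div_dist_le {x x' y : E3} (hx' : x' ≠ 0) (h₁ : ‖x'‖ ≤ ‖x‖) (h₂ : ‖x‖ ≤ ‖y‖)
    {ξ τ δ : ℝ} (hξ : ‖‖x‖⁻¹ • x - ‖x'‖⁻¹ • x'‖ ≤ ξ) (hτ0 : 0 ≤ τ) (hτ1 : τ < 1) (hδ : 0 < δ)
    (hτ : ξ ≤ τ * δ) (hcr : δ * (‖x‖ * ‖y‖) ≤ ‖cr x y‖) :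
    x' ≠ y ∧ ‖cr x' y‖ / ‖x' - y‖ ≤ (1 + τ) / (1 - τ) * (‖cr x y‖ / ‖x - y‖) := by
  have hx'0 : 0 < ‖x'‖ := norm_pos_iff.2 hx'
  have hx0 : 0 < ‖x‖ := by linarith
  have hy0 : 0 < ‖y‖ := by linarith
  have unit {z : E3} (hz : 0 < ‖z‖) : ‖‖z‖⁻¹ • z‖ = 1 := by
    rw [norm_smul, norm_inv, norm_norm, inv_mul_cancel₀ hz.ne']
  -- homogeneity reduces the claim to unit vectors
  have hcr' {z : E3} (hz : 0 < ‖z‖) :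
      ‖cr z y‖ = ‖z‖ * ‖y‖ * ‖cr (‖z‖⁻¹ • z) (‖y‖⁻¹ • y)‖ := by
    rw [cr_smul, cr_smul_right, norm_smul, norm_smul, norm_inv, norm_inv, norm_norm, norm_norm]
    field_simp
  have hsub {z : E3} (hz : 0 < ‖z‖) :
      ‖z - y‖ = ‖z‖ * ‖‖z‖⁻¹ • z - (‖y‖ / ‖z‖) • (‖y‖⁻¹ • y)‖ := by
    have : z - y = ‖z‖ • (‖z‖⁻¹ • z - (‖y‖ / ‖z‖) • (‖y‖⁻¹ • y)) := by
      rw [smul_sub, smul_smul, smul_smul, smul_smul, mul_inv_cancel₀ hz.ne', one_smul]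
      congr 1
      rw [show ‖z‖ * (‖y‖ / ‖z‖) * ‖y‖⁻¹ = 1 by field_simp, one_smul]
    nth_rewrite 1 [this]
    rw [norm_smul, norm_norm]
  have hδ' : δ ≤ ‖cr (‖x‖⁻¹ • x) (‖y‖⁻¹ • y)‖ := by
    rw [hcr' hx0, mul_comm δ] at hcr
    exact le_of_mul_le_mul_left hcr (by positivity)
  obtain ⟨hpos, hle⟩ := cross_ratio_le (q := ‖y‖ / ‖x‖) (q' := ‖y‖ / ‖x'‖) (unit hx0) (unit hy0)
    ((one_le_div hx0).2 h₂) (by gcongr) hξ hτ0 hτ1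
    (hτ.trans (by gcongr)) (hδ.trans_le hδ')
  constructor
  · rw [← sub_ne_zero, ← norm_pos_iff, hsub hx'0]
    positivity
  · rw [hcr' hx0, hcr' hx'0, hsub hx0, hsub hx'0]
    rw [mul_assoc, mul_div_mul_left _ _ hx'0.ne', mul_assoc, mul_div_mul_left _ _ hx0.ne',
      mul_div_assoc, mul_div_assoc, mul_left_comm]
    gcongr

/-! ### Spanners -/

/-- The theta-graph argument. Every pair of points `i`, `j` of `S` has an edge from one end to a point
`c` of `S` that is a step of relative length `l` towards the other end, up to a small error. If
`W` stretches edges by a factor of at most `M`, then it stretches all distances by a factor of at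
most `t * M`. -/
theorem spanner_stretch {ι E F : Type*} [NormedAddCommGroup E] [NormedSpace ℝ E]
    [NormedAddCommGroup F] (S : Finset ι) (U : ι → E) (W : ι → F) {M t η : ℝ}
    (hM : 0 ≤ M) (hη0 : 0 ≤ η) (hη1 : η < 1) (ht : 1 + η ≤ t * (1 - η))
    (H : ∀ i ∈ S, ∀ j ∈ S, i ≠ j → ∃ i' j', (i' = i ∧ j' = j ∨ i' = j ∧ j' = i) ∧ ∃ c ∈ S, ∃ l : ℝ,
      0 < l ∧ l ≤ 1 ∧ 0 < ‖U j' - U i'‖ ∧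
      ‖(U c - U i') - l • (U j' - U i')‖ ≤ η * (l * ‖U j' - U i'‖) ∧
      ‖W i' - W c‖ ≤ M * ‖U c - U i'‖) :
    ∀ i ∈ S, ∀ j ∈ S, ‖W i - W j‖ ≤ t * M * ‖U i - U j‖ := by
  classical
  by_contra hcon
  push Not at hcon
  obtain ⟨i₀, hi₀, j₀, hj₀, h₀⟩ := hcon
  have ht0 : 0 < t := by
    by_contra hneg
    nlinarith
  -- a pair at minimal distance among those that are stretched too much
  obtain ⟨⟨i, j⟩, hmem, hmin⟩ := Finset.exists_min_image
    ((S ×ˢ S).filter fun x => t * M * ‖U x.1 - U x.2‖ < ‖W x.1 - W x.2‖)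
    (fun x => ‖U x.1 - U x.2‖) ⟨(i₀, j₀), by simp [hi₀, hj₀, h₀]⟩
  simp only [Finset.mem_filter, Finset.mem_product] at hmem hmin
  obtain ⟨⟨hi, hj⟩, hbad⟩ := hmem
  have hij : i ≠ j := by
    rintro rfl
    simp at hbad
  obtain ⟨i', j', hor, c, hc, l, hl0, hl1, hd, hstep, hedge⟩ := H i hi j hj hij
  have hj' : j' ∈ S := by rcases hor with ⟨-, rfl⟩ | ⟨-, rfl⟩ <;> assumption
  have eU : ‖U i - U j‖ = ‖U j' - U i'‖ := by
    rcases hor with ⟨rfl, rfl⟩ | ⟨rfl, rfl⟩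
    · exact norm_sub_rev _ _
    · rfl
  have eW : ‖W i - W j‖ = ‖W i' - W j'‖ := by
    rcases hor with ⟨rfl, rfl⟩ | ⟨rfl, rfl⟩
    · rfl
    · exact norm_sub_rev _ _
  rw [eU, eW] at hbad
  have h1 : ‖U c - U i'‖ ≤ l * (1 + η) * ‖U j' - U i'‖ := by
    have : U c - U i' = ((U c - U i') - l • (U j' - U i')) + l • (U j' - U i') := by abel
    rw [this]
    refine (norm_add_le _ _).trans ?_
    rw [norm_smul, Real.norm_of_nonneg hl0.le]
    linarith
  have h2 : ‖U c - U j'‖ ≤ (1 - l * (1 - η)) * ‖U j' - U i'‖ := by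
    have : U c - U j' = ((U c - U i') - l • (U j' - U i')) - (1 - l) • (U j' - U i') := by
      rw [sub_smul, one_smul]
      abel
    rw [this]
    refine (norm_sub_le _ _).trans ?_
    rw [norm_smul, Real.norm_of_nonneg (by linarith : 0 ≤ 1 - l)]
    linarith
  have h3 : ‖W c - W j'‖ ≤ t * M * ‖U c - U j'‖ := by
    by_contra hneg
    have := hmin (c, j') ⟨⟨hc, hj'⟩, not_le.1 hneg⟩
    simp only at this
    rw [eU] at this
    have : 0 < l * (1 - η) * ‖U j' - U i'‖ := by
      have : 0 < 1 - η := by linarith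
      positivity
    linarith
  have h4 : ‖W i' - W j'‖ ≤ ‖W i' - W c‖ + ‖W c - W j'‖ := norm_sub_le_norm_sub_add_norm_sub _ _ _
  have h5 : M * ‖U c - U i'‖ ≤ M * (l * (1 + η) * ‖U j' - U i'‖) := by gcongr
  have h6 : t * M * ‖U c - U j'‖ ≤ t * M * ((1 - l * (1 - η)) * ‖U j' - U i'‖) := by gcongr
  have h7 : M * l * ‖U j' - U i'‖ * (1 + η) ≤ M * l * ‖U j' - U i'‖ * (t * (1 - η)) := by gcongr
  nlinarith

/-! ### Central projections to a plane -/

/-- The three axes in some order. -/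
def axes : List (ℕ × ℕ × ℕ) :=
  [(0, 1, 2), (0, 2, 1), (1, 0, 2), (1, 2, 0), (2, 0, 1), (2, 1, 0)]

theorem normSq_axes {k u v : ℕ} (h : (k, u, v) ∈ axes) (a : ℕ → ℝ) :
    normSq a = a k ^ 2 + a u ^ 2 + a v ^ 2 := by
  simp only [axes, List.mem_cons, Prod.mk.injEq, List.not_mem_nil, or_false] at h
  rcases h with ⟨rfl, rfl, rfl⟩ | ⟨rfl, rfl, rfl⟩ | ⟨rfl, rfl, rfl⟩ | ⟨rfl, rfl, rfl⟩ |
    ⟨rfl, rfl, rfl⟩ | ⟨rfl, rfl, rfl⟩ <;> simp only [normSq] <;> ring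

theorem crossSq_axes {k u v : ℕ} (h : (k, u, v) ∈ axes) (a b : ℕ → ℝ) :
    crossSq a b = (a k * b u - a u * b k) ^ 2 + (a k * b v - a v * b k) ^ 2 +
      (a u * b v - a v * b u) ^ 2 := by
  simp only [axes, List.mem_cons, Prod.mk.injEq, List.not_mem_nil, or_false] at h
  rcases h with ⟨rfl, rfl, rfl⟩ | ⟨rfl, rfl, rfl⟩ | ⟨rfl, rfl, rfl⟩ | ⟨rfl, rfl, rfl⟩ |
    ⟨rfl, rfl, rfl⟩ | ⟨rfl, rfl, rfl⟩ <;> simp only [crossSq] <;> ring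

/-- The coordinate in direction `u` of the central projection to the plane where the coordinate
in direction `k` is `1`. -/
noncomputable def chart (k u : ℕ) (a : ℕ → ℝ) : ℝ := a u / a k

theorem normSq_nonneg (a : ℕ → ℝ) : 0 ≤ normSq a := by
  rw [← norm_sq_toE]
  positivity

theorem norm_toE (a : ℕ → ℝ) : ‖toE a‖ = Real.sqrt (normSq a) := by
  rw [← norm_sq_toE, Real.sqrt_sq (norm_nonneg _)]

/-- The sine of the angle between the lines from the origin to `a` and `b`. -/
noncomputable def sine (a b : ℕ → ℝ) : ℝ := Real.sqrt (crossSq a b / (normSq a * normSq b))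

theorem sine_nonneg (a b : ℕ → ℝ) : 0 ≤ sine a b := Real.sqrt_nonneg _

theorem sine_sq (a b : ℕ → ℝ) : sine a b ^ 2 = crossSq a b / (normSq a * normSq b) :=
  Real.sq_sqrt (div_nonneg (crossSq_nonneg _ _) (mul_nonneg (normSq_nonneg _) (normSq_nonneg _)))

/-- A linear image of the chart coordinates whose Euclidean norm approximates, up to a constant
factor, the sine near the point `(x₀, y₀)` of the chart: the cross product with `(x₀, y₀, 1)`. -/
noncomputable def flat (x₀ y₀ x y : ℝ) : E3 := !₂[x, y, x₀ * y - y₀ * x]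

theorem flat_sub (x₀ y₀ x y x' y' : ℝ) :
    flat x₀ y₀ x y - flat x₀ y₀ x' y' = flat x₀ y₀ (x - x') (y - y') := by
  ext c
  fin_cases c <;> simp [flat]
  ring

theorem flat_smul (x₀ y₀ s x y : ℝ) : s • flat x₀ y₀ x y = flat x₀ y₀ (s * x) (s * y) := by
  ext c
  fin_cases c <;> simp [flat]
  ring

theorem abs_le_norm_flat (x₀ y₀ x y : ℝ) :
    |x| ≤ ‖flat x₀ y₀ x y‖ ∧ |y| ≤ ‖flat x₀ y₀ x y‖ :=
  ⟨PiLp.norm_apply_le (flat x₀ y₀ x y) 0, PiLp.norm_apply_le (flat x₀ y₀ x y) 1⟩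

theorem norm_vec3_le (x y z : ℝ) : ‖(!₂[x, y, z] : E3)‖ ≤ |x| + |y| + |z| := by
  refine (pow_le_pow_iff_left₀ (norm_nonneg _) (by positivity) two_ne_zero).1 ?_
  rw [norm_sq_E3]
  simp only [Matrix.cons_val]
  rw [← abs_mul_abs_self x, ← abs_mul_abs_self y, ← abs_mul_abs_self z]
  nlinarith [mul_nonneg (abs_nonneg x) (abs_nonneg y), mul_nonneg (abs_nonneg x) (abs_nonneg z),
    mul_nonneg (abs_nonneg y) (abs_nonneg z)]

theorem norm_flat_le {x₀ y₀ : ℝ} (hx : |x₀| ≤ 1) (hy : |y₀| ≤ 1) (x y : ℝ) :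
    ‖flat x₀ y₀ x y‖ ≤ 2 * (|x| + |y|) := by
  refine (norm_vec3_le _ _ _).trans ?_
  have h1 : |x₀ * y - y₀ * x| ≤ |x₀ * y| + |y₀ * x| := abs_sub _ _
  rw [abs_mul, abs_mul] at h1
  nlinarith [abs_nonneg x, abs_nonneg y]

/-- In a small cell of the chart, the sine is the Euclidean norm of a linear function, up to a
constant factor and small errors. -/
theorem sine_flat {k u v : ℕ} (hax : (k, u, v) ∈ axes) {a b : ℕ → ℝ} (ha : a k ≠ 0) (hb : b k ≠ 0)
    {x₀ y₀ η : ℝ} (hη0 : 0 ≤ η) (hη1 : 2 * η < 1)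
    (hax₀ : |chart k u a - x₀| ≤ η) (hay₀ : |chart k v a - y₀| ≤ η)
    (hbx₀ : |chart k u b - x₀| ≤ η) (hby₀ : |chart k v b - y₀| ≤ η) :
    (1 - 2 * η) ^ 2 * ‖(!₂[x₀, y₀, 1] : E3)‖ ^ 2 * sine a b ≤ (1 + 2 * η) *
      ‖flat x₀ y₀ (chart k u b) (chart k v b) - flat x₀ y₀ (chart k u a) (chart k v a)‖ ∧
    (1 - 2 * η) *
      ‖flat x₀ y₀ (chart k u b) (chart k v b) - flat x₀ y₀ (chart k u a) (chart k v a)‖ ≤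
        (1 + 2 * η) ^ 2 * ‖(!₂[x₀, y₀, 1] : E3)‖ ^ 2 * sine a b := by
  set ρ₀ := ‖(!₂[x₀, y₀, 1] : E3)‖ with hρ₀
  have one_le : 1 ≤ ρ₀ := by
    simpa using PiLp.norm_apply_le (!₂[x₀, y₀, 1] : E3) 2
  -- the norm of a representative in the plane of the chart
  have hρ : ∀ c : ℕ → ℝ, |chart k u c - x₀| ≤ η → |chart k v c - y₀| ≤ η →
      (1 - 2 * η) * ρ₀ ≤ ‖(!₂[chart k u c, chart k v c, 1] : E3)‖ ∧
      ‖(!₂[chart k u c, chart k v c, 1] : E3)‖ ≤ (1 + 2 * η) * ρ₀ := by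
    intro c h1 h2
    have h3 : ‖(!₂[chart k u c, chart k v c, 1] : E3) - !₂[x₀, y₀, 1]‖ ≤ 2 * η := by
      have : (!₂[chart k u c, chart k v c, 1] : E3) - !₂[x₀, y₀, 1] =
          !₂[chart k u c - x₀, chart k v c - y₀, 0] := by
        ext i
        fin_cases i <;> simp
      rw [this]
      refine (norm_vec3_le _ _ _).trans ?_
      rw [abs_zero]
      linarith
    have h4 := abs_le.1 ((abs_norm_sub_norm_le _ _).trans h3)
    rw [← hρ₀] at h4
    constructor <;> nlinarith
  obtain ⟨ra1, ra2⟩ := hρ a hax₀ hay₀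
  obtain ⟨rb1, rb2⟩ := hρ b hbx₀ hby₀
  set ρa := ‖(!₂[chart k u a, chart k v a, 1] : E3)‖ with hρa
  set ρb := ‖(!₂[chart k u b, chart k v b, 1] : E3)‖ with hρb
  set K : E3 := !₂[chart k u b - chart k u a, chart k v b - chart k v a,
    chart k u a * chart k v b - chart k v a * chart k u b] with hK
  have pos1 : 0 < 1 - 2 * η := by linarith
  have pos2 : 0 < (1 - 2 * η) * ρ₀ := by positivity
  have posa : 0 < ρa := by linarith
  have posb : 0 < ρb := by linarith
  have hsin : ρa * ρb * sine a b = ‖K‖ := by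
    refine (pow_left_inj₀ (mul_nonneg (by positivity) (sine_nonneg _ _)) (norm_nonneg _)
      two_ne_zero).1 ?_
    have ea : normSq a = a k ^ 2 * ρa ^ 2 := by
      rw [normSq_axes hax, hρa, norm_sq_E3]
      simp only [Matrix.cons_val, chart]
      field_simp
      ring
    have eb : normSq b = b k ^ 2 * ρb ^ 2 := by
      rw [normSq_axes hax, hρb, norm_sq_E3]
      simp only [Matrix.cons_val, chart]
      field_simp
      ring
    have ec : crossSq a b = a k ^ 2 * b k ^ 2 * ‖K‖ ^ 2 := by
      rw [crossSq_axes hax, hK, norm_sq_E3]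
      simp only [Matrix.cons_val, chart]
      field_simp
    rw [mul_pow, sine_sq, ea, eb, ec]
    field_simp
  rw [flat_sub]
  set G := ‖flat x₀ y₀ (chart k u b - chart k u a) (chart k v b - chart k v a)‖ with hG
  have hKG : ‖K - flat x₀ y₀ (chart k u b - chart k u a) (chart k v b - chart k v a)‖ ≤
      2 * η * G := by
    obtain ⟨g1, g2⟩ := abs_le_norm_flat x₀ y₀ (chart k u b - chart k u a) (chart k v b - chart k v a)
    rw [← hG] at g1 g2
    have : K - flat x₀ y₀ (chart k u b - chart k u a) (chart k v b - chart k v a) =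
        !₂[0, 0, (chart k u a - x₀) * (chart k v b - chart k v a) -
          (chart k v a - y₀) * (chart k u b - chart k u a)] := by
      ext i
      fin_cases i <;> simp [hK, flat]
      ring
    rw [this]
    refine (norm_vec3_le _ _ _).trans ?_
    rw [abs_zero, zero_add, zero_add]
    refine (abs_sub _ _).trans ?_
    rw [abs_mul, abs_mul]
    calc _ ≤ η * G + η * G := by gcongr
      _ = 2 * η * G := by ring
  have hKG' := abs_le.1 ((abs_norm_sub_norm_le _ _).trans hKG)
  rw [← hG] at hKG'
  have hs := sine_nonneg a b
  constructor
  · calc (1 - 2 * η) ^ 2 * ρ₀ ^ 2 * sine a b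
        = ((1 - 2 * η) * ρ₀) * ((1 - 2 * η) * ρ₀) * sine a b := by ring
      _ ≤ ρa * ρb * sine a b := by gcongr
      _ ≤ (1 + 2 * η) * G := by rw [hsin]; linarith
  · calc (1 - 2 * η) * G ≤ ρa * ρb * sine a b := by rw [hsin]; linarith
      _ ≤ ((1 + 2 * η) * ρ₀) * ((1 + 2 * η) * ρ₀) * sine a b := by gcongr
      _ = _ := by ring

/-! ### Pairs in near directions -/

/-- The image of `a` under the inversion at the unit sphere. -/
noncomputable def inversion (a : ℕ → ℝ) : E3 := (normSq a)⁻¹ • toE a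

theorem norm_inversion_sub {a b : ℕ → ℝ} (ha : 0 < normSq a) (hb : 0 < normSq b) :
    ‖inversion a - inversion b‖ ^ 2 = distSq a b / (normSq a * normSq b) := by
  have e : distSq a b = normSq a + normSq b - 2 * inner ℝ (toE a) (toE b) := by
    rw [← norm_sq_sub_toE, norm_sub_sq_real, norm_sq_toE, norm_sq_toE]
    ring
  rw [e, norm_sub_sq_real, inversion, inversion, norm_smul, norm_smul, mul_pow, mul_pow,
    norm_sq_toE, norm_sq_toE, inner_smul_left, inner_smul_right, Real.norm_eq_abs, Real.norm_eq_abs,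
    sq_abs, sq_abs]
  simp only [conj_trivial]
  field_simp
  ring

/-- The line through `a` and `b` has distance at least `s` from the origin if and only if the inversion
stretches the sine metric by at most `1 / s`. -/
theorem le_lineSq_iff {a b : ℕ → ℝ} (ha : 0 < normSq a) (hb : 0 < normSq b) (hab : 0 < distSq a b)
    {s t : ℝ} (hs : 0 ≤ s) (ht : 0 ≤ t) :
    s ^ 2 ≤ t ^ 2 * lineSq a b ↔ s * ‖inversion a - inversion b‖ ≤ t * sine a b := by
  rw [← pow_le_pow_iff_left₀ (mul_nonneg hs (norm_nonneg _)) (mul_nonneg ht (sine_nonneg _ _))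
    two_ne_zero, mul_pow, mul_pow, norm_inversion_sub ha hb, sine_sq, lineSq_eq, ← mul_div_assoc,
    ← mul_div_assoc, ← mul_div_assoc, div_le_div_iff_of_pos_right (mul_pos ha hb), le_div_iff₀ hab]

/-- Within a cell of the chart, the lines tried for the edges of a theta graph contain a good
approximation for the nearest line. -/
theorem near_le {k u v : ℕ} (hax : (k, u, v) ∈ axes) (vec : ℕ → ℕ → ℝ) (S : Finset ℕ)
    {x₀ y₀ η s : ℝ} (hx₀ : |x₀| ≤ 1) (hy₀ : |y₀| ≤ 1) (hη0 : 0 ≤ η) (hη1 : 2 * η < 1) (hs : 0 < s)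
    (hpos : ∀ i ∈ S, vec i k ≠ 0) (hx : ∀ i ∈ S, |chart k u (vec i) - x₀| ≤ η)
    (hy : ∀ i ∈ S, |chart k v (vec i) - y₀| ≤ η)
    (hd : ∀ i ∈ S, ∀ j ∈ S, i ≠ j → 0 < distSq (vec i) (vec j))
    (H : ∀ i ∈ S, ∀ j ∈ S, i ≠ j → ∃ i' j', (i' = i ∧ j' = j ∨ i' = j ∧ j' = i) ∧ ∃ c ∈ S, ∃ l : ℝ,
      0 < l ∧ l ≤ 1 ∧ c ≠ i' ∧ s ^ 2 ≤ lineSq (vec i') (vec c) ∧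
      ∃ r, 0 < r ∧ (r ≤ |chart k u (vec j') - chart k u (vec i')| ∨
        r ≤ |chart k v (vec j') - chart k v (vec i')|) ∧
      |(chart k u (vec c) - chart k u (vec i')) - l * (chart k u (vec j') - chart k u (vec i'))| +
      |(chart k v (vec c) - chart k v (vec i')) - l * (chart k v (vec j') - chart k v (vec i'))| ≤
        η * (l * r)) :
    ∀ i ∈ S, ∀ j ∈ S, i ≠ j →
      s ^ 2 ≤ (((1 + 2 * η) / (1 - 2 * η)) ^ 4) ^ 2 * lineSq (vec i) (vec j) := by
  have hN : ∀ i ∈ S, 0 < normSq (vec i) := by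
    intro i hi
    rw [normSq_axes hax]
    have := hpos i hi
    positivity
  have pos1 : 0 < 1 - 2 * η := by linarith
  set ρ₀ := ‖(!₂[x₀, y₀, 1] : E3)‖ with hρ₀
  have one_le : 1 ≤ ρ₀ := by
    simpa using PiLp.norm_apply_le (!₂[x₀, y₀, 1] : E3) 2
  set M := (1 + 2 * η) / ((1 - 2 * η) ^ 2 * ρ₀ ^ 2) with hM
  have key := spanner_stretch S (fun i => flat x₀ y₀ (chart k u (vec i)) (chart k v (vec i)))
    (fun i => s • inversion (vec i)) (M := M) (t := (1 + 2 * η) / (1 - 2 * η)) (η := 2 * η)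
    (by positivity) (by positivity) hη1 (by rw [div_mul_cancel₀ _ pos1.ne']) ?_
  · intro i hi j hj hij
    rw [le_lineSq_iff (hN i hi) (hN j hj) (hd i hi j hj hij) hs.le (by positivity)]
    have h1 := key i hi j hj
    rw [← smul_sub, norm_smul, Real.norm_of_nonneg hs.le, norm_sub_rev (flat _ _ _ _)] at h1
    refine h1.trans ?_
    have h2 := (sine_flat hax (hpos i hi) (hpos j hj) hη0 hη1 (hx i hi) (hy i hi) (hx j hj)
      (hy j hj)).2
    rw [← hρ₀] at h2
    calc _ ≤ (1 + 2 * η) / (1 - 2 * η) * M *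
          ((1 + 2 * η) ^ 2 * ρ₀ ^ 2 * sine (vec i) (vec j) / (1 - 2 * η)) := by
            gcongr
            rwa [le_div_iff₀' pos1]
      _ = _ := by
        rw [hM]
        field_simp
  · intro i hi j hj hij
    obtain ⟨i', j', hor, c, hc, l, hl0, hl1, hci, hle, r, hr, hrle, hstep⟩ := H i hi j hj hij
    have hi' : i' ∈ S := by rcases hor with ⟨rfl, -⟩ | ⟨rfl, -⟩ <;> assumption
    refine ⟨i', j', hor, c, hc, l, hl0, hl1, ?_⟩
    have hr' : r ≤ ‖flat x₀ y₀ (chart k u (vec j')) (chart k v (vec j')) -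
        flat x₀ y₀ (chart k u (vec i')) (chart k v (vec i'))‖ := by
      rw [flat_sub]
      have := abs_le_norm_flat x₀ y₀ (chart k u (vec j') - chart k u (vec i'))
        (chart k v (vec j') - chart k v (vec i'))
      exact hrle.elim this.1.trans' this.2.trans'
    refine ⟨hr.trans_le hr', ?_, ?_⟩
    · refine le_trans ?_ (mul_le_mul_of_nonneg_left
        (mul_le_mul_of_nonneg_left hr' hl0.le) (by positivity))
      rw [flat_sub, flat_sub, flat_smul, flat_sub]
      refine (norm_flat_le hx₀ hy₀ _ _).trans ?_
      linarith
    · have h1 := (le_lineSq_iff (hN i' hi') (hN c hc) (hd i' hi' c hc hci.symm) hs.le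
        zero_le_one).1 (by simpa using hle)
      rw [← smul_sub, norm_smul, Real.norm_of_nonneg hs.le]
      refine h1.trans ?_
      have h2 := (sine_flat hax (hpos i' hi') (hpos c hc) hη0 hη1 (hx i' hi') (hy i' hi') (hx c hc)
        (hy c hc)).1
      rw [← hρ₀] at h2
      rw [one_mul, hM, div_mul_eq_mul_div, le_div_iff₀ (by positivity)]
      linarith

/-- If `a` and `b` have nearly the same direction, up to sign, then they are near each other in the
chart for the largest coordinate of `a`. -/
theorem chart_near {k u v : ℕ} (hax : (k, u, v) ∈ axes) {a b : ℕ → ℝ} (ha : 0 < normSq a)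
    (hb : 0 < normSq b) (hu : |a u| ≤ |a k|) (hv : |a v| ≤ |a k|) {δ : ℝ} (hδ0 : 0 ≤ δ)
    (hδ : 8 * δ ≤ 1) (h : sine a b ≤ δ) :
    a k ≠ 0 ∧ b k ≠ 0 ∧ |chart k u a| ≤ 1 ∧ |chart k v a| ≤ 1 ∧
      |chart k u b - chart k u a| ≤ 12 * δ ∧ |chart k v b - chart k v a| ≤ 12 * δ := by
  have ea := normSq_axes hax a
  have eb := normSq_axes hax b
  have hk : a k ≠ 0 := by
    intro h0
    rw [h0, abs_zero] at hu hv
    have h1 := abs_eq_zero.1 (le_antisymm hu (abs_nonneg _))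
    have h2 := abs_eq_zero.1 (le_antisymm hv (abs_nonneg _))
    rw [ea, h0, h1, h2] at ha
    norm_num at ha
  have hk0 : 0 < |a k| := abs_pos.2 hk
  set A := Real.sqrt (normSq a) with hA
  set B := Real.sqrt (normSq b) with hB
  have hA2 : A ^ 2 = normSq a := Real.sq_sqrt ha.le
  have hB2 : B ^ 2 = normSq b := Real.sq_sqrt hb.le
  have hA0 : 0 < A := Real.sqrt_pos.2 ha
  have hB0 : 0 < B := Real.sqrt_pos.2 hb
  have hAk : A ≤ 2 * |a k| := by
    refine (pow_le_pow_iff_left₀ hA0.le (by positivity) two_ne_zero).1 ?_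
    have h1 := sq_le_sq.2 hu
    have h2 := sq_le_sq.2 hv
    rw [hA2, ea, mul_pow, sq_abs]
    linarith [sq_nonneg (a k)]
  have hc : crossSq a b ≤ (δ * A * B) ^ 2 := by
    have : crossSq a b = sine a b ^ 2 * (A ^ 2 * B ^ 2) := by
      rw [sine_sq, hA2, hB2, div_mul_cancel₀ _ (by positivity)]
    rw [this]
    calc _ ≤ δ ^ 2 * (A ^ 2 * B ^ 2) := by
          gcongr
          exact sine_nonneg _ _
      _ = _ := by ring
  have hcoord : ∀ x, (a k * b x - a x * b k) ^ 2 ≤ crossSq a b → |b x - chart k x a * b k| ≤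
      2 * δ * B := by
    intro x hx
    have h1 : |a k * b x - a x * b k| ≤ δ * A * B := abs_le_of_sq_le_sq (hx.trans hc) (by positivity)
    have h2 : a k * b x - a x * b k = a k * (b x - chart k x a * b k) := by
      rw [chart]
      field_simp
    rw [h2, abs_mul] at h1
    have h3 : δ * A * B ≤ |a k| * (2 * δ * B) := by
      have : δ * A * B ≤ δ * (2 * |a k|) * B := by gcongr
      linarith
    exact le_of_mul_le_mul_left (h1.trans h3) hk0
  have ec := crossSq_axes hax a b
  have hbu := hcoord u (by
    rw [ec]
    linarith [sq_nonneg (a k * b v - a v * b k), sq_nonneg (a u * b v - a v * b u)])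
  have hbv := hcoord v (by
    rw [ec]
    linarith [sq_nonneg (a k * b u - a u * b k), sq_nonneg (a u * b v - a v * b u)])
  have hX : |chart k u a| ≤ 1 := by
    rw [chart, abs_div]
    exact div_le_one_of_le₀ hu (abs_nonneg _)
  have hY : |chart k v a| ≤ 1 := by
    rw [chart, abs_div]
    exact div_le_one_of_le₀ hv (abs_nonneg _)
  have hBsum : B ≤ |b k| + |b u| + |b v| := by
    refine (pow_le_pow_iff_left₀ hB0.le (by positivity) two_ne_zero).1 ?_
    rw [hB2, eb, ← sq_abs (b k), ← sq_abs (b u), ← sq_abs (b v)]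
    have h1 := mul_nonneg (abs_nonneg (b k)) (abs_nonneg (b u))
    have h2 := mul_nonneg (abs_nonneg (b k)) (abs_nonneg (b v))
    have h3 := mul_nonneg (abs_nonneg (b u)) (abs_nonneg (b v))
    linarith
  have bound : ∀ x, |chart k x a| ≤ 1 → |b x - chart k x a * b k| ≤ 2 * δ * B →
      |b x| ≤ |b k| + 2 * δ * B := by
    intro x h1 h2
    have h3 : b x = (b x - chart k x a * b k) + chart k x a * b k := by ring
    rw [h3]
    refine (abs_add_le _ _).trans ?_
    rw [abs_mul]
    have h4 : |chart k x a| * |b k| ≤ 1 * |b k| := by gcongr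
    linarith
  have hBk : B ≤ 6 * |b k| := by
    have h1 := bound u hX hbu
    have h2 := bound v hY hbv
    have h3 : 8 * δ * B ≤ 1 * B := by gcongr
    linarith
  have hbk0 : 0 < |b k| := by linarith
  have hbk : b k ≠ 0 := abs_pos.1 hbk0
  have final : ∀ x, |b x - chart k x a * b k| ≤ 2 * δ * B →
      |chart k x b - chart k x a| ≤ 12 * δ := by
    intro x hx
    have : b x - chart k x a * b k = b k * (chart k x b - chart k x a) := by
      rw [chart, chart]
      field_simp
    rw [this, abs_mul] at hx
    have h3 : 2 * δ * B ≤ |b k| * (12 * δ) := by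
      have : 2 * δ * B ≤ 2 * δ * (6 * |b k|) := by gcongr
      linarith
    exact le_of_mul_le_mul_left (hx.trans h3) hbk0
  exact ⟨hk, hbk, hX, hY, final u hbu, final v hbv⟩

/-- The replacement of `a` by the point `a'` nearest to the origin in the same cell of directions. -/
theorem far_le {k u v : ℕ} (hax : (k, u, v) ∈ axes) {a a' b : ℕ → ℝ} {σ x₀ y₀ r τ δ : ℝ}
    (hσ : |σ| = 1) (ha : 0 < σ * a k) (ha' : 0 < σ * a' k)
    (hax₀ : |chart k u a - x₀| ≤ r) (hay₀ : |chart k v a - y₀| ≤ r)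
    (hax' : |chart k u a' - x₀| ≤ r) (hay' : |chart k v a' - y₀| ≤ r)
    (h₁ : normSq a' ≤ normSq a) (h₂ : normSq a ≤ normSq b) (hr : 0 ≤ r) (hτ1 : τ < 1) (hδ : 0 < δ)
    (hτ : 8 * r ≤ τ * δ) (hsin : δ ≤ sine a b) :
    a' ≠ b ∧ lineSq a' b ≤ ((1 + τ) / (1 - τ)) ^ 2 * lineSq a b := by
  have hτ0 : 0 ≤ τ := by
    by_contra hneg
    nlinarith
  have hN : ∀ c : ℕ → ℝ, c k ≠ 0 → 0 < normSq c := by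
    intro c hc
    rw [normSq_axes hax]
    positivity
  have hak : a k ≠ 0 := by rintro h; simp [h] at ha
  have hak' : a' k ≠ 0 := by rintro h; simp [h] at ha'
  have habs : ∀ {c : ℕ → ℝ}, 0 < σ * c k → |c k| = σ * c k := by
    intro c hc
    rw [← abs_of_pos hc, abs_mul, hσ, one_mul]
  have hσ2 : σ * σ = 1 := by rw [← abs_mul_abs_self, hσ, one_mul]
  have hnb : 0 < normSq b := (hN a hak).trans_le h₂
  -- scaling by a positive number does not change the direction
  have hscale : ∀ {c : ℕ → ℝ}, c k ≠ 0 →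
      ‖toE c‖⁻¹ • toE c = ‖|c k|⁻¹ • toE c‖⁻¹ • (|c k|⁻¹ • toE c) := by
    intro c hc
    have h0 : 0 < |c k| := abs_pos.2 hc
    rw [norm_smul, norm_inv, Real.norm_eq_abs, abs_abs, smul_smul, mul_inv, inv_inv,
      mul_comm |c k|, mul_assoc, mul_inv_cancel₀ h0.ne', mul_one]
  have hne {c : ℕ → ℝ} (hc : c k ≠ 0) : toE c ≠ 0 := by
    rw [← norm_pos_iff, norm_toE]
    exact Real.sqrt_pos.2 (hN c hc)
  have hone : 1 ≤ ‖|a k|⁻¹ • toE a‖ := by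
    have : |a k| ≤ ‖toE a‖ := by
      refine abs_le_of_sq_le_sq ?_ (norm_nonneg _)
      rw [norm_sq_toE, normSq_axes hax]
      nlinarith [sq_nonneg (a u), sq_nonneg (a v)]
    rw [norm_smul, norm_inv, Real.norm_eq_abs, abs_abs, ← div_eq_inv_mul]
    exact (one_le_div (abs_pos.2 hak)).2 this
  have hdir : ‖‖toE a‖⁻¹ • toE a - ‖toE a'‖⁻¹ • toE a'‖ ≤ 8 * r := by
    rw [hscale hak, hscale hak']
    refine (norm_normalize_sub_le hone (smul_ne_zero (by simpa using hak') (hne hak'))).trans ?_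
    have hd : ‖|a k|⁻¹ • toE a - |a' k|⁻¹ • toE a'‖ ≤ 4 * r := by
      have e : |a k|⁻¹ • toE a - |a' k|⁻¹ • toE a' =
          toE (fun i => σ * (a i / a k - a' i / a' k)) := by
        have hinv : ∀ {c : ℕ → ℝ}, 0 < σ * c k → |c k|⁻¹ = σ * (c k)⁻¹ := by
          intro c hc
          rw [habs hc, mul_inv, inv_eq_of_mul_eq_one_left hσ2]
        rw [hinv ha, hinv ha']
        ext i
        fin_cases i <;> simp [toE] <;> ring
      refine (pow_le_pow_iff_left₀ (norm_nonneg _) (by positivity) two_ne_zero).1 ?_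
      rw [e, norm_sq_toE, normSq_axes hax, div_self hak, div_self hak', sub_self, mul_zero]
      have hbd : ∀ {x y z : ℝ}, |x - z| ≤ r → |y - z| ≤ r → (σ * (x - y)) ^ 2 ≤ (2 * r) ^ 2 := by
        intro x y z h1 h2
        rw [mul_pow, pow_two σ, hσ2, one_mul]
        rw [abs_le] at h1 h2
        exact sq_le_sq' (by linarith) (by linarith)
      have b1 := hbd hax₀ hax'
      have b2 := hbd hay₀ hay'
      rw [chart, chart] at b1 b2
      nlinarith [sq_nonneg r]
    linarith
  have hcr : δ * (‖toE a‖ * ‖toE b‖) ≤ ‖cr (toE a) (toE b)‖ := by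
    refine (pow_le_pow_iff_left₀ (by positivity) (norm_nonneg _) two_ne_zero).1 ?_
    rw [norm_sq_cr_toE, mul_pow, mul_pow, norm_sq_toE, norm_sq_toE]
    have h3 : δ ^ 2 ≤ sine a b ^ 2 := by gcongr
    rwa [sine_sq, le_div_iff₀ (mul_pos (hN a hak) hnb)] at h3
  obtain ⟨hab, hle⟩ := cross_div_dist_le (x := toE a) (x' := toE a') (y := toE b) (hne hak')
    (by rw [norm_toE, norm_toE]; exact Real.sqrt_le_sqrt h₁)
    (by rw [norm_toE, norm_toE]; exact Real.sqrt_le_sqrt h₂) hdir hτ0 hτ1 hδ hτ hcr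
  refine ⟨fun h => hab (by rw [h]), ?_⟩
  have e (c : ℕ → ℝ) : lineSq c b = (‖cr (toE c) (toE b)‖ / ‖toE c - toE b‖) ^ 2 := by
    rw [div_pow, norm_sq_cr_toE, norm_sq_sub_toE, lineSq_eq]
  rw [e, e, ← mul_pow]
  gcongr

/-! ### Cells of directions and their programs -/

theorem axes_lt {k u v : ℕ} (h : (k, u, v) ∈ axes) : k < 3 ∧ u < 3 ∧ v < 3 := by
  simp only [axes, List.mem_cons, Prod.mk.injEq, List.not_mem_nil, or_false] at h
  omega

theorem axes_swap {k u v : ℕ} (h : (k, u, v) ∈ axes) : (k, v, u) ∈ axes := by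
  simp only [axes, List.mem_cons, Prod.mk.injEq, List.not_mem_nil, or_false] at h ⊢
  omega

/-- The multiples of `1 / N` between `-1` and `1`. -/
def grid (N : ℕ) : List ℚ := (List.range (2 * N + 1)).map fun i : ℕ => (i : ℚ) / N - 1

theorem exists_mem_grid {N : ℕ} (hN : 0 < N) {x : ℝ} (hx : |x| ≤ 1) :
    ∃ q ∈ grid N, (q : ℝ) ≤ x ∧ x ≤ q + 1 / N ∧ |(q : ℝ)| ≤ 1 := by
  have hN' : (0 : ℝ) < N := Nat.cast_pos.2 hN
  obtain ⟨h1, h2⟩ := abs_le.1 hx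
  have h3 : 0 ≤ (x + 1) * N := mul_nonneg (by linarith) hN'.le
  have h4 := Nat.floor_le h3
  have h5 := (Nat.lt_floor_add_one ((x + 1) * N)).le
  have h6 : ((⌊(x + 1) * N⌋₊ : ℚ) / N - 1 : ℚ) = ((⌊(x + 1) * N⌋₊ : ℝ) / N - 1 : ℝ) := by
    push_cast
    rfl
  have h7 : (⌊(x + 1) * N⌋₊ : ℝ) / N ≤ x + 1 := (div_le_iff₀ hN').2 h4
  have h8 : x + 1 ≤ (⌊(x + 1) * N⌋₊ : ℝ) / N + 1 / N := by
    rw [← add_div, le_div_iff₀ hN']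
    exact h5
  have h9 : (0 : ℝ) ≤ (⌊(x + 1) * N⌋₊ : ℝ) / N := by positivity
  refine ⟨_, List.mem_map.2 ⟨⌊(x + 1) * N⌋₊, List.mem_range.2 ?_, rfl⟩, ?_⟩
  · refine Nat.lt_succ_of_le (Nat.floor_le_of_le ?_)
    push_cast
    nlinarith
  · rw [h6]
    exact ⟨by linarith, by linarith, abs_le.2 ⟨by linarith, by linarith⟩⟩

/-- The condition `|e| ≤ r`. -/
def absLe (e : RExp) (r : ℚ) : Test :=
  .both (.neg (.realLt (.const r) e)) (.neg (.realLt e (.const (-r))))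

/-- The expression for `chart`. -/
def chartE (k u : ℕ) (e : WExp) : RExp := .div (vecE u e) (vecE k e)

/-- A vector whose chart coordinates differ by at most `r` from `x₀` and `y₀`, and for which a
quantity `s` (which forces its coordinate in direction `k` to be nonzero) is positive. -/
def InCell (s : (ℕ → ℝ) → ℝ) (k u v : ℕ) (x₀ y₀ r : ℚ) (a : ℕ → ℝ) : Prop :=
  0 < s a ∧ |chart k u a - x₀| ≤ r ∧ |chart k v a - y₀| ≤ r

/-- The test for `InCell`. -/
def cellTest (s : WExp → RExp) (k u v : ℕ) (x₀ y₀ r : ℚ) (e : WExp) : Test :=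
  .both (.realLt (.const 0) (s e)) (.both (absLe (.sub (chartE k u e) (.const x₀)) r)
    (absLe (.sub (chartE k v e) (.const y₀)) r))

theorem computes_chartE {k u : ℕ} (hk : k < 3) (hu : u < 3) :
    Computes vec (chartE k u) fun i => chart k u (vec i) := by
  intro w μ h e
  simp only [chartE, RExp.eval, eval_vecE h hk, eval_vecE h hu, chart]

theorem holds_absLe {μ : Memory w} (e : RExp) (r : ℚ) :
    (absLe e r).Holds μ ↔ |e.eval μ| ≤ r := by
  simp only [absLe, Test.Holds, RExp.eval, not_lt, abs_le, Rat.cast_neg]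
  exact and_comm

theorem decides_cellTest {sE : WExp → RExp} {s : (ℕ → ℝ) → ℝ}
    (hs : Computes vec sE fun i => s (vec i)) {k u v : ℕ} (hax : (k, u, v) ∈ axes) (x₀ y₀ r : ℚ) :
    Decides vec (cellTest sE k u v x₀ y₀ r) fun i => InCell s k u v x₀ y₀ r (vec i) := by
  obtain ⟨hk, hu, hv⟩ := axes_lt hax
  intro w μ h e
  simp only [cellTest, Test.Holds, holds_absLe, RExp.eval, hs h, computes_chartE hk hu h,
    computes_chartE hk hv h, InCell, Rat.cast_zero]

/-- An oriented cell of directions: axes, a sign for the first of them, and the centre. -/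
abbrev FarTask : Type := (ℕ × ℕ × ℕ) × ℚ × ℚ × ℚ

/-- The oriented cells of directions of width `2 / m ^ 2`, which cover all directions. -/
def farTasks (m : ℕ) : List FarTask :=
  axes ×ˢ ([1, -1] : List ℚ) ×ˢ grid (m ^ 2) ×ˢ grid (m ^ 2)

/-- The program for an oriented cell: try the nearest point of the cell with all the others. -/
def farProg (m : ℕ) : FarTask → Prog
  | ((k, u, v), σ, x₀, y₀) =>
    scanCell (cellTest (fun e => .mul (.const σ) (vecE k e)) k u v x₀ y₀ (1 / m ^ 2)) normSqE

/-- What the program for an oriented cell achieves. -/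
def FarGoal (n : ℕ) (vec : ℕ → ℕ → ℝ) (m : ℕ) : FarTask → ℝ → Prop
  | ((k, u, v), σ, x₀, y₀) => ScanGoal n vec
      (fun i => InCell (fun a => σ * a k) k u v x₀ y₀ (1 / m ^ 2) (vec i)) fun i => normSq (vec i)

theorem ScanGoal.anti {p : ℕ → Prop} {k : ℕ → ℝ} : Antitone (ScanGoal n vec p k) := by
  intro v v' hv h i hi hp
  obtain ⟨m, h1, h2, h3, h4⟩ := h i hi hp
  exact ⟨m, h1, h2, h3, fun j hj hjm => hv.trans (h4 j hj hjm)⟩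

theorem FarGoal.anti (m : ℕ) (a : FarTask) : Antitone (FarGoal n vec m a) := ScanGoal.anti

theorem wp_farProg (hw : n + 1 < 2 ^ w) {m : ℕ} {a : FarTask} (ha : a ∈ farTasks m) {μ : Memory w}
    (ok : Ok n vec μ) :
    WP (farProg m a) (14 * n + 9) (fun μ' => Ok n vec μ' ∧ μ'.real 3 ≤ μ.real 3 ∧
      FarGoal n vec m a (μ'.real 3)) μ := by
  obtain ⟨⟨k, u, v⟩, σ, x₀, y₀⟩ := a
  have hax : (k, u, v) ∈ axes := (List.mem_product.1 ha).1
  refine wp_scanCell hw (decides_cellTest (s := fun a => σ * a k) ?_ hax x₀ y₀ _) ?_ ok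
  · intro w μ h e
    simp only [RExp.eval, eval_vecE h (axes_lt hax).1]
  · intro w μ h e
    exact eval_normSqE h e

/-- A cell of directions up to sign, given by axes and the centre, and the smallest slope of a cone in
the chart. -/
abbrev NearTask : Type := (ℕ × ℕ × ℕ) × ℚ × ℚ × ℚ

/-- The cells of width `2 / m`, and cones for the slopes between `-1` and `1`. The centres have distance
`1 / (2 * m)`, so that each pair of nearby directions has a cell in common. Slopes above `1` are
covered by exchanging the axes of the chart. -/
def nearTasks (m : ℕ) : List NearTask := axes ×ˢ grid (2 * m) ×ˢ grid (2 * m) ×ˢ grid m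

/-- The first of two functions that describe a cone: a point is seen from another one within the slopes
from `κ` to `κ + d`, in the direction of increasing `u`, if both functions are larger there. -/
noncomputable def coneKey₁ (k u v : ℕ) (κ : ℚ) (a : ℕ → ℝ) : ℝ := chart k v a - κ * chart k u a

/-- The second of the two functions that describe a cone. -/
noncomputable def coneKey₂ (k u v : ℕ) (κ d : ℚ) (a : ℕ → ℝ) : ℝ :=
  (κ + d : ℚ) * chart k u a - chart k v a

/-- The expression for `coneKey₁`. -/
def coneKeyE₁ (k u v : ℕ) (κ : ℚ) (e : WExp) : RExp :=
  .sub (chartE k v e) (.mul (.const κ) (chartE k u e))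

/-- The expression for `coneKey₂`. -/
def coneKeyE₂ (k u v : ℕ) (κ d : ℚ) (e : WExp) : RExp :=
  .sub (.mul (.const (κ + d)) (chartE k u e)) (chartE k v e)

/-- Sorting by the first key of a cone, and by the second one in case of a tie. -/
noncomputable def coneLe₁ (k u v : ℕ) (κ d : ℚ) (a b : ℕ → ℝ) : Bool :=
  coneKey₁ k u v κ a < coneKey₁ k u v κ b ∨
    (coneKey₁ k u v κ a ≤ coneKey₁ k u v κ b ∧ coneKey₂ k u v κ d a ≤ coneKey₂ k u v κ d b)

/-- Sorting by the second key of a cone in descending order. -/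
noncomputable def coneLe₂ (k u v : ℕ) (κ d : ℚ) (a b : ℕ → ℝ) : Bool :=
  coneKey₂ k u v κ d b ≤ coneKey₂ k u v κ d a

/-- The test for `coneLe₁`. -/
def coneTest₁ (k u v : ℕ) (κ d : ℚ) (e f : WExp) : Test :=
  .neg (.both (.neg (.realLt (coneKeyE₁ k u v κ e) (coneKeyE₁ k u v κ f)))
    (.neg (.both (.neg (.realLt (coneKeyE₁ k u v κ f) (coneKeyE₁ k u v κ e)))
      (.neg (.realLt (coneKeyE₂ k u v κ d f) (coneKeyE₂ k u v κ d e))))))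

/-- The test for `coneLe₂`. -/
def coneTest₂ (k u v : ℕ) (κ d : ℚ) (e f : WExp) : Test :=
  .neg (.realLt (coneKeyE₂ k u v κ d e) (coneKeyE₂ k u v κ d f))

/-- The program for a cell and a cone: find the edges of the theta graph. -/
def nearProg (m : ℕ) : NearTask → Prog
  | ((k, u, v), x₀, y₀, κ) =>
    dominance (coneTest₁ k u v κ (1 / m)) (coneTest₂ k u v κ (1 / m))
      (cellTest (fun e => sqE (vecE k e)) k u v x₀ y₀ (1 / m)) (chartE k u)

/-- What the program for a cell and a cone achieves. -/
def NearGoal (n : ℕ) (vec : ℕ → ℕ → ℝ) (m : ℕ) : NearTask → ℝ → Prop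
  | ((k, u, v), x₀, y₀, κ) => DominanceGoal n vec
      (fun i => InCell (fun a => a k * a k) k u v x₀ y₀ (1 / m) (vec i))
      (fun i => chart k u (vec i)) (fun i j => coneLe₁ k u v κ (1 / m) (vec i) (vec j))
      (fun i j => coneLe₂ k u v κ (1 / m) (vec i) (vec j))

theorem NearGoal.anti (m : ℕ) (a : NearTask) : Antitone (NearGoal n vec m a) := by
  intro s s' hs h i hi j hj hij h1 h2 h3 h4
  obtain ⟨c, hc⟩ := h i hi j hj hij h1 h2 h3 h4
  refine ⟨c, hc.imp ?_ (And.imp_right ?_)⟩ <;>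
  exact fun ⟨g1, g2, g3, g4, g5, g6, g7⟩ => ⟨g1, g2, g3, g4, g5, g6, hs.trans g7⟩

theorem wp_nearProg (hw : 2 * n + 1 < 2 ^ w) {m : ℕ} {a : NearTask} (ha : a ∈ nearTasks m)
    {μ : Memory w} (ok : Ok n vec μ) :
    WP (nearProg m a) (4 * n + 5 + 2 * sortTime n) (fun μ' => Ok n vec μ' ∧
      μ'.real 3 ≤ μ.real 3 ∧ NearGoal n vec m a (μ'.real 3)) μ := by
  obtain ⟨⟨k, u, v⟩, x₀, y₀, κ⟩ := a
  have hax : (k, u, v) ∈ axes := (List.mem_product.1 ha).1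
  obtain ⟨hk, hu, hv⟩ := axes_lt hax
  have key₁ : Computes vec (coneKeyE₁ k u v κ) fun i => coneKey₁ k u v κ (vec i) := by
    intro w μ h e
    simp only [coneKeyE₁, RExp.eval, computes_chartE hk hu h, computes_chartE hk hv h, coneKey₁]
  have key₂ : Computes vec (coneKeyE₂ k u v κ (1 / m))
      fun i => coneKey₂ k u v κ (1 / m) (vec i) := by
    intro w μ h e
    simp only [coneKeyE₂, RExp.eval, computes_chartE hk hu h, computes_chartE hk hv h, coneKey₂]
  refine wp_dominance hw ?_ ?_ (decides_cellTest (s := fun a => a k * a k) ?_ hax x₀ y₀ _)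
    (computes_chartE hk hu) ?_ ?_ ?_ ?_ ?_ ok
  · intro w μ h e f
    simp only [coneTest₁, Test.Holds, key₁ h, key₂ h, coneLe₁, decide_eq_true_eq, ← not_lt]
    tauto
  · intro w μ h e f
    simp only [coneTest₂, Test.Holds, key₂ h, coneLe₂, decide_eq_true_eq, not_lt]
  · intro w μ h e
    simp only [sqE, RExp.eval, eval_vecE h hk]
  · intro a b c
    simp only [coneLe₁, decide_eq_true_eq]
    rintro (h1 | ⟨h1, h2⟩) (h3 | ⟨h3, h4⟩)
    · exact Or.inl (h1.trans h3)
    · exact Or.inl (h1.trans_le h3)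
    · exact Or.inl (h1.trans_lt h3)
    · exact Or.inr ⟨h1.trans h3, h2.trans h4⟩
  · intro a b
    simp only [coneLe₁, Bool.or_eq_true, decide_eq_true_eq]
    rcases lt_trichotomy (coneKey₁ k u v κ (vec a)) (coneKey₁ k u v κ (vec b)) with h | h | h
    · exact Or.inl (Or.inl h)
    · exact (le_total (coneKey₂ k u v κ (1 / m) (vec a)) (coneKey₂ k u v κ (1 / m) (vec b))).imp
        (fun h' => Or.inr ⟨h.le, h'⟩) (fun h' => Or.inr ⟨h.ge, h'⟩)
    · exact Or.inr (Or.inl h)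
  · intro a b c
    simp only [coneLe₂, decide_eq_true_eq]
    exact fun h1 h2 => h2.trans h1
  · intro a b
    simp only [coneLe₂, Bool.or_eq_true, decide_eq_true_eq]
    exact le_total _ _
  · intro a b
    simp only [coneLe₁, coneLe₂, decide_eq_true_eq]
    rintro (h1 | ⟨h1, h2⟩) (h3 | ⟨h3, h4⟩)
    · exact absurd h1 h3.not_gt
    · exact absurd h1 h3.not_gt
    · exact absurd h3 h1.not_gt
    · exact h4

/-! ### The approximation guarantee -/

theorem lineSq_eq_zero {k u v : ℕ} (hax : (k, u, v) ∈ axes) {a b : ℕ → ℝ} (ha : a k ≠ 0)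
    (hb : b k ≠ 0) (hu : chart k u a = chart k u b) (hv : chart k v a = chart k v b) :
    lineSq a b = 0 := by
  rw [chart, chart, div_eq_div_iff ha hb] at hu hv
  have hk : a u * b v = a v * b u := by
    have : (a k * b k) * (a u * b v - a v * b u) = 0 := by
      linear_combination (a k * b v) * hu - (a k * b u) * hv
    have := (mul_eq_zero.1 this).resolve_left (mul_ne_zero ha hb)
    linarith
  have : crossSq a b = 0 := by
    rw [crossSq_axes hax]
    have h1 : a k * b u - a u * b k = 0 := by linarith
    have h2 : a k * b v - a v * b k = 0 := by linarith
    have h3 : a u * b v - a v * b u = 0 := by linarith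
    rw [h1, h2, h3]
    norm_num
  rw [lineSq_eq, this, zero_div]

theorem exists_axes (a : ℕ → ℝ) : ∃ k u v, (k, u, v) ∈ axes ∧ |a u| ≤ |a k| ∧ |a v| ≤ |a k| := by
  rcases le_total |a 0| |a 1| with h1 | h1 <;> rcases le_total |a 1| |a 2| with h2 | h2 <;>
    rcases le_total |a 0| |a 2| with h3 | h3
  · exact ⟨2, 0, 1, by simp [axes], h3, h2⟩
  · exact ⟨2, 0, 1, by simp [axes], h1.trans h2, h2⟩
  · exact ⟨1, 0, 2, by simp [axes], h1, h2⟩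
  · exact ⟨1, 0, 2, by simp [axes], h1, h2⟩
  · exact ⟨2, 0, 1, by simp [axes], h3, h2⟩
  · exact ⟨0, 1, 2, by simp [axes], h1, h3⟩
  · exact ⟨2, 0, 1, by simp [axes], h3, h1.trans h3⟩
  · exact ⟨0, 1, 2, by simp [axes], h1, h3⟩

/-- The step towards another point of the cell that the tasks for the cones with slopes between
`-1` and `1` provide. -/
theorem exists_cone_step {k u v m : ℕ} (hax : (k, u, v) ∈ axes) (hm : 0 < m) {x₀ y₀ : ℚ} {s : ℝ}
    (hs : 0 < s) (hnear : ∀ κ ∈ grid m, NearGoal n vec m ((k, u, v), x₀, y₀, κ) s)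
    {i j : ℕ} (hi : i < n) (hj : j < n) (hij : i ≠ j)
    (hci : InCell (fun a => a k * a k) k u v x₀ y₀ (1 / m) (vec i))
    (hcj : InCell (fun a => a k * a k) k u v x₀ y₀ (1 / m) (vec j))
    (hle : |chart k v (vec j) - chart k v (vec i)| ≤ |chart k u (vec j) - chart k u (vec i)|) :
    ∃ i' j', (i' = i ∧ j' = j ∨ i' = j ∧ j' = i) ∧ ∃ c < n,
      InCell (fun a => a k * a k) k u v x₀ y₀ (1 / m) (vec c) ∧ ∃ l : ℝ, 0 < l ∧ l ≤ 1 ∧ c ≠ i' ∧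
      s ≤ lineSq (vec i') (vec c) ∧ 0 < chart k u (vec j') - chart k u (vec i') ∧
      chart k u (vec c) - chart k u (vec i') = l * (chart k u (vec j') - chart k u (vec i')) ∧
      |(chart k v (vec c) - chart k v (vec i')) - l * (chart k v (vec j') - chart k v (vec i'))| ≤
        1 / m * (l * (chart k u (vec j') - chart k u (vec i'))) := by
  wlog hX : chart k u (vec i) ≤ chart k u (vec j) generalizing i j
  · obtain ⟨i', j', hor, h⟩ := this hj hi hij.symm hcj hci
      (by rwa [abs_sub_comm, abs_sub_comm (chart k u _)]) (not_le.1 hX).le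
    exact ⟨i', j', hor.symm, h⟩
  have hm' : (0 : ℝ) < m := Nat.cast_pos.2 hm
  have hne : ∀ {c}, InCell (fun a => a k * a k) k u v x₀ y₀ (1 / m) (vec c) → vec c k ≠ 0 := by
    intro c hc h0
    have := hc.1
    simp [h0] at this
  set p := chart k u (vec j) - chart k u (vec i) with hp
  set q := chart k v (vec j) - chart k v (vec i) with hq
  have hp0 : 0 ≤ p := by linarith
  rw [abs_of_nonneg hp0] at hle
  -- a cone that contains the direction from `i` to `j`
  obtain ⟨κ, hκ, hκ1, hκ2⟩ : ∃ κ ∈ grid m, κ * p ≤ q ∧ q ≤ (κ + 1 / m) * p := by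
    rcases hp0.eq_or_lt with hp0 | hp0
    · obtain ⟨κ, hκ, -⟩ := exists_mem_grid hm (x := 0) (by simp)
      rw [← hp0] at hle
      have : q = 0 := abs_eq_zero.1 (le_antisymm hle (abs_nonneg _))
      exact ⟨κ, hκ, by rw [← hp0, this]; simp, by rw [← hp0, this]; simp⟩
    · obtain ⟨κ, hκ, h1, h2, -⟩ := exists_mem_grid hm (x := q / p)
        (by rw [abs_div, abs_of_pos hp0]; exact div_le_one_of_le₀ hle hp0.le)
      exact ⟨κ, hκ, (le_div_iff₀ hp0).1 h1, (div_le_iff₀ hp0).1 h2⟩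
  have hcast : ((κ + 1 / m : ℚ) : ℝ) = κ + 1 / m := by push_cast; rfl
  -- if the step has no length, then the line through its ends contains the origin
  have hstep : ∀ {a c}, InCell (fun a => a k * a k) k u v x₀ y₀ (1 / m) (vec a) →
      InCell (fun a => a k * a k) k u v x₀ y₀ (1 / m) (vec c) →
      s ≤ lineSq (vec a) (vec c) →
      coneKey₁ k u v κ (vec a) ≤ coneKey₁ k u v κ (vec c) →
      coneKey₂ k u v κ (1 / m) (vec a) ≤ coneKey₂ k u v κ (1 / m) (vec c) →
      chart k u (vec a) < chart k u (vec c) := by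
    intro a c ha hc hle h1 h2
    simp only [coneKey₁, coneKey₂, hcast] at h1 h2
    by_contra hneg
    have h3 : 0 ≤ 1 / (m : ℝ) * (chart k u (vec c) - chart k u (vec a)) := by linarith
    have h4 := (mul_nonneg_iff_of_pos_left (by positivity : 0 < 1 / (m : ℝ))).1 h3
    have h5 : chart k u (vec a) = chart k u (vec c) := by linarith
    rw [h5] at h1 h2
    have := lineSq_eq_zero hax (hne ha) (hne hc) h5 (by linarith)
    linarith
  have k1 : coneKey₁ k u v κ (vec i) ≤ coneKey₁ k u v κ (vec j) := by
    simp only [coneKey₁]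
    linarith
  have k2 : coneKey₂ k u v κ (1 / m) (vec i) ≤ coneKey₂ k u v κ (1 / m) (vec j) := by
    simp only [coneKey₂, hcast]
    linarith
  obtain ⟨c, ⟨g1, g2, g3, g4, g5, g6, g7⟩ | ⟨h0, g1, g2, g3, g4, g5, g6, g7⟩⟩ :=
    hnear κ hκ i hi j hj hij hci hcj (decide_eq_true (Or.inr ⟨k1, k2⟩))
      (decide_eq_true k2)
  · simp only [coneLe₁, coneLe₂, decide_eq_true_eq] at g4 g5
    have l1 : coneKey₁ k u v κ (vec i) ≤ coneKey₁ k u v κ (vec c) :=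
      g4.elim le_of_lt And.left
    have hlt := hstep hci g3 g7 l1 g5
    simp only [coneKey₁, coneKey₂, hcast] at l1 g5
    set pc := chart k u (vec c) - chart k u (vec i) with hpc
    have hpc0 : 0 < pc := by linarith
    have hpcp : pc ≤ p := by linarith
    have hp1 : 0 < p := by linarith
    have el : pc / p * p = pc := div_mul_cancel₀ _ hp1.ne'
    refine ⟨i, j, Or.inl ⟨rfl, rfl⟩, c, g1, g3, pc / p, by positivity,
      div_le_one_of_le₀ hpcp hp1.le, g2, g7, hp1, el.symm, ?_⟩
    have b1 := mul_le_mul_of_nonneg_left hκ1 (div_nonneg hpc0.le hp1.le)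
    have b2 := mul_le_mul_of_nonneg_left hκ2 (div_nonneg hpc0.le hp1.le)
    have e1 : pc / p * (κ * p) = κ * pc := by rw [mul_left_comm, el]
    have e2 : pc / p * ((κ + 1 / m) * p) = (κ + 1 / m) * pc := by rw [mul_left_comm, el]
    rw [e1] at b1
    rw [e2] at b2
    rw [el, abs_le]
    constructor <;> linarith
  · simp only [coneLe₁, coneLe₂, decide_eq_true_eq] at h0 g4 g5
    have l1 : coneKey₁ k u v κ (vec j) ≤ coneKey₁ k u v κ (vec c) :=
      g4.elim le_of_lt And.left
    have hlt := hstep hcj g3 g7 l1 g5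
    simp only at g6
    linarith

/-- The pair found is a good approximation. The angle from which on directions count as far apart is
`1 / (24 * m)`; directions closer than that share a cell of radius `1 / m`, and it is large compared
to the radius `1 / m ^ 2` of the oriented cells. -/
theorem approx_of_goals {m : ℕ} (hm : 192 < m) {ε : ℝ}
    (hε : ((1 + 192 / (m : ℝ)) / (1 - 192 / m)) ^ 4 ≤ 1 + ε) {s : ℝ}
    (hd : ∀ i < n, ∀ j < n, i ≠ j → 0 < distSq (vec i) (vec j))
    (hall : ScanGoal n vec (fun _ => True) (fun i => normSq (vec i)) s)
    (hfar : ∀ a ∈ farTasks m, FarGoal n vec m a s)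
    (hnear : ∀ a ∈ nearTasks m, NearGoal n vec m a s) :
    ∀ i < n, ∀ j < n, i ≠ j → s ≤ (1 + ε) ^ 2 * lineSq (vec i) (vec j) := by
  intro i hi j hj hij
  rcases le_or_gt s 0 with hs | hs
  · exact hs.trans (mul_nonneg (sq_nonneg _) (lineSq_nonneg _ _))
  have hm' : (192 : ℝ) < m := by exact_mod_cast hm
  have hm0 : (0 : ℝ) < m := by linarith
  have hτ1 : 192 / (m : ℝ) < 1 := (div_lt_one hm0).2 hm'
  set Q := (1 + 192 / (m : ℝ)) / (1 - 192 / m) with hQ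
  have hτpos : 0 < 1 - 192 / (m : ℝ) := by linarith
  have hτ0 : 0 < 192 / (m : ℝ) := by positivity
  have hQ1 : 1 ≤ Q := (one_le_div hτpos).2 (by linarith)
  -- a point at the origin would have been found by the task without a cell
  have hN : ∀ a < n, 0 < normSq (vec a) := by
    intro a ha
    by_contra hneg
    obtain ⟨b, hb, -, hle, hb'⟩ := hall a ha trivial
    have h0 : normSq (vec b) = 0 := le_antisymm (hle.trans (not_lt.1 hneg)) (normSq_nonneg _)
    have h1 : toE (vec b) = 0 := by
      rw [← norm_eq_zero, norm_toE, h0, Real.sqrt_zero]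
    have h2 : ∀ c, lineSq (vec b) c = 0 := by
      intro c
      rw [lineSq_eq, ← norm_sq_cr_toE, h1]
      have : cr 0 (toE c) = 0 := by simpa using cr_smul 0 0 (toE c)
      rw [this]
      simp
    by_cases hbi : i = b
    · have := hb' j hj (by rw [← hbi]; exact hij.symm)
      rw [h2] at this
      linarith
    · have := hb' i hi hbi
      rw [h2] at this
      linarith
  by_cases hsin : 1 / (24 * (m : ℝ)) ≤ sine (vec i) (vec j)
  · wlog hle : normSq (vec i) ≤ normSq (vec j) generalizing i j
    · rw [lineSq_comm]
      refine this j hj i hi hij.symm ?_ (not_le.1 hle).le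
      refine hsin.trans_eq ?_
      rw [sine, sine, mul_comm]
      congr 2
      unfold crossSq
      ring
    obtain ⟨k, u, v, hax, hu, hv⟩ := exists_axes (vec i)
    have hk : vec i k ≠ 0 := by
      intro h0
      have := hN i hi
      rw [h0, abs_zero] at hu hv
      rw [normSq_axes hax, h0, abs_eq_zero.1 (le_antisymm hu (abs_nonneg _)),
        abs_eq_zero.1 (le_antisymm hv (abs_nonneg _))] at this
      norm_num at this
    have hX : |chart k u (vec i)| ≤ 1 := by
      rw [chart, abs_div]
      exact div_le_one_of_le₀ hu (abs_nonneg _)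
    have hY : |chart k v (vec i)| ≤ 1 := by
      rw [chart, abs_div]
      exact div_le_one_of_le₀ hv (abs_nonneg _)
    have hm2 : 0 < m ^ 2 := by positivity
    obtain ⟨x₀, hx₀, hx1, hx2, -⟩ := exists_mem_grid hm2 hX
    obtain ⟨y₀, hy₀, hy1, hy2, -⟩ := exists_mem_grid hm2 hY
    obtain ⟨σ, hσ, hσ1, hσk⟩ : ∃ σ ∈ ([1, -1] : List ℚ), |(σ : ℝ)| = 1 ∧ 0 < σ * vec i k := by
      rcases hk.lt_or_gt with h | h
      · exact ⟨-1, by simp, by simp, by simpa⟩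
      · exact ⟨1, by simp, by simp, by simpa⟩
    have hr : ((1 / m ^ 2 : ℚ) : ℝ) = 1 / (m : ℝ) ^ 2 := by push_cast; rfl
    have hr0 : 0 < 1 / (m : ℝ) ^ 2 := by positivity
    have hcast : ((m ^ 2 : ℕ) : ℝ) = (m : ℝ) ^ 2 := by push_cast; rfl
    rw [hcast] at hx2 hy2
    have hcell : InCell (fun a => σ * a k) k u v x₀ y₀ (1 / m ^ 2) (vec i) := by
      refine ⟨hσk, ?_, ?_⟩ <;> rw [hr, abs_le] <;> constructor <;> linarith
    obtain ⟨b, hb, hcb, hble, hbj⟩ := hfar ((k, u, v), σ, x₀, y₀)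
      (by simp only [farTasks, List.mem_product]; exact ⟨hax, hσ, hx₀, hy₀⟩) i hi hcell
    obtain ⟨-, c1, c2⟩ := hcell
    obtain ⟨c3, c4, c5⟩ := hcb
    rw [hr] at c1 c2 c4 c5
    obtain ⟨hne, hfin⟩ := far_le hax (τ := 192 / m) (δ := 1 / (24 * m)) hσ1 hσk c3 c1 c2 c4 c5 hble hle
      hr0.le hτ1 (by positivity) (le_of_eq (by field_simp; norm_num)) hsin
    refine (hbj j hj (fun h => hne (by rw [h]))).trans (hfin.trans ?_)
    have : Q ≤ Q ^ 4 := le_self_pow₀ hQ1 (by norm_num)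
    gcongr
    · exact lineSq_nonneg _ _
    · linarith
  · obtain ⟨k, u, v, hax, hu, hv⟩ := exists_axes (vec i)
    obtain ⟨hik, hjk, hX, hY, hXX, hYY⟩ := chart_near hax (hN i hi) (hN j hj) hu hv
      (δ := 1 / (24 * m)) (by positivity)
      (by rw [mul_one_div, div_le_one (by positivity)]; linarith) (not_le.1 hsin).le
    have hm2 : 0 < 2 * m := by omega
    obtain ⟨x₀, hx₀, hx1, hx2, hx3⟩ := exists_mem_grid hm2 hX
    obtain ⟨y₀, hy₀, hy1, hy2, hy3⟩ := exists_mem_grid hm2 hY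
    have hr : ((1 / m : ℚ) : ℝ) = 1 / (m : ℝ) := by push_cast; rfl
    have e12 : 12 * (1 / (24 * (m : ℝ))) = 1 / m / 2 := by field_simp; norm_num
    have e2 : 1 / ((2 * m : ℕ) : ℝ) = 1 / m / 2 := by push_cast; field_simp
    rw [e12, abs_le] at hXX hYY
    rw [e2] at hx2 hy2
    have hr0 : 0 < 1 / (m : ℝ) := by positivity
    set p : ℕ → Prop := fun a => InCell (fun a => a k * a k) k u v x₀ y₀ (1 / m) (vec a) with hp
    have hpi : p i := by
      refine ⟨mul_self_pos.2 hik, ?_, ?_⟩ <;> rw [hr, abs_le] <;> constructor <;> linarith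
    have hpj : p j := by
      refine ⟨mul_self_pos.2 hjk, ?_, ?_⟩ <;> rw [hr, abs_le] <;> constructor <;> linarith
    classical
    set S := (Finset.range n).filter p with hS
    have memS : ∀ {a}, a ∈ S ↔ a < n ∧ p a := by simp [hS]
    have hη1 : 2 * (1 / (m : ℝ)) < 1 := by
      have : 2 * (1 / (m : ℝ)) ≤ 192 / m := by
        rw [mul_one_div]
        gcongr
        norm_num
      linarith
    have hfin := near_le hax vec S (η := 1 / m) (s := Real.sqrt s) hx3 hy3 hr0.le hη1
      (Real.sqrt_pos.2 hs) (fun a ha h0 => by simpa [h0] using (memS.1 ha).2.1)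
      (fun a ha => by simpa using (memS.1 ha).2.2.1)
      (fun a ha => by simpa using (memS.1 ha).2.2.2)
      (fun a ha b hb hab => hd a (memS.1 ha).1 b (memS.1 hb).1 hab) ?_ i (memS.2 ⟨hi, hpi⟩) j
      (memS.2 ⟨hj, hpj⟩) hij
    · rw [Real.sq_sqrt hs.le] at hfin
      refine hfin.trans ?_
      have h1 : (1 + 2 * (1 / (m : ℝ))) / (1 - 2 * (1 / m)) ≤ Q := by
        have h2 : 2 * (1 / (m : ℝ)) ≤ 192 / m := by
          rw [mul_one_div]
          gcongr
          norm_num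
        exact div_le_div₀ (by linarith) (by linarith) hτpos (by linarith)
      have h3 : 0 ≤ (1 + 2 * (1 / (m : ℝ))) / (1 - 2 * (1 / m)) :=
        div_nonneg (by positivity) (by linarith)
      have h4 : ((1 + 2 * (1 / (m : ℝ))) / (1 - 2 * (1 / m))) ^ 4 ≤ 1 + ε :=
        (pow_le_pow_left₀ h3 h1 4).trans hε
      gcongr
      exact lineSq_nonneg _ _
    · intro a ha b hb hab
      obtain ⟨ha1, ha2⟩ := memS.1 ha
      obtain ⟨hb1, hb2⟩ := memS.1 hb
      rw [Real.sq_sqrt hs.le]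
      rcases le_total |chart k v (vec b) - chart k v (vec a)|
        |chart k u (vec b) - chart k u (vec a)| with hle | hle
      · obtain ⟨i', j', hor, c, hc1, hc2, l, hl0, hl1, hne, hsl, hpos, hXc, hYc⟩ :=
          exists_cone_step hax (by omega) hs (fun κ hκ => hnear ((k, u, v), x₀, y₀, κ)
            (by simp only [nearTasks, List.mem_product]; exact ⟨hax, hx₀, hy₀, hκ⟩))
            ha1 hb1 hab ha2 hb2 hle
        refine ⟨i', j', hor, c, memS.2 ⟨hc1, hc2⟩, l, hl0, hl1, hne, hsl, _, hpos,
          Or.inl (le_abs_self _), ?_⟩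
        rw [hXc, sub_self, abs_zero, zero_add]
        exact hYc
      · have swap : ∀ {a}, p a → InCell (fun a => a k * a k) k v u y₀ x₀ (1 / m) (vec a) :=
          fun h => ⟨h.1, h.2.2, h.2.1⟩
        obtain ⟨i', j', hor, c, hc1, hc2, l, hl0, hl1, hne, hsl, hpos, hXc, hYc⟩ :=
          exists_cone_step (axes_swap hax) (by omega) hs (fun κ hκ => hnear ((k, v, u), y₀, x₀, κ)
            (by simp only [nearTasks, List.mem_product]; exact ⟨axes_swap hax, hy₀, hx₀, hκ⟩))
            ha1 hb1 hab (swap ha2) (swap hb2) hle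
        refine ⟨i', j', hor, c, memS.2 ⟨hc1, hc2.1, hc2.2.2, hc2.2.1⟩, l, hl0, hl1, hne, hsl, _, hpos,
          Or.inr (le_abs_self _), ?_⟩
        rw [hXc, sub_self, abs_zero, add_zero]
        exact hYc

/-! ### The program -/

/-- The nearest line program with resolution `1 / m`. -/
def program (m : ℕ) : Prog :=
  .seq (.setWord 2 (.const 1)) (.seq (.setReal 3 (lineSqE (.var 1) (.var 2)))
    (.seq (scanCell (fun e => .neg (.wordLt e e)) normSqE)
      (.seq (.all ((farTasks m).map (farProg m))) (.all ((nearTasks m).map (nearProg m))))))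

/-- An upper bound for the running time of the program. -/
def programTime (m n : ℕ) : ℕ :=
  14 * n + 16 + ((farTasks m).length * (14 * n + 10) + 1) +
    ((nearTasks m).length * (4 * n + 6 + 2 * sortTime n) + 1)

/-- The coordinates of the vectors from the query point to the points, and `0` for indices out of
range in agreement with the initial memory. -/
noncomputable def inputVec {n : ℕ} (p : Fin n ↪ E3) (y : E3) (i c : ℕ) : ℝ :=
  (if h : c < 3 ∧ i < n then p ⟨i, h.2⟩ ⟨c, h.1⟩ else 0) - (if h : c < 3 then y ⟨c, h⟩ else 0)

theorem inputVec_eq {n : ℕ} (p : Fin n ↪ E3) (y : E3) (i : Fin n) (c : Fin 3) :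
    inputVec p y i c = p i c - y c := by
  simp [inputVec]

theorem lineDist_sq_input {n : ℕ} (p : Fin n ↪ E3) (y : E3) {i j : Fin n} (h : i ≠ j) :
    lineDist y (p i) (p j) ^ 2 = lineSq (inputVec p y i) (inputVec p y j) :=
  lineDist_sq (inputVec_eq p y i) (inputVec_eq p y j) fun h' => h (p.injective h')

theorem distSq_input_pos {n : ℕ} (p : Fin n ↪ E3) (y : E3) {i j : Fin n} (h : i ≠ j) :
    0 < distSq (inputVec p y i) (inputVec p y j) := by
  have h1 : 0 < ‖p i - p j‖ := norm_pos_iff.2 (sub_ne_zero.2 fun h' => h (p.injective h'))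
  have h2 : distSq (inputVec p y i) (inputVec p y j) = ‖p i - p j‖ ^ 2 := by
    have e (i : Fin n) : inputVec p y i 0 = p i 0 - y 0 ∧ inputVec p y i 1 = p i 1 - y 1 ∧
        inputVec p y i 2 = p i 2 - y 2 :=
      ⟨inputVec_eq p y i 0, inputVec_eq p y i 1, inputVec_eq p y i 2⟩
    rw [norm_sq_E3, distSq, (e i).1, (e i).2.1, (e i).2.2, (e j).1, (e j).2.1, (e j).2.2]
    simp only [PiLp.sub_apply]
    ring
  rw [h2]
  positivity

theorem hasVec_input {w n : ℕ} (p : Fin n ↪ E3) (y : E3) :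
    HasVec (inputVec p y) (inputMemory w p y) := by
  intro c hc b
  simp [inputMemory, inputVec, hc]

theorem wp_program {ε : ℝ} (hε : 0 < ε) {m : ℕ} (hm : 192 < m)
    (hεm : ((1 + 192 / (m : ℝ)) / (1 - 192 / m)) ^ 4 ≤ 1 + ε) {w n : ℕ} (p : Fin n ↪ E3) (y : E3)
    (hn : 2 ≤ n) (hw : 2 * n + 1 < 2 ^ w) :
    WP (program m) (programTime m n) (IsApproxOutput ε p y) (inputMemory w p y) := by
  refine (wp_seq (T₁ := 1) (wp_setWord (wp_seq (T₁ := 1) (wp_setReal (wp_seq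
    ((wp_scanCell (n := n) (vec := inputVec p y) (p := fun _ => True)
      (k := fun i => normSq (inputVec p y i)) (by omega) ?_ ?_ ?_).mono le_rfl ?_)))))).mono
    (T := 1 + 1 + (1 + 1 + (1 + (14 * n + 9) + (1 + ((farTasks m).length * (14 * n + 9 + 1) + 1) +
      ((nearTasks m).length * (4 * n + 5 + 2 * sortTime n + 1) + 1)))))
    (by
      rw [programTime, show 14 * n + 10 = 14 * n + 9 + 1 by omega,
        show 4 * n + 6 + 2 * sortTime n = 4 * n + 5 + 2 * sortTime n + 1 by omega]
      omega) fun _ h => h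
  · intro w μ _ e
    simp [Test.Holds]
  · intro w μ h e
    exact eval_normSqE h e
  · have h1 : ((WExp.const 1).eval (inputMemory w p y)).toNat = 1 := toNat_const _ (by omega)
    have h0 : reg (inputMemory w p y) 0 = n := by
      simp [reg, inputMemory, Nat.mod_eq_of_lt (show n < 2 ^ w by omega)]
    have h2 : reg (inputMemory w p y) 1 = 0 := by simp [reg, inputMemory]
    have h3 : HasVec (inputVec p y) (setW (inputMemory w p y) 2
        ((WExp.const 1).eval (inputMemory w p y))) := hasVec_input p y
    refine ⟨?_, ?_, ?_, ?_, ?_, ?_⟩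
    · simpa only [reg_setR, reg_setW, show (0 : ℕ) ≠ 2 by norm_num, if_false] using h0
    · intro c hc b
      have hc3 : c ≠ 3 := by omega
      simpa [hc3] using h3 c hc b
    · simp only [reg_setR, reg_setW, show (1 : ℕ) ≠ 2 by norm_num, if_false, h2]
      omega
    · simp only [reg_setR, reg_setW, if_true, h1]
      omega
    · simp only [reg_setR, reg_setW, show (1 : ℕ) ≠ 2 by norm_num, if_false, if_true, h1, h2]
      norm_num
    · rw [eval_lineSqE h3, toNat_var, toNat_var, real_setR, if_pos rfl]
      rfl
  · rintro μ₁ ⟨ok₁, -, goal₁⟩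
    refine wp_seq ((wp_all (farProg m) (Ok n (inputVec p y)) (FarGoal n (inputVec p y) m)
      (FarGoal.anti m) (14 * n + 9) (farTasks m)
      (fun a ha μ ok => wp_farProg (by omega) ha ok) μ₁ ok₁).mono le_rfl ?_)
    rintro μ₂ ⟨ok₂, le₂, goal₂⟩
    refine (wp_all (nearProg m) (Ok n (inputVec p y)) (NearGoal n (inputVec p y) m)
      (NearGoal.anti m) (4 * n + 5 + 2 * sortTime n) (nearTasks m)
      (fun a ha μ ok => wp_nearProg hw ha ok) μ₂ ok₂).mono le_rfl ?_
    rintro μ₃ ⟨ok₃, le₃, goal₃⟩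
    have happ := approx_of_goals hm hεm (s := μ₃.real 3)
      (fun i hi j hj hij => distSq_input_pos p y (i := ⟨i, hi⟩) (j := ⟨j, hj⟩) (by simpa using hij))
      (ScanGoal.anti (le₃.trans le₂) goal₁) (fun a ha => FarGoal.anti m a le₃ (goal₂ a ha)) goal₃
    have hne : (⟨reg μ₃ 1, ok₃.lt_one⟩ : Fin n) ≠ ⟨reg μ₃ 2, ok₃.lt_two⟩ := by
      simpa using ok₃.ne
    refine ⟨_, _, hne, rfl, rfl, fun a b hab => ?_⟩
    have h0 (a b : E3) : 0 ≤ lineDist y a b := Metric.infDist_nonneg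
    refine (pow_le_pow_iff_left₀ (h0 _ _) (mul_nonneg (by positivity) (h0 _ _)) two_ne_zero).1 ?_
    rw [mul_pow, lineDist_sq_input p y hab, lineDist_sq_input p y hne, ← ok₃.real_three]
    exact happ a a.2 b b.2 fun h => hab (Fin.ext h)

/-! ### The running time -/

theorem clog_le_log_pow {n : ℕ} (hn : 2 ≤ n) : (Nat.clog 2 n : ℝ) ≤ 9 * Real.log n ^ 3 := by
  have hlog2 := Real.log_two_gt_d9
  have hlog : Real.log 2 ≤ Real.log n := Real.log_le_log (by norm_num) (by exact_mod_cast hn)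
  set x := Real.log n with hx
  have h1 : Nat.clog 2 n ≤ Nat.log 2 n + 1 := Nat.clog_le_of_le_pow
    (Nat.lt_pow_succ_log_self (by norm_num) n).le
  have h2 : (Nat.log 2 n : ℝ) * Real.log 2 ≤ x := by
    rw [← Real.log_pow]
    refine Real.log_le_log (by positivity) ?_
    exact_mod_cast Nat.pow_log_le_self 2 (by omega)
  have h3 : (Nat.clog 2 n : ℝ) ≤ Nat.log 2 n + 1 := by exact_mod_cast h1
  have h4 : (Nat.log 2 n : ℝ) ≤ 3 / 2 * x := by
    have : (0 : ℝ) ≤ Nat.log 2 n := by positivity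
    nlinarith
  have h5 : (1 : ℝ) ≤ 3 / 2 * x := by linarith
  have h6 : x ≤ 3 * x ^ 3 := by nlinarith [mul_self_nonneg (x - 1), mul_pos (by linarith : 0 < x) (by linarith : 0 < x)]
  linarith

theorem programTime_le (m : ℕ) : ∃ C : ℕ, ∀ n, 2 ≤ n → programTime m n ≤ C * (n * Nat.clog 2 n) := by
  refine ⟨32 + 24 * (farTasks m).length + 120 * (nearTasks m).length, fun n hn => ?_⟩
  have hc : 1 ≤ Nat.clog 2 n := Nat.clog_pos (by norm_num) hn
  have h1 : n ≤ n * Nat.clog 2 n := Nat.le_mul_of_pos_right n hc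
  have h2 : 1 ≤ n * Nat.clog 2 n := by omega
  have h3 : Nat.clog 2 n ≤ n * Nat.clog 2 n := Nat.le_mul_of_pos_left _ (by omega)
  set N := n * Nat.clog 2 n with hN
  have h4 : sortTime n ≤ 53 * N := by
    have : sortTime n = 40 * N + 10 * Nat.clog 2 n + 3 := by
      rw [sortTime, hN]
      ring
    omega
  have h5 : (farTasks m).length * (14 * n + 10) ≤ (farTasks m).length * (24 * N) :=
    Nat.mul_le_mul_left _ (by omega)
  have h6 : (nearTasks m).length * (4 * n + 6 + 2 * sortTime n) ≤
      (nearTasks m).length * (120 * N) := Nat.mul_le_mul_left _ (by omega)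
  have h7 : (32 + 24 * (farTasks m).length + 120 * (nearTasks m).length) * N =
      32 * N + (farTasks m).length * (24 * N) + (nearTasks m).length * (120 * N) := by ring
  rw [programTime, h7]
  omega

theorem exists_resolution {ε : ℝ} (hε : 0 < ε) : ∃ m : ℕ, 192 < m ∧
    ((1 + 192 / (m : ℝ)) / (1 - 192 / m)) ^ 4 ≤ 1 + ε := by
  have h0 := tendsto_const_div_atTop_nhds_zero_nat (192 : ℝ)
  have h1 : Filter.Tendsto (fun m : ℕ => ((1 + 192 / (m : ℝ)) / (1 - 192 / m)) ^ 4) Filter.atTop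
      (nhds (((1 + 0) / (1 - 0)) ^ 4)) :=
    ((tendsto_const_nhds.add h0).div (tendsto_const_nhds.sub h0) (by norm_num)).pow 4
  obtain ⟨m, hm⟩ := ((h1.eventually_le_const (u := 1 + ε) (by norm_num; exact hε)).and
    (Filter.eventually_gt_atTop 192)).exists
  exact ⟨m, hm.2, hm.1⟩

theorem run_eq_of_halts {w : ℕ} {γ : Config w} {t₀ : ℕ} {μ₀ : Memory w}
    (h : run t₀ γ = PMF.pure ⟨[], μ₀⟩) {t : ℕ} (ht : t₀ ≤ t) : run t γ = PMF.pure ⟨[], μ₀⟩ := by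
  obtain ⟨s, rfl⟩ := Nat.exists_eq_add_of_le ht
  rw [run_add, h, PMF.pure_bind, run_halted]

theorem eq_of_halted {w : ℕ} {γ γ' : Config w} {t₀ t : ℕ} {μ₀ : Memory w}
    (h : run t₀ γ = PMF.pure ⟨[], μ₀⟩) (hγ' : γ' ∈ (run t γ).support) (hh : γ'.Halted) :
    γ' = ⟨[], μ₀⟩ := by
  obtain ⟨k, μ'⟩ := γ'
  obtain rfl : k = [] := hh
  have h1 : (⟨[], μ'⟩ : Config w) ∈ (run (t + t₀) γ).support := by
    rw [run_add, PMF.mem_support_bind_iff]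
    exact ⟨_, hγ', by rw [run_halted]; simp⟩
  rw [run_eq_of_halts h (Nat.le_add_left _ _)] at h1
  simpa using h1

end NearestLine

theorem theorem1 (ε : ℝ) (hε : 0 < ε) :
    ∃ (P : RealRAM.Prog) (κ : ℕ),
      -- whenever the program halts, its output is a `(1 + ε)`-approximation
      (∀ (n w : ℕ) (p : Fin n ↪ NearestLine.E3) (y : NearestLine.E3),
        2 ≤ n → n ^ κ ≤ 2 ^ w →
        ∀ (t : ℕ), ∀ γ ∈ (RealRAM.run t (NearestLine.start P w p y)).support,
          γ.Halted → NearestLine.IsApproxOutput ε p y γ.mem) ∧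
      -- and it halts within `O(n log ^ 3 n)` steps with high probability
      (∀ c : ℕ, ∃ C : ℝ,
        ∀ (n w : ℕ) (p : Fin n ↪ NearestLine.E3) (y : NearestLine.E3),
          2 ≤ n → n ^ κ ≤ 2 ^ w →
          1 - ((n : ℝ≥0∞) ^ c)⁻¹ ≤
            (RealRAM.run ⌊C * n * Real.log n ^ 3⌋₊ (NearestLine.start P w p y)).toOuterMeasure
              {γ | γ.Halted}) := by
  obtain ⟨m, hm, hεm⟩ := NearestLine.exists_resolution hε
  have key : ∀ (n w : ℕ) (p : Fin n ↪ NearestLine.E3) (y : NearestLine.E3), 2 ≤ n →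
      n ^ 3 ≤ 2 ^ w → ∃ t ≤ NearestLine.programTime m n, ∃ μ₀,
        RealRAM.run t (NearestLine.start (NearestLine.program m) w p y) = PMF.pure ⟨[], μ₀⟩ ∧
        NearestLine.IsApproxOutput ε p y μ₀ := by
    intro n w p y hn hw
    have h2 : 2 * n + 1 < 2 ^ w := by
      have h3 : 2 ^ 2 * n ≤ n ^ 2 * n := by gcongr
      have h4 : n ^ 3 = n ^ 2 * n := pow_succ n 2
      omega
    obtain ⟨t, ht, μ₀, he, ho⟩ := NearestLine.wp_program hε hm hεm p y hn h2
    exact ⟨t, ht, μ₀, he [], ho⟩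
  refine ⟨NearestLine.program m, 3, ?_, fun c => ?_⟩
  · intro n w p y hn hw t γ hγ hh
    obtain ⟨t₀, -, μ₀, hrun, ho⟩ := key n w p y hn hw
    rw [NearestLine.eq_of_halted hrun hγ hh]
    exact ho
  · obtain ⟨C, hC⟩ := NearestLine.programTime_le m
    refine ⟨9 * C, fun n w p y hn hw => ?_⟩
    obtain ⟨t₀, ht₀, μ₀, hrun, -⟩ := key n w p y hn hw
    have hle : t₀ ≤ ⌊9 * (C : ℝ) * n * Real.log n ^ 3⌋₊ := by
      refine Nat.le_floor ?_
      calc (t₀ : ℝ) ≤ (C * (n * Nat.clog 2 n) : ℕ) := by exact_mod_cast ht₀.trans (hC n hn)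
        _ = C * (n * (Nat.clog 2 n : ℝ)) := by push_cast; rfl
        _ ≤ C * (n * (9 * Real.log n ^ 3)) := by
            gcongr
            exact NearestLine.clog_le_log_pow hn
        _ = 9 * (C : ℝ) * n * Real.log n ^ 3 := by ring
    -- the program makes no random choices, so it halts in time with probability one
    have hone : (PMF.pure (⟨[], μ₀⟩ : RealRAM.Config w)).toOuterMeasure {γ | γ.Halted} = 1 := by
      rw [PMF.toOuterMeasure_apply_eq_one_iff]
      intro γ hγ
      rw [PMF.support_pure, Set.mem_singleton_iff] at hγ
      rw [hγ]
      rfl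
    rw [NearestLine.run_eq_of_halts hrun hle, hone]
    exact tsub_le_self
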